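/- Let $d\ge 1$ and let $X_1,X_2,\ldots$ be i.i.d. random vectors in $\mathbb R^d$ with Lebesgue density $f_0$. Put $\theta_0=\mathbb E[f_0(X_1)]$, $L_0(x)=2\{f_0(x)-\theta_0\}$ and $\sigma_0^2=\mathbb V[L_0(X_1)]$, and assume $\sigma_0^2>0$. Let $K:\mathbb R^d\to\mathbb R$ be a (measurable) kernel, $h_n>0$ a bandwidth sequence, $K_n(x)=h_n^{-d}K(x/h_n)$, let $c>0$, $c\ne1$, be a constant, and let $B_n\in\{2,\ldots,n\}$ for $n\ge 2$. **Estimators.** Let $\hat f_n(x)=\frac1n\sum_{j=1}^nK_n(x-X_j)$ and $$\hat\theta_n^{\mathtt{AD}}=\frac1n\sum_{i=1}^n\hat f_n(X_i),\qquad \hat\theta_n^{\mathtt{ISD}}=\int_{\mathbb R^d}\hat f_n(x)^2\,dx,$$ $$\hat\theta_n^{\mathtt{AD-BC}}=\hat\theta_n^{\mathtt{AD}}-\frac{K(0)}{nh_n^d},\qquad \hat\theta_n^{\mathtt{ISD-BC}}=\hat\theta_n^{\mathtt{ISD}}-\frac{\int_{\mathbb R^d} K(u)^2du}{nh_n^d}.$$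 For $\mathtt T\in\{\mathtt{AD},\mathtt{ISD}\}$ let $\hat\theta_n^{\mathtt{T-GJ}}=\frac1{1-c^d}\hat\theta_n^{\mathtt T}-\frac{c^d}{1-c^d}\hat\theta_n^{\mathtt T}(ch_n)$, where $\hat\theta_n^{\mathtt T}(ch_n)$ is $\hat\theta_n^{\mathtt T}$ computed with bandwidth $ch_n$ in place of $h_n$. Let $$\hat\theta_n^{\mathtt{AD-LO}}=\frac1n\sum_{i=1}^n\hat f_{i,n}^{\mathtt{LO}}(X_i),\qquad \hat\theta_n^{\mathtt{ISD-LO}}=\frac1n\sum_{i=1}^n\int_{\mathbb R^d}\hat f_{i,n}^{\mathtt{LO}}(x)^2dx,$$ $$\hat f_{i,n}^{\mathtt{LO}}(x)=\sum_{j=1}^nw_{ij,n}K_n(x-X_j),\qquad w_{ij,n}=\frac{\mathbf 1(\lceil iB_n/n\rceil\ne\lceil jB_n/n\rceil)}{\sum_{k=1}^n\mathbf 1(\lceil iB_n/n\rceil\ne\lceil kB_n/n\rceil)}.$$ The locally robust estimators are $\hat\theta_n^{\mathtt{LR}}=2\hat\theta_n^{\mathtt{AD}}-\hat\theta_n^{\mathtt{ISD}}$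 and $\hat\theta_n^{\mathtt{LR-V}}=2\hat\theta_n^{\mathtt{AD-V}}-\hat\theta_n^{\mathtt{ISD-V}}$ for $\mathtt V\in\{\mathtt{BC},\mathtt{GJ},\mathtt{LO}\}$. **Bootstrap consistency.** Conditionally on the data let $X_{1,n}^*,\ldots,X_{n,n}^*$ be a random sample from the empirical distribution of $X_1,\ldots,X_n$, and let $\mathbb P_n^*$ denote conditional probability given the data. For an estimator $\hat\theta_n=\hat\theta_n(X_1,\ldots,X_n)$ let $\hat\theta_n^*=\hat\theta_n(X_{1,n}^*,\ldots,X_{n,n}^*)$ (same $h_n$, $c$, $B_n$). The bootstrap is consistent for $\hat\theta_n$ if $$\sup_{t\in\mathbb R}\left|\mathbb P[\sqrt n(\hat\theta_n-\theta_0)\le t]-\mathbb P_n^*[\sqrt n(\hat\theta_n^*-\hat\theta_n)\le t]\right|\to0\quad\text{in probability as }n\to\infty.$$ **Conditions.** Let $s,P\in\mathbb R$ and $S=\min(P/2,s)$. - (D) $s>d/4$, $2s\notin\mathbb N$, and $f_0$ is bounded and belongs to the Besov space $B^s_{2\infty}(\mathbb R^d)$. - (K) $P>d/2$, $K$ is even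 and bounded, $\int_{\mathbb R^d}|K(u)|(1+\|u\|_1^P)\,du<\infty$, $\int_{\mathbb R^d} K(u)\,du=1$, and $\int_{\mathbb R^d} u^lK(u)\,du=0$ for every $l\in\mathbb Z_+^d$ with $0<\|l\|_1<P$, where $\|\cdot\|_1$ is the $\ell_1$-norm and $u^l=u_1^{l_1}\cdots u_d^{l_d}$. - (B) $nh_n^{4S}\to0$ and $nh_n^d\to\infty$. - (B$^+$) $nh_n^{4S}\to0$ and $nh_n^{2d}\to\infty$. **Theorem.** Suppose (D) and (K) hold. If (B) holds, then the bootstrap is consistent for $\hat\theta_n^{\mathtt{LR}}$ and for $\hat\theta_n^{\mathtt{LR-GJ}}$. If (B$^+$) holds, then the bootstrap is consistent for $\hat\theta_n^{\mathtt{LR-BC}}$ and for $\hat\theta_n^{\mathtt{LR-LO}}$. -/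

import Mathlib

open MeasureTheory ProbabilityTheory Filter Topology
open scoped ENNReal

namespace AvgDensity

noncomputable section

/-- The space `ℝ^d`. -/
abbrev E (d : ℕ) : Type := EuclideanSpace ℝ (Fin d)

/-! ### The density, the estimand and the variance bound -/

/-- The distribution on `ℝ^d` with Lebesgue density `f₀`. -/
def densityLaw {d : ℕ} (f₀ : E d → ℝ) : Measure (E d) :=
  volume.withDensity fun x => ENNReal.ofReal (f₀ x)

/-- The average density `θ₀ = 𝔼[f₀(X)]`, where `X` has density `f₀`. -/
def averageDensity {d : ℕ} (f₀ : E d → ℝ) : ℝ := ∫ x, f₀ x ∂(densityLaw f₀)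

/-- The efficient influence function `L₀(x) = 2 (f₀(x) - θ₀)`. -/
def influence {d : ℕ} (f₀ : E d → ℝ) (x : E d) : ℝ := 2 * (f₀ x - averageDensity f₀)

/-- The variance bound `σ₀² = 𝕍[L₀(X)]`, where `X` has density `f₀`. -/
def varianceBound {d : ℕ} (f₀ : E d → ℝ) : ℝ := variance (influence f₀) (densityLaw f₀)

/-- Membership in the Besov space `B^s_{2∞}(ℝ^d)`, for `s > 0`: `f` is square integrable and
`‖Δ_v^m f‖_{L²} ≤ C |v|^s` for all `v`, where `Δ_v f(x) = f(x + v) - f(x)` and `m` is the smallest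
integer larger than `s`. -/
def MemBesovTwoInfty {d : ℕ} (s : ℝ) (f : E d → ℝ) : Prop :=
  MemLp f 2 volume ∧
    ∃ C : ℝ, ∀ v : E d,
      eLpNorm ((fwdDiff v)^[⌊s⌋₊ + 1] f) 2 volume ≤ ENNReal.ofReal (C * ‖v‖ ^ s)

/-- Condition D on a density `f₀`, with smoothness `s`. -/
structure ConditionD {d : ℕ} (f₀ : E d → ℝ) (s : ℝ) : Prop where
  lt_smoothness : (d : ℝ) / 4 < s
  two_mul_not_nat : ∀ k : ℕ, 2 * s ≠ k
  bounded : ∃ M : ℝ, ∀ x, |f₀ x| ≤ M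
  besov : MemBesovTwoInfty s f₀

/-! ### The kernel and the bandwidth -/

/-- The `ℓ¹` norm on `ℝ^d`. -/
def l1norm {d : ℕ} (u : E d) : ℝ := ∑ i, |u i|

/-- Condition K on a kernel `K`, of order `P`. -/
structure ConditionK {d : ℕ} (K : E d → ℝ) (P : ℝ) : Prop where
  lt_order : (d : ℝ) / 2 < P
  measurable : Measurable K
  even : ∀ u, K (-u) = K u
  bounded : ∃ M : ℝ, ∀ u, |K u| ≤ M
  integrable : Integrable (fun u => |K u| * (1 + l1norm u ^ P)) volume
  integral_eq_one : ∫ u, K u = 1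
  moment_eq_zero : ∀ l : Fin d → ℕ, 0 < ∑ i, l i → ((∑ i, l i : ℕ) : ℝ) < P →
    ∫ u, (∏ i, u i ^ l i) * K u = 0

/-- The exponent `S = min (P/2, s)`. -/
def exponentS (P s : ℝ) : ℝ := min (P / 2) s

/-- Condition B: `n h_n^{4S} → 0` and `n h_n^d → ∞`. -/
structure ConditionB (d : ℕ) (P s : ℝ) (h : ℕ → ℝ) : Prop where
  upper : Tendsto (fun n : ℕ => (n : ℝ) * h n ^ (4 * exponentS P s)) atTop (𝓝 0)
  lower : Tendsto (fun n : ℕ => (n : ℝ) * h n ^ d) atTop atTop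

/-- Condition B⁺: `n h_n^{4S} → 0` and `n h_n^{2d} → ∞`. -/
structure ConditionBPlus (d : ℕ) (P s : ℝ) (h : ℕ → ℝ) : Prop where
  upper : Tendsto (fun n : ℕ => (n : ℝ) * h n ^ (4 * exponentS P s)) atTop (𝓝 0)
  lower : Tendsto (fun n : ℕ => (n : ℝ) * h n ^ (2 * d)) atTop atTop

/-! ### The estimators, as functions of a sample `x = (x₁, …, xₙ)` -/

/-- The rescaled kernel `K_h(u) = h^{-d} K(u/h)`. -/
def scaledKernel {d : ℕ} (K : E d → ℝ) (h : ℝ) (u : E d) : ℝ := (h ^ d)⁻¹ * K (h⁻¹ • u)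

/-- The kernel density estimator `f̂_n`. -/
def kde {d n : ℕ} (K : E d → ℝ) (h : ℝ) (x : Fin n → E d) (u : E d) : ℝ :=
  (n : ℝ)⁻¹ * ∑ j, scaledKernel K h (u - x j)

/-- The plug-in average density estimator. -/
def thetaAD {d n : ℕ} (K : E d → ℝ) (h : ℝ) (x : Fin n → E d) : ℝ :=
  (n : ℝ)⁻¹ * ∑ i, kde K h x (x i)

/-- The bias-corrected average density estimator. -/
def thetaADBC {d n : ℕ} (K : E d → ℝ) (h : ℝ) (x : Fin n → E d) : ℝ :=
  thetaAD K h x - K 0 / (n * h ^ d)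

/-- The generalized jackknife average density estimator with constant `c`. -/
def thetaADGJ {d n : ℕ} (c : ℝ) (K : E d → ℝ) (h : ℝ) (x : Fin n → E d) : ℝ :=
  1 / (1 - c ^ d) * thetaAD K h x - c ^ d / (1 - c ^ d) * thetaAD K (c * h) x

/-- The block `⌈i b / n⌉` of an observation, `i` being its number counted from `1`, when the sample
is divided into `b` blocks. -/
def block {n : ℕ} (b : ℕ) (i : Fin n) : ℕ := ⌈(((i : ℕ) + 1 : ℕ) : ℝ) * (b : ℝ) / (n : ℝ)⌉₊

/-- The leave-out weights `w_{ij,n}` for `b` blocks. -/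
def leaveOutWeight {n : ℕ} (b : ℕ) (i j : Fin n) : ℝ :=
  (if block b i ≠ block b j then 1 else 0) / ∑ k : Fin n, if block b i ≠ block b k then 1 else 0

/-- The leave-out density estimator `f̂^{LO}_{i,n}`. -/
def kdeLO {d n : ℕ} (b : ℕ) (K : E d → ℝ) (h : ℝ) (x : Fin n → E d) (i : Fin n) (u : E d) : ℝ :=
  ∑ j, leaveOutWeight b i j * scaledKernel K h (u - x j)

/-- The leave-out average density estimator. -/
def thetaADLO {d n : ℕ} (b : ℕ) (K : E d → ℝ) (h : ℝ) (x : Fin n → E d) : ℝ :=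
  (n : ℝ)⁻¹ * ∑ i, kdeLO b K h x i (x i)

/-- The plug-in integrated squared density estimator. -/
def thetaISD {d n : ℕ} (K : E d → ℝ) (h : ℝ) (x : Fin n → E d) : ℝ :=
  ∫ u, kde K h x u ^ 2

/-- The bias-corrected integrated squared density estimator. -/
def thetaISDBC {d n : ℕ} (K : E d → ℝ) (h : ℝ) (x : Fin n → E d) : ℝ :=
  thetaISD K h x - (∫ u, K u ^ 2) / (n * h ^ d)

/-- The generalized jackknife integrated squared density estimator with constant `c`. -/
def thetaISDGJ {d n : ℕ} (c : ℝ) (K : E d → ℝ) (h : ℝ) (x : Fin n → E d) : ℝ :=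
  1 / (1 - c ^ d) * thetaISD K h x - c ^ d / (1 - c ^ d) * thetaISD K (c * h) x

/-- The leave-out integrated squared density estimator. -/
def thetaISDLO {d n : ℕ} (b : ℕ) (K : E d → ℝ) (h : ℝ) (x : Fin n → E d) : ℝ :=
  (n : ℝ)⁻¹ * ∑ i, ∫ u, kdeLO b K h x i u ^ 2

/-- The locally robust plug-in estimator. -/
def thetaLR {d n : ℕ} (K : E d → ℝ) (h : ℝ) (x : Fin n → E d) : ℝ :=
  2 * thetaAD K h x - thetaISD K h x

/-- The bias-corrected locally robust estimator. -/
def thetaLRBC {d n : ℕ} (K : E d → ℝ) (h : ℝ) (x : Fin n → E d) : ℝ :=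
  2 * thetaADBC K h x - thetaISDBC K h x

/-- The generalized jackknife locally robust estimator with constant `c`. -/
def thetaLRGJ {d n : ℕ} (c : ℝ) (K : E d → ℝ) (h : ℝ) (x : Fin n → E d) : ℝ :=
  2 * thetaADGJ c K h x - thetaISDGJ c K h x

/-- The leave-out locally robust estimator with `b` blocks. -/
def thetaLRLO {d n : ℕ} (b : ℕ) (K : E d → ℝ) (h : ℝ) (x : Fin n → E d) : ℝ :=
  2 * thetaADLO b K h x - thetaISDLO b K h x

/-! ### The bootstrap -/

/-- The empirical distribution of `x₁, …, xₙ`. -/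
def empiricalLaw {d n : ℕ} (x : Fin n → E d) : Measure (E d) :=
  (n : ℝ≥0∞)⁻¹ • ∑ i, Measure.dirac (x i)

/-- The bootstrap distribution given the data `x`: the law of a random sample of size `n` from the
empirical distribution of `x₁, …, xₙ`. -/
def bootstrapLaw {d n : ℕ} (x : Fin n → E d) : Measure (Fin n → E d) :=
  Measure.pi fun _ => empiricalLaw x

/-- The first `n` observations. -/
def sample {d : ℕ} {Ω : Type*} (X : ℕ → Ω → E d) (n : ℕ) (ω : Ω) : Fin n → E d :=
  fun i => X i ω

/-- Bootstrap consistency of the sequence of estimators `θ̂_n = T_n(X₁, …, Xₙ)` of `θ₀`: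
`sup_t |ℙ[√n (θ̂_n - θ₀) ≤ t] - ℙ*_n[√n (θ̂*_n - θ̂_n) ≤ t]| → 0` in probability, where
`θ̂*_n = T_n(X*₁, …, X*ₙ)` with a bootstrap sample `X*₁, …, X*ₙ`. -/
def BootstrapConsistent {d : ℕ} {Ω : Type*} [MeasurableSpace Ω] (μ : Measure Ω)
    (X : ℕ → Ω → E d) (θ₀ : ℝ) (T : (n : ℕ) → (Fin n → E d) → ℝ) : Prop :=
  TendstoInMeasure μ
    (fun (n : ℕ) (ω : Ω) => ⨆ t : ℝ,
      |μ.real {ω' | √(n : ℝ) * (T n (sample X n ω') - θ₀) ≤ t}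
        - (bootstrapLaw (sample X n ω)).real
            {y | √(n : ℝ) * (T n y - T n (sample X n ω)) ≤ t}|)
    atTop (fun _ => 0)

end

end AvgDensity

/-! Every estimator in the theorem is built, up to deterministic constants, from pairwise statistics
`∑ a i j * G_h (x i - x j)`, with `G = K` for the average density and `G = K ∗ K` for the integrated
squared density. The weights are close to `n⁻²` (`NearUniform`): total mass one, entries `O(n⁻²)`,
and row plus column sums `2/n + O(n⁻²)`.

Such a statistic splits into a deterministic diagonal part of size about `G 0 / (n h^d)` and an
off-diagonal part. A Hoeffding decomposition reduces the latter to its mean plus the centred average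
of `2 f₀`. The mean square of the error, times `n`, is at most a constant times `(∫∫ G²) / n + ∫
(projection - f₀)²` (`integral_sq_expansion_error_le`). The first term is `O(1/(n h^d))`. The second
is `O(h^{2S})`, by Plancherel, the flatness of the Fourier transform of the kernel at the origin,
and the Besov bound (`GoodKernel.exists_eLpNorm_smooth_sub_le`).

The decomposition is valid for every sampling law, hence conditionally on the data for the empirical
law, with the same function `f₀`. The bound then becomes random, but its expectation is controlled
by the population quantities plus a diagonal term `(G 0 / (n h^d))²`. So each statistic has the same
linear expansion under sampling and under the bootstrap (`LinearExpansion`).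

The smoothing bias of the locally robust combination is exactly `-∫ (K_h ∗ f₀ - f₀)² = O(h^{2S})`,
which is `o(n^{-1/2})` (`locallyRobust_bias`). The diagonal bias may be larger than `n^{-1/2}` under
(B), but a bootstrap sample of the plug-in statistic reproduces it, so it shifts both distribution
functions equally and drops out of the supremum. The same holds for the generalized jackknife, a
combination of two plug-in estimators with coefficients adding up to one. For the bias-corrected and
leave-out versions the two diagonal biases may differ, and (B⁺) makes both negligible.

A central limit theorem uniform in the sampling law (`uniform_central_limit`) puts both distribution
functions close to one shifted normal distribution function (`LinearExpansion.bootstrapConsistent`).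
-/

namespace AvgDensity

open FourierTransform
open scoped NNReal

/-! ### Plancherel's theorem on `L¹ ∩ L²`. -/

section Plancherel

open SchwartzMap

variable {V : Type*} [NormedAddCommGroup V] [InnerProductSpace ℝ V] [FiniteDimensional ℝ V]
  [MeasurableSpace V] [BorelSpace V]

/-- On `L¹ ∩ L²` the Fourier integral represents the `L²` Fourier transform. -/
theorem fourier_toLp_ae_eq {f : V → ℂ} (hf1 : Integrable f) (hf2 : MemLp f 2) :
    (𝓕 (hf2.toLp f) : Lp ℂ 2 (volume : Measure V)) =ᵐ[volume] 𝓕 f := by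
  have hcont : Continuous (𝓕 f) :=
    VectorFourier.fourierIntegral_continuous Real.continuous_fourierChar (L := innerₗ V)
      continuous_inner hf1
  have h2 : LocallyIntegrable
      (𝓕 (hf2.toLp f) : Lp ℂ 2 (volume : Measure V)) volume :=
    (Lp.memLp _).locallyIntegrable (by norm_num)
  -- Both transforms are tested against compactly supported smooth `g`. The `L²` transform, read as
  -- a tempered distribution, and the Fourier integral, through the multiplication formula, both
  -- give `∫ (𝓕 g) f`.
  refine ae_eq_of_integral_contDiff_smul_eq h2 hcont.locallyIntegrable fun g hg hgs => ?_
  have hgc : HasCompactSupport (fun x => (g x : ℂ)) := hgs.comp_left Complex.ofReal_zero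
  have hgd : ContDiff ℝ (⊤ : ℕ∞) (fun x => (g x : ℂ)) := Complex.ofRealCLM.contDiff.comp hg
  let φ : 𝓢(V, ℂ) := hgc.toSchwartzMap hgd
  have hφ : ∀ x, φ x = (g x : ℂ) := fun x => rfl
  have key := congrArg (fun T => T φ) (Lp.fourier_toTemperedDistribution_eq (hf2.toLp f))
  simp only [TemperedDistribution.fourier_apply, Lp.toTemperedDistribution_apply] at key
  have e1 : ∫ x, g x • (𝓕 (hf2.toLp f) : Lp ℂ 2 (volume : Measure V)) x
      = ∫ x, φ x • (𝓕 (hf2.toLp f) : Lp ℂ 2 (volume : Measure V)) x := by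
    simp [hφ]
  rw [e1, ← key]
  have e2 : ∫ x, (𝓕 φ) x • (hf2.toLp f) x = ∫ x, (𝓕 φ) x • f x := by
    refine integral_congr_ae ?_
    filter_upwards [hf2.coeFn_toLp] with x hx
    rw [hx]
  rw [e2, SchwartzMap.fourier_coe]
  have := VectorFourier.integral_fourierIntegral_smul_eq_flip (e := Real.fourierChar)
    (L := innerₗ V) (μ := volume) (ν := volume) Real.continuous_fourierChar continuous_inner
    φ.integrable hf1
  rw [flip_innerₗ] at this
  exact this

/-- **Plancherel's theorem** for functions in `L¹ ∩ L²`. -/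
theorem eLpNorm_fourier_eq {f : V → ℂ} (hf1 : Integrable f) (hf2 : MemLp f 2) :
    eLpNorm (𝓕 f) 2 volume = eLpNorm f 2 volume := by
  have h := Lp.norm_fourier_eq (hf2.toLp f)
  rw [Lp.norm_def, Lp.norm_def, eLpNorm_congr_ae (fourier_toLp_ae_eq hf1 hf2),
    eLpNorm_congr_ae hf2.coeFn_toLp] at h
  refine (ENNReal.toReal_eq_toReal_iff' ?_ hf2.2.ne).1 h
  rw [← eLpNorm_congr_ae (fourier_toLp_ae_eq hf1 hf2)]
  exact Lp.eLpNorm_ne_top _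

end Plancherel

/-! ### Flatness at the origin of the Fourier transform of a higher-order kernel. -/

section KernelTransform

variable {d : ℕ}

theorem norm_le_l1norm (u : E d) : ‖u‖ ≤ l1norm u := by
  have h0 : 0 ≤ l1norm u := Finset.sum_nonneg fun _ _ => abs_nonneg _
  rw [EuclideanSpace.norm_eq]
  refine Real.sqrt_le_iff.2 ⟨h0, ?_⟩
  simp only [Real.norm_eq_abs]
  exact Finset.sum_sq_le_sq_sum_of_nonneg fun _ _ => abs_nonneg _

theorem abs_apply_le_l1norm (u : E d) (i : Fin d) : |u i| ≤ l1norm u :=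
  Finset.single_le_sum (f := fun i => |u i|) (fun _ _ => abs_nonneg _) (Finset.mem_univ i)

theorem pow_le_one_add_rpow {x P : ℝ} (hx : 0 ≤ x) {k : ℕ} (hk : (k : ℝ) ≤ P) :
    x ^ k ≤ 1 + x ^ P := by
  have hP : 0 ≤ x ^ P := Real.rpow_nonneg hx P
  rcases le_total x 1 with h | h
  · exact (pow_le_one₀ hx h).trans (by linarith)
  · rw [← Real.rpow_natCast]
    exact (Real.rpow_le_rpow_of_exponent_le h hk).trans (by linarith)

/-- For `|t| ≤ 1` the usual remainder of order `⌈P⌉` is dominated by `|t| ^ P` times `e ≤ 3`. For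
`|t| ≥ 1` cancellation is not needed: the exponential and each of the `⌈P⌉` Taylor terms, whose
degrees are below `P`, are at most `|t| ^ P`. The constant covers both cases. -/
theorem norm_exp_sub_taylor_le {P : ℝ} (hP : 0 < P) (t : ℝ) :
    ‖Complex.exp (t * Complex.I)
      - ∑ k ∈ Finset.range ⌈P⌉₊, (t * Complex.I) ^ k / (k.factorial : ℂ)‖
      ≤ (⌈P⌉₊ + 3) * |t| ^ P := by
  have hp : 0 < ⌈P⌉₊ := Nat.ceil_pos.2 hP
  have hnorm : ‖(t : ℂ) * Complex.I‖ = |t| := by simp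
  rcases le_total |t| 1 with h | h
  · have h1 := Complex.norm_exp_sub_sum_le_norm_mul_exp ((t : ℂ) * Complex.I) ⌈P⌉₊
    rw [hnorm] at h1
    have h2 : |t| ^ ⌈P⌉₊ ≤ |t| ^ P := by
      rcases eq_or_lt_of_le (abs_nonneg t) with h0 | h0
      · rw [← h0, zero_pow hp.ne', Real.zero_rpow hP.ne']
      · rw [← Real.rpow_natCast]
        exact Real.rpow_le_rpow_of_exponent_ge h0 h (Nat.le_ceil P)
    have h3 : Real.exp |t| ≤ ⌈P⌉₊ + 3 := by
      have := Real.exp_le_exp.2 h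
      have := Real.exp_one_lt_d9
      have : (0 : ℝ) ≤ ⌈P⌉₊ := Nat.cast_nonneg _
      linarith
    calc _ ≤ |t| ^ ⌈P⌉₊ * Real.exp |t| := h1
      _ ≤ |t| ^ P * (⌈P⌉₊ + 3) := by gcongr
      _ = _ := mul_comm _ _
  · have hle : ∀ k ∈ Finset.range ⌈P⌉₊, ‖(t * Complex.I) ^ k / (k.factorial : ℂ)‖ ≤ |t| ^ P := by
      intro k hk
      rw [norm_div, norm_pow, hnorm, Complex.norm_natCast]
      have hkP : (k : ℝ) ≤ P := (Nat.lt_ceil.1 (Finset.mem_range.1 hk)).le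
      calc |t| ^ k / (k.factorial : ℝ) ≤ |t| ^ k :=
            div_le_self (by positivity) (by exact_mod_cast k.factorial_pos)
        _ ≤ |t| ^ P := by
            rw [← Real.rpow_natCast]
            exact Real.rpow_le_rpow_of_exponent_le h hkP
    have h1 : (1 : ℝ) ≤ |t| ^ P := Real.one_le_rpow h hP.le
    calc _ ≤ ‖Complex.exp (t * Complex.I)‖
          + ‖∑ k ∈ Finset.range ⌈P⌉₊, (t * Complex.I) ^ k / (k.factorial : ℂ)‖ := norm_sub_le _ _
      _ ≤ |t| ^ P + ∑ k ∈ Finset.range ⌈P⌉₊, |t| ^ P := by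
          rw [Complex.norm_exp_ofReal_mul_I]
          exact add_le_add h1 (norm_sum_le_of_le _ hle)
      _ = (⌈P⌉₊ + 1) * |t| ^ P := by
          rw [Finset.sum_const, Finset.card_range, nsmul_eq_mul]; ring
      _ ≤ _ := by gcongr; norm_num

namespace ConditionK

variable {K : E d → ℝ} {P : ℝ}

theorem order_pos (hK : ConditionK K P) : 0 < P :=
  lt_of_le_of_lt (by positivity) hK.lt_order

theorem integrable_kernel (hK : ConditionK K P) : Integrable K := by
  refine hK.integrable.mono hK.measurable.aestronglyMeasurable (ae_of_all _ fun u => ?_)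
  have : 0 ≤ l1norm u ^ P := Real.rpow_nonneg ((norm_nonneg u).trans (norm_le_l1norm u)) P
  rw [Real.norm_eq_abs, Real.norm_eq_abs, abs_mul, abs_abs,
    abs_of_nonneg (a := 1 + l1norm u ^ P) (by linarith)]
  exact le_mul_of_one_le_right (abs_nonneg _) (by linarith)

theorem integrable_rpow_norm (hK : ConditionK K P) : Integrable fun u => ‖u‖ ^ P * |K u| := by
  refine hK.integrable.mono (by have := hK.measurable; fun_prop) (ae_of_all _ fun u => ?_)
  have hl : ‖u‖ ^ P ≤ l1norm u ^ P :=
    Real.rpow_le_rpow (norm_nonneg u) (norm_le_l1norm u) hK.order_pos.le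
  have h0 : 0 ≤ ‖u‖ ^ P := Real.rpow_nonneg (norm_nonneg u) P
  rw [Real.norm_eq_abs, Real.norm_eq_abs, abs_of_nonneg (by positivity), abs_mul, abs_abs,
    abs_of_nonneg (a := 1 + l1norm u ^ P) (by linarith), mul_comm]
  gcongr
  linarith

theorem integrable_monomial (hK : ConditionK K P) {l : Fin d → ℕ} (hl : ((∑ i, l i : ℕ) : ℝ) ≤ P) :
    Integrable fun u => (∏ i, u i ^ l i) * K u := by
  refine hK.integrable.mono (by have := hK.measurable; fun_prop) (ae_of_all _ fun u => ?_)
  have h0 : 0 ≤ l1norm u := (norm_nonneg u).trans (norm_le_l1norm u)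
  have h1 : 0 ≤ l1norm u ^ P := Real.rpow_nonneg h0 P
  rw [Real.norm_eq_abs, Real.norm_eq_abs, abs_mul, abs_mul, abs_abs,
    abs_of_nonneg (a := 1 + l1norm u ^ P) (by linarith), mul_comm]
  gcongr
  rw [Finset.abs_prod]
  calc ∏ i, |u i ^ l i| ≤ ∏ i, l1norm u ^ l i := by
        refine Finset.prod_le_prod (fun _ _ => abs_nonneg _) fun i _ => ?_
        rw [abs_pow]
        exact pow_le_pow_left₀ (abs_nonneg _) (abs_apply_le_l1norm u i) _
    _ = l1norm u ^ (∑ i, l i) := Finset.prod_pow_eq_pow_sum _ _ _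
    _ ≤ _ := pow_le_one_add_rpow h0 hl

/-- The multinomial theorem expresses directional moments through the coordinate moments controlled
by Condition K. -/
theorem inner_pow_mul_eq (ξ u : E d) (k : ℕ) :
    (inner ℝ u ξ) ^ k * K u = ∑ l ∈ Finset.piAntidiag (Finset.univ : Finset (Fin d)) k,
      ((Nat.multinomial Finset.univ l : ℝ) * ∏ i, ξ i ^ l i) * ((∏ i, u i ^ l i) * K u) := by
  have : (inner ℝ u ξ : ℝ) = ∑ i, u i * ξ i := by
    simp [PiLp.inner_apply, mul_comm]
  rw [this, Finset.sum_pow_eq_sum_piAntidiag, Finset.sum_mul]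
  refine Finset.sum_congr rfl fun l _ => ?_
  simp_rw [mul_pow, Finset.prod_mul_distrib]
  ring

theorem integrable_inner_pow (hK : ConditionK K P) (ξ : E d) {k : ℕ} (hk : (k : ℝ) ≤ P) :
    Integrable fun u => (inner ℝ u ξ) ^ k * K u := by
  simp_rw [inner_pow_mul_eq]
  refine integrable_finsetSum _ fun l hl => (hK.integrable_monomial ?_).const_mul _
  rwa [(Finset.mem_piAntidiag.1 hl).1]

theorem integral_inner_pow (hK : ConditionK K P) (ξ : E d) {k : ℕ} (hk0 : 0 < k)
    (hk : (k : ℝ) < P) : ∫ u, (inner ℝ u ξ) ^ k * K u = 0 := by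
  simp_rw [inner_pow_mul_eq]
  rw [integral_finsetSum]
  · refine Finset.sum_eq_zero fun l hl => ?_
    have hs := (Finset.mem_piAntidiag.1 hl).1
    rw [integral_const_mul, hK.moment_eq_zero l (by rw [hs]; exact hk0) (by rw [hs]; exact hk),
      mul_zero]
  · refine fun l hl => (hK.integrable_monomial ?_).const_mul _
    rw [(Finset.mem_piAntidiag.1 hl).1]
    exact hk.le

/-- The Fourier transform of a kernel of order `P` is flat of order `P` at the origin. -/
theorem exists_norm_fourier_sub_one_le (hK : ConditionK K P) :
    ∃ D : ℝ, ∀ ξ : E d, ‖𝓕 (fun u => (K u : ℂ)) ξ - 1‖ ≤ D * ‖ξ‖ ^ P := by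
  have hP := hK.order_pos
  refine ⟨(⌈P⌉₊ + 3) * (2 * Real.pi) ^ P * ∫ u, ‖u‖ ^ P * |K u|, fun ξ => ?_⟩
  set t : E d → ℝ := fun u => -2 * Real.pi * inner ℝ u ξ with ht
  have hterm : ∀ (k : ℕ) (u : E d), (t u * Complex.I) ^ k / (k.factorial : ℂ) * (K u : ℂ)
      = ((-2 * Real.pi * Complex.I) ^ k / (k.factorial : ℂ))
        * (((inner ℝ u ξ) ^ k * K u : ℝ) : ℂ) := by
    intro k u
    simp only [ht]
    push_cast
    ring
  have hint : ∀ k ∈ Finset.range ⌈P⌉₊,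
      Integrable fun u => (t u * Complex.I) ^ k / (k.factorial : ℂ) * (K u : ℂ) := by
    intro k hk
    simp_rw [hterm]
    exact (hK.integrable_inner_pow ξ (Nat.lt_ceil.1 (Finset.mem_range.1 hk)).le).ofReal.const_mul _
  -- The indices in `Finset.range ⌈P⌉₊` are exactly the `k < P`, so every Taylor term except `k = 0`
  -- is a vanishing moment, and the term `k = 0` is `∫ K = 1`.
  have hsum : ∫ u, (∑ k ∈ Finset.range ⌈P⌉₊, (t u * Complex.I) ^ k / (k.factorial : ℂ)) * (K u : ℂ)
      = 1 := by
    simp_rw [Finset.sum_mul]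
    rw [integral_finsetSum _ hint, Finset.sum_eq_single_of_mem 0
      (Finset.mem_range.2 (Nat.ceil_pos.2 hP))]
    · have := hK.integral_eq_one
      simp [integral_complex_ofReal, this]
    · intro k hk hk0
      simp_rw [hterm]
      rw [integral_const_mul, integral_complex_ofReal, hK.integral_inner_pow ξ
        (Nat.pos_of_ne_zero hk0) (Nat.lt_ceil.1 (Finset.mem_range.1 hk))]
      simp
  have hF : 𝓕 (fun u => (K u : ℂ)) ξ = ∫ u, Complex.exp (t u * Complex.I) * (K u : ℂ) := by
    rw [Real.fourier_eq']
    refine integral_congr_ae (ae_of_all _ fun u => ?_)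
    simp only [ht, smul_eq_mul]
  have htm : Measurable t := by fun_prop
  have hexp : Integrable fun u => Complex.exp (t u * Complex.I) * (K u : ℂ) := by
    refine hK.integrable_kernel.ofReal.bdd_mul (c := 1) (by fun_prop) (ae_of_all _ fun u => ?_)
    rw [Complex.norm_exp_ofReal_mul_I]
  have hS : Integrable fun u =>
      (∑ k ∈ Finset.range ⌈P⌉₊, (t u * Complex.I) ^ k / (k.factorial : ℂ)) * (K u : ℂ) := by
    simp_rw [Finset.sum_mul]
    exact integrable_finsetSum _ hint
  rw [← hsum, hF, ← integral_sub hexp hS]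
  calc _ ≤ ∫ u, (⌈P⌉₊ + 3) * (2 * Real.pi) ^ P * ‖ξ‖ ^ P * (‖u‖ ^ P * |K u|) := by
        refine norm_integral_le_of_norm_le (hK.integrable_rpow_norm.const_mul _)
          (ae_of_all _ fun u => ?_)
        rw [← sub_mul, norm_mul, Complex.norm_real, Real.norm_eq_abs]
        have h1 := norm_exp_sub_taylor_le hP (t u)
        have h2 : |t u| ^ P ≤ (2 * Real.pi) ^ P * ‖ξ‖ ^ P * ‖u‖ ^ P := by
          rw [← Real.mul_rpow (by positivity) (norm_nonneg _),
            ← Real.mul_rpow (by positivity) (norm_nonneg _)]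
          refine Real.rpow_le_rpow (abs_nonneg _) ?_ hP.le
          simp only [ht]
          rw [abs_mul, abs_mul, abs_neg, abs_two, abs_of_pos Real.pi_pos, mul_assoc _ ‖ξ‖,
            mul_comm ‖ξ‖]
          exact mul_le_mul_of_nonneg_left (abs_real_inner_le_norm u ξ) (by positivity)
        calc _ ≤ ((⌈P⌉₊ + 3) * |t u| ^ P) * |K u| := by gcongr
          _ ≤ ((⌈P⌉₊ + 3) * ((2 * Real.pi) ^ P * ‖ξ‖ ^ P * ‖u‖ ^ P)) * |K u| := by gcongr
          _ = _ := by ring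
    _ = _ := by rw [integral_const_mul]; ring

end ConditionK

end KernelTransform

/-! ### Domination of a flat symbol by difference symbols at dyadic scales. -/

section DyadicBound

theorem eLpNorm_two_sq {α F : Type*} [MeasurableSpace α] [NormedAddCommGroup F] (f : α → F)
    (μ : Measure α) : eLpNorm f 2 μ ^ 2 = ∫⁻ x, ‖f x‖ₑ ^ 2 ∂μ := by
  have := eLpNorm_nnreal_pow_eq_lintegral (f := f) (μ := μ) (p := 2) (by norm_num)
  simpa using this

/-- The modulus is `2 |sin (π x)|`, and Jordan's inequality `sin y ≥ 2 y / π` on `[0, π/2]` bounds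
it below by `4 |x|`. -/
theorem one_le_norm_fourierChar_sub_one {x : ℝ} (h1 : 1 / 4 ≤ |x|) (h2 : |x| ≤ 1 / 2) :
    1 ≤ ‖(Real.fourierChar x : ℂ) - 1‖ := by
  have h : (Real.fourierChar x : ℂ) = Complex.exp (Complex.I * ((2 * Real.pi * x : ℝ) : ℂ)) := by
    rw [Real.fourierChar_apply, mul_comm]
  rw [h, Complex.norm_exp_I_mul_ofReal_sub_one, Real.norm_eq_abs, abs_mul, abs_two]
  have hpi := Real.pi_pos
  have e : 2 * Real.pi * x / 2 = Real.pi * x := by ring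
  have h3 : |Real.sin (Real.pi * x)| = Real.sin (Real.pi * |x|) := by
    have h0 : 0 ≤ Real.sin (Real.pi * |x|) :=
      Real.sin_nonneg_of_nonneg_of_le_pi (by positivity) (by nlinarith)
    rcases abs_cases x with ⟨hx, _⟩ | ⟨hx, _⟩
    · rw [hx] at h0 ⊢
      exact abs_of_nonneg h0
    · rw [hx] at h0 ⊢
      rw [mul_neg, Real.sin_neg] at h0 ⊢
      exact abs_of_nonpos (by linarith)
  rw [e, h3]
  have h4 := Real.mul_le_sin (x := Real.pi * |x|) (by positivity) (by nlinarith)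
  have h5 : 2 / Real.pi * (Real.pi * |x|) = 2 * |x| := by field_simp
  linarith

/-- The weight of the scale `2^k` in the dyadic decomposition of frequency space. -/
noncomputable def dyadicWeight (P : ℝ) (k : ℤ) : ℝ := (max 1 ((2 : ℝ) ^ k)) ^ (-(2 * P))

theorem dyadicWeight_nonneg (P : ℝ) (k : ℤ) : 0 ≤ dyadicWeight P k :=
  Real.rpow_nonneg (le_trans zero_le_one (le_max_left _ _)) _

/-- For `k ≥ 0` the terms are `2 ^ (2 k (S - P))`, for `k ≤ 0` they are `2 ^ (2 k S)`: two geometric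
series, convergent because `S < P` and `S > 0` respectively. -/
theorem summable_dyadicWeight {P S : ℝ} (hS : 0 < S) (hSP : S < P) :
    Summable fun k : ℤ => dyadicWeight P k * (((2 : ℝ) ^ k) ^ S) ^ 2 := by
  have key : ∀ x : ℝ, x < 0 → Summable fun n : ℕ => ((2 : ℝ) ^ n) ^ x := by
    intro x hx
    have : ∀ n : ℕ, ((2 : ℝ) ^ n) ^ x = ((2 : ℝ) ^ x) ^ n := by
      intro n
      rw [← Real.rpow_natCast, ← Real.rpow_mul (by norm_num), mul_comm,
        Real.rpow_mul (by norm_num), Real.rpow_natCast]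
    simp_rw [this]
    exact summable_geometric_of_lt_one (by positivity)
      (Real.rpow_lt_one_of_one_lt_of_neg (by norm_num) hx)
  have hsq : ∀ x : ℝ, 0 ≤ x → (x ^ S) ^ 2 = x ^ (2 * S) := by
    intro x hx
    rw [← Real.rpow_natCast, ← Real.rpow_mul hx]
    congr 1
    push_cast
    ring
  refine Summable.of_nat_of_neg ?_ ?_
  · refine (key (-(2 * P) + 2 * S) (by linarith)).congr fun n => ?_
    have h1 : (1 : ℝ) ≤ 2 ^ n := one_le_pow₀ (by norm_num)
    rw [dyadicWeight, zpow_natCast, max_eq_right h1, hsq _ (by positivity),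
      ← Real.rpow_add (by positivity)]
  · refine (key (-(2 * S)) (by linarith)).congr fun n => ?_
    have h1 : ((2 : ℝ) ^ n)⁻¹ ≤ 1 := inv_le_one_of_one_le₀ (one_le_pow₀ (by norm_num))
    rw [dyadicWeight, zpow_neg, zpow_natCast, max_eq_left h1, hsq _ (by positivity),
      Real.one_rpow, one_mul, Real.inv_rpow (by positivity), Real.rpow_neg (by positivity)]

variable {d : ℕ}

/-- A function of `ξ` that is bounded and flat of order `P` at `0` is dominated by a weighted sum
of the symbols of the differences in the directions of the coordinate axes at dyadic scales. -/
theorem exists_sq_le_dyadic_sum {F : E d → ℝ} {A D P : ℝ} (hP : 0 < P) (hF : ∀ ξ, 0 ≤ F ξ)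
    (hA : ∀ ξ, F ξ ≤ A) (hD : ∀ ξ, F ξ ≤ D * ‖ξ‖ ^ P) (m : ℕ) :
    ∃ C : ℝ, 0 ≤ C ∧ ∀ ξ : E d, ENNReal.ofReal (F ξ ^ 2) ≤ ENNReal.ofReal C *
      ∑ i : Fin d, ∑' k : ℤ, ENNReal.ofReal (dyadicWeight P k) *
        ‖(Real.fourierChar ((2 : ℝ) ^ k * ξ i) : ℂ) - 1‖ₑ ^ (2 * m) := by
  refine ⟨A ^ 2 + (|D| * (d : ℝ) ^ P) ^ 2, by positivity, fun ξ => ?_⟩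
  rcases eq_or_ne ξ 0 with rfl | hξ
  · have h0 := hD 0
    rw [norm_zero, Real.zero_rpow hP.ne', mul_zero] at h0
    rw [le_antisymm h0 (hF 0)]
    simp
  obtain ⟨j, hj⟩ : ∃ j, ξ j ≠ 0 := by
    by_contra! hcon
    exact hξ (by ext i; exact hcon i)
  have : Nonempty (Fin d) := ⟨j⟩
  obtain ⟨i, -, hi⟩ := Finset.exists_max_image Finset.univ (fun i => |ξ i|) ⟨j, Finset.mem_univ j⟩
  set a := |ξ i| with ha
  have ha0 : 0 < a := lt_of_lt_of_le (abs_pos.2 hj) (hi j (Finset.mem_univ j))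
  have hnorm : ‖ξ‖ ≤ d * a := by
    refine (norm_le_l1norm ξ).trans ?_
    calc l1norm ξ ≤ ∑ _i : Fin d, a := Finset.sum_le_sum fun k _ => hi k (Finset.mem_univ k)
      _ = d * a := by simp
  -- With `a` the largest coordinate of `ξ` in modulus, the choice `2 ^ n ≤ 4 a < 2 ^ (n + 1)` puts
  -- `τ a` with `τ = 2 ^ (-n)` in `[1/4, 1/2)`, where the difference symbol has modulus at least
  -- one. This single term of the double sum suffices.
  obtain ⟨n, hn1, hn2⟩ := exists_mem_Ico_zpow (x := 4 * a) (y := (2 : ℝ)) (by positivity)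
    (by norm_num)
  set τ : ℝ := (2 : ℝ) ^ (-n) with hτ
  have hτ0 : 0 < τ := by positivity
  have hτn : τ * 2 ^ n = 1 := by rw [hτ, ← zpow_add₀ (by norm_num)]; simp
  have hlow : 1 / 4 ≤ τ * a := by nlinarith
  have hupp : τ * a ≤ 1 / 2 := by
    rw [zpow_add₀ (by norm_num), zpow_one] at hn2
    nlinarith
  have hsym : (1 : ℝ≥0∞) ≤ ‖(Real.fourierChar (τ * ξ i) : ℂ) - 1‖ₑ ^ (2 * m) := by
    have habs : |τ * ξ i| = τ * a := by rw [abs_mul, abs_of_pos hτ0]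
    have := one_le_norm_fourierChar_sub_one (x := τ * ξ i) (by rw [habs]; exact hlow)
      (by rw [habs]; exact hupp)
    refine one_le_pow₀ ?_
    rw [← ofReal_norm]
    exact ENNReal.one_le_ofReal.2 this
  -- For `τ ≤ 1` the weight is one and the bound `A` is enough. For `τ ≥ 1` the weight is `τ ^
  -- (-2P)`, and flatness applies with `‖ξ‖ ≤ d a ≤ d / τ`.
  have hmain : F ξ ^ 2 ≤ (A ^ 2 + (|D| * (d : ℝ) ^ P) ^ 2) * dyadicWeight P (-n) := by
    rcases le_total τ 1 with h1 | h1
    · have : dyadicWeight P (-n) = 1 := by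
        rw [dyadicWeight, ← hτ, max_eq_left h1, Real.one_rpow]
      rw [this, mul_one]
      have := pow_le_pow_left₀ (hF ξ) (hA ξ) 2
      nlinarith [sq_nonneg (|D| * (d : ℝ) ^ P)]
    · have hw : dyadicWeight P (-n) = ((τ⁻¹) ^ P) ^ 2 := by
        rw [dyadicWeight, ← hτ, max_eq_right h1, Real.inv_rpow hτ0.le, Real.rpow_neg hτ0.le,
          inv_pow, ← Real.rpow_natCast, ← Real.rpow_mul hτ0.le]
        congr 2
        push_cast
        ring
      have haτ : a ≤ τ⁻¹ := by
        rw [← one_div, le_div_iff₀ hτ0]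
        linarith
      have h2 : F ξ ≤ |D| * (d : ℝ) ^ P * (τ⁻¹) ^ P := by
        calc F ξ ≤ D * ‖ξ‖ ^ P := hD ξ
          _ ≤ |D| * (d * a) ^ P := by
              gcongr
              exact le_abs_self D
          _ = |D| * (d : ℝ) ^ P * a ^ P := by
              rw [Real.mul_rpow (by positivity) ha0.le, mul_assoc]
          _ ≤ _ := by gcongr
      rw [hw]
      have h3 := pow_le_pow_left₀ (hF ξ) h2 2
      rw [mul_pow] at h3
      nlinarith [mul_nonneg (sq_nonneg A) (sq_nonneg ((τ⁻¹) ^ P))]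
  calc ENNReal.ofReal (F ξ ^ 2)
      ≤ ENNReal.ofReal (A ^ 2 + (|D| * (d : ℝ) ^ P) ^ 2) *
        (ENNReal.ofReal (dyadicWeight P (-n)) * 1) := by
        rw [mul_one, ← ENNReal.ofReal_mul (by positivity)]
        exact ENNReal.ofReal_le_ofReal hmain
    _ ≤ ENNReal.ofReal (A ^ 2 + (|D| * (d : ℝ) ^ P) ^ 2) *
        (ENNReal.ofReal (dyadicWeight P (-n)) *
          ‖(Real.fourierChar (τ * ξ i) : ℂ) - 1‖ₑ ^ (2 * m)) := by gcongr
    _ ≤ _ := by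
        gcongr
        refine le_trans ?_ (Finset.single_le_sum (f := fun i => ∑' k : ℤ,
          ENNReal.ofReal (dyadicWeight P k) *
            ‖(Real.fourierChar ((2 : ℝ) ^ k * ξ i) : ℂ) - 1‖ₑ ^ (2 * m))
          (fun _ _ => zero_le) (Finset.mem_univ i))
        exact ENNReal.le_tsum (f := fun k : ℤ => ENNReal.ofReal (dyadicWeight P k) *
            ‖(Real.fourierChar ((2 : ℝ) ^ k * ξ i) : ℂ) - 1‖ₑ ^ (2 * m)) (-n)

end DyadicBound

/-! ### Iterated differences and their Fourier symbols. -/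

section Differences

variable {d : ℕ}

theorem fwdDiff_iterate_ofReal (v : E d) (f : E d → ℝ) (m : ℕ) :
    (fwdDiff v)^[m] (fun x => (f x : ℂ)) = fun x => (((fwdDiff v)^[m] f x : ℝ) : ℂ) := by
  induction m generalizing f with
  | zero => rfl
  | succ m ih =>
    rw [Function.iterate_succ_apply, Function.iterate_succ_apply, ← ih]
    congr 1
    ext x
    simp [fwdDiff]

theorem integrable_fwdDiff_iterate {F : Type*} [NormedAddCommGroup F] {f : E d → F}
    (hf : Integrable f) (v : E d) (m : ℕ) : Integrable ((fwdDiff v)^[m] f) := by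
  induction m generalizing f with
  | zero => exact hf
  | succ m ih =>
    rw [Function.iterate_succ_apply]
    exact ih ((hf.comp_add_right v).sub hf)

theorem eLpNorm_comp_add_right {F : Type*} [NormedAddCommGroup F] {f : E d → F}
    (hf : AEStronglyMeasurable f) (v : E d) :
    eLpNorm (fun x => f (x + v)) 2 volume = eLpNorm f 2 volume :=
  eLpNorm_comp_measurePreserving hf (measurePreserving_add_right volume v)

theorem memLp_fwdDiff_iterate {F : Type*} [NormedAddCommGroup F] {f : E d → F}
    (hf : MemLp f 2) (v : E d) (m : ℕ) : MemLp ((fwdDiff v)^[m] f) 2 ∧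
      eLpNorm ((fwdDiff v)^[m] f) 2 volume ≤ 2 ^ m * eLpNorm f 2 volume := by
  induction m generalizing f with
  | zero => simpa using hf
  | succ m ih =>
    rw [Function.iterate_succ_apply]
    have h1 : MemLp (fun x => f (x + v)) 2 :=
      hf.comp_measurePreserving (measurePreserving_add_right volume v)
    have h2 : MemLp (fwdDiff v f) 2 := h1.sub hf
    refine ⟨(ih h2).1, (ih h2).2.trans ?_⟩
    rw [pow_succ, mul_assoc, two_mul]
    gcongr
    refine (eLpNorm_sub_le h1.1 hf.1 (by norm_num)).trans ?_
    rw [eLpNorm_comp_add_right hf.1]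

theorem fourier_fwdDiff_iterate {f : E d → ℂ} (hf : Integrable f) (v : E d) (m : ℕ) (ξ : E d) :
    𝓕 ((fwdDiff v)^[m] f) ξ = ((Real.fourierChar (inner ℝ v ξ) : ℂ) - 1) ^ m * 𝓕 f ξ := by
  induction m generalizing f with
  | zero => simp
  | succ m ih =>
    have h1 : Integrable (fun x => f (x + v)) := hf.comp_add_right v
    have hd : Integrable (fwdDiff v f) := h1.sub hf
    rw [Function.iterate_succ_apply, ih hd, pow_succ, mul_assoc]
    congr 1
    have h2 : 𝓕 (fun x => f (x + v)) ξ = (Real.fourierChar (inner ℝ v ξ) : ℂ) * 𝓕 f ξ :=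
      congrFun (VectorFourier.fourierIntegral_comp_add_right Real.fourierChar volume
        (innerₗ (E d)) f v) ξ
    have h3 : 𝓕 (fwdDiff v f) ξ = 𝓕 (fun x => f (x + v)) ξ - 𝓕 f ξ := by
      have e : fwdDiff v f = fun x => f (x + v) - f x := rfl
      simp only [Real.fourier_eq, e, smul_sub]
      exact integral_sub ((Real.fourierIntegral_convergent_iff ξ).2 h1)
        ((Real.fourierIntegral_convergent_iff ξ).2 hf)
    rw [h3, h2]
    ring

/-- The `L²` norm of an iterated difference in terms of the Fourier transform. -/
theorem lintegral_symbol_mul_fourier {f : E d → ℝ} (hf1 : Integrable f) (hf2 : MemLp f 2)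
    (v : E d) (m : ℕ) :
    ∫⁻ ξ, ‖(Real.fourierChar (inner ℝ v ξ) : ℂ) - 1‖ₑ ^ (2 * m) *
        ‖𝓕 (fun x => (f x : ℂ)) ξ‖ₑ ^ 2
      = eLpNorm ((fwdDiff v)^[m] f) 2 volume ^ 2 := by
  have hfc : Integrable (fun x => (f x : ℂ)) := hf1.ofReal
  have h1 := integrable_fwdDiff_iterate hfc v m
  have h2 := (memLp_fwdDiff_iterate (hf2.ofReal (K := ℂ)) v m).1
  have h3 : eLpNorm ((fwdDiff v)^[m] f) 2 volume
      = eLpNorm ((fwdDiff v)^[m] (fun x => (f x : ℂ))) 2 volume := by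
    rw [fwdDiff_iterate_ofReal]
    exact (eLpNorm_congr_norm_ae (ae_of_all _ fun x => by simp))
  rw [h3, ← eLpNorm_fourier_eq h1 h2, eLpNorm_two_sq]
  refine lintegral_congr fun ξ => ?_
  have h4 := fourier_fwdDiff_iterate hfc v m ξ
  rw [h4, enorm_mul, mul_pow, enorm_pow, ← pow_mul, mul_comm m]

end Differences

/-! ### Convolution smoothing and its `L²` error. -/

section Smoothing

variable {d : ℕ}

/-- The convolution of `f` with the kernel `G`. -/
noncomputable def smooth (G f : E d → ℝ) (x : E d) : ℝ := ∫ y, G (x - y) * f y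

theorem smooth_eq_convolution (G f : E d → ℝ) :
    smooth G f = MeasureTheory.convolution f G (ContinuousLinearMap.mul ℝ ℝ) volume := by
  ext x
  simp [smooth, convolution, mul_comm]

theorem measurable_smooth {G f : E d → ℝ} (hG : Measurable G) (hf : Measurable f) :
    Measurable (smooth G f) := by
  have : StronglyMeasurable (Function.uncurry fun x y : E d => G (x - y) * f y) := by
    refine Measurable.stronglyMeasurable ?_
    exact (hG.comp (measurable_fst.sub measurable_snd)).mul (hf.comp measurable_snd)
  exact (this.integral_prod_right (ν := volume)).measurable

theorem integrable_smooth {G f : E d → ℝ} (hG : Integrable G) (hf : Integrable f) :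
    Integrable (smooth G f) := by
  rw [smooth_eq_convolution]
  exact hf.integrable_convolution (ContinuousLinearMap.mul ℝ ℝ) hG

theorem abs_smooth_le {G f : E d → ℝ} {M : ℝ} (hG : Integrable G) (hM : ∀ x, |f x| ≤ M) (x : E d) :
    |smooth G f x| ≤ M * ∫ u, |G u| := by
  have h1 : Integrable fun y => M * |G (x - y)| := (hG.abs.comp_sub_left x).const_mul _
  calc |smooth G f x| ≤ ∫ y, M * |G (x - y)| := by
        refine norm_integral_le_of_norm_le (f := fun y => G (x - y) * f y) h1
          (ae_of_all _ fun y => ?_)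
        rw [Real.norm_eq_abs, abs_mul, mul_comm]
        gcongr
        exact hM y
    _ = M * ∫ u, |G u| := by
        rw [integral_const_mul, integral_sub_left_eq_self (fun u => |G u|)]

theorem memLp_two_of_integrable_of_bounded {α : Type*} [MeasurableSpace α] {μ : Measure α}
    {f : α → ℝ} {M : ℝ} (hf : Integrable f μ) (hM : ∀ x, |f x| ≤ M) : MemLp f 2 μ := by
  rw [memLp_two_iff_integrable_sq hf.1]
  refine (hf.abs.const_mul M).mono (hf.1.pow 2) (ae_of_all _ fun x => ?_)
  have h0 : 0 ≤ M := (abs_nonneg _).trans (hM x)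
  rw [Real.norm_eq_abs, Real.norm_eq_abs, abs_pow, abs_mul, abs_abs, abs_of_nonneg h0, sq]
  gcongr
  exact hM x

theorem fourier_smooth {G f : E d → ℝ} (hG : Integrable G) (hf : Integrable f) (ξ : E d) :
    𝓕 (fun x => (smooth G f x : ℂ)) ξ
      = 𝓕 (fun x => (G x : ℂ)) ξ * 𝓕 (fun x => (f x : ℂ)) ξ := by
  have h : (fun x => (smooth G f x : ℂ)) = MeasureTheory.convolution (fun x => (f x : ℂ))
      (fun x => (G x : ℂ)) (ContinuousLinearMap.mul ℂ ℂ) volume := by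
    ext x
    rw [smooth, ← integral_complex_ofReal]
    simp [convolution, mul_comm]
  have hGc : Integrable (fun x => (G x : ℂ)) := hG.ofReal
  have hfc : Integrable (fun x => (f x : ℂ)) := hf.ofReal
  have key := Real.fourier_mul_convolution_eq hfc hGc ξ
  rw [h, mul_comm]
  exact key

section Scaled

variable {G : E d → ℝ} {h : ℝ}

theorem measurable_scaledKernel (hG : Measurable G) (h : ℝ) : Measurable (scaledKernel G h) := by
  unfold scaledKernel
  fun_prop

theorem integrable_scaledKernel (hG : Integrable G) (hh : 0 < h) :
    Integrable (scaledKernel G h) :=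
  (hG.comp_smul (inv_ne_zero hh.ne')).const_mul _

theorem integral_scale_comp {F : Type*} [NormedAddCommGroup F] [NormedSpace ℝ F] (hh : 0 < h)
    (g : E d → F) : ∫ u, (h ^ d)⁻¹ • g (h⁻¹ • u) = ∫ u, g u := by
  rw [integral_smul, Measure.integral_comp_inv_smul_of_nonneg volume g hh.le]
  simp [smul_smul, inv_mul_cancel₀ (pow_pos hh d).ne']

theorem integral_abs_scaledKernel (hh : 0 < h) : ∫ u, |scaledKernel G h u| = ∫ u, |G u| := by
  rw [← integral_scale_comp hh fun u => |G u|]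
  simp [scaledKernel, abs_mul, abs_of_pos (pow_pos hh d)]

theorem abs_scaledKernel_le {M : ℝ} (hM : ∀ u, |G u| ≤ M) (hh : 0 < h) (u : E d) :
    |scaledKernel G h u| ≤ M / h ^ d := by
  rw [scaledKernel, abs_mul, abs_of_pos (inv_pos.2 (pow_pos hh d)), div_eq_inv_mul]
  have := pow_pos hh d
  gcongr
  exact hM _

theorem scaledKernel_zero (G : E d → ℝ) (h : ℝ) : scaledKernel G h 0 = G 0 / h ^ d := by
  rw [scaledKernel, smul_zero, div_eq_inv_mul]

theorem scaledKernel_neg (hG : ∀ u, G (-u) = G u) (u : E d) :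
    scaledKernel G h (-u) = scaledKernel G h u := by
  rw [scaledKernel, smul_neg, hG, scaledKernel]

theorem fourier_scaledKernel (hh : 0 < h) (ξ : E d) :
    𝓕 (fun u => (scaledKernel G h u : ℂ)) ξ = 𝓕 (fun u => (G u : ℂ)) (h • ξ) := by
  rw [Real.fourier_eq, Real.fourier_eq,
    ← integral_scale_comp hh fun v => Real.fourierChar (-inner ℝ v (h • ξ)) • (G v : ℂ)]
  refine integral_congr_ae (ae_of_all _ fun u => ?_)
  have : inner ℝ (h⁻¹ • u) (h • ξ) = inner ℝ u ξ := by
    rw [real_inner_smul_left, real_inner_smul_right, ← mul_assoc, inv_mul_cancel₀ hh.ne', one_mul]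
  simp only [this, scaledKernel]
  rw [smul_comm]
  congr 1
  simp

end Scaled

/-- The properties of a kernel used for the linear expansion of a pairwise statistic. -/
structure GoodKernel (G : E d → ℝ) (P : ℝ) : Prop where
  order_pos : 0 < P
  measurable : Measurable G
  even : ∀ u, G (-u) = G u
  bounded : ∃ M : ℝ, ∀ u, |G u| ≤ M
  integrable : Integrable G
  flat : ∃ D : ℝ, ∀ ξ : E d, ‖𝓕 (fun u => (G u : ℂ)) ξ - 1‖ ≤ D * ‖ξ‖ ^ P

theorem ConditionK.goodKernel {K : E d → ℝ} {P : ℝ} (hK : ConditionK K P) : GoodKernel K P :=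
  ⟨hK.order_pos, hK.measurable, hK.even, hK.bounded, hK.integrable_kernel,
    hK.exists_norm_fourier_sub_one_le⟩

theorem norm_fourier_ofReal_le (G : E d → ℝ) (ξ : E d) :
    ‖𝓕 (fun u => (G u : ℂ)) ξ‖ ≤ ∫ u, |G u| := by
  have := VectorFourier.norm_fourierIntegral_le_integral_norm Real.fourierChar volume
    (innerₗ (E d)) (fun u => (G u : ℂ)) ξ
  simp only [Complex.norm_real, Real.norm_eq_abs] at this
  exact this

/-- The autocorrelation `K ∗ K` of an even kernel is as good as the kernel. -/
theorem GoodKernel.autoconv {K : E d → ℝ} {P : ℝ} (hK : GoodKernel K P) :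
    GoodKernel (smooth K K) P := by
  obtain ⟨M, hM⟩ := hK.bounded
  obtain ⟨D, hD⟩ := hK.flat
  refine ⟨hK.order_pos, measurable_smooth hK.measurable hK.measurable, fun u => ?_,
    ⟨_, abs_smooth_le hK.integrable hM⟩, integrable_smooth hK.integrable hK.integrable,
    ⟨D * ((∫ u, |K u|) + 1), fun ξ => ?_⟩⟩
  · rw [smooth, ← integral_neg_eq_self, smooth]
    refine integral_congr_ae (ae_of_all _ fun y => ?_)
    simp only
    rw [show -u - -y = -(u - y) by abel, hK.even, hK.even]
  · rw [fourier_smooth hK.integrable hK.integrable]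
    -- The transform of `K ∗ K` is the square of that of `K`, so flatness is inherited through this
    -- factorization, at the cost of the bounded factor `z + 1`.
    have e : ∀ z : ℂ, z * z - 1 = (z - 1) * (z + 1) := fun z => by ring
    rw [e, norm_mul]
    calc _ ≤ (D * ‖ξ‖ ^ P) * ((∫ u, |K u|) + 1) := by
          refine mul_le_mul (hD ξ) ((norm_add_le _ _).trans ?_) (norm_nonneg _)
            ((norm_nonneg _).trans (hD ξ))
          rw [norm_one]
          gcongr
          exact norm_fourier_ofReal_le K ξ
      _ = _ := by ring

/-- Rescaling commutes with autoconvolution. Therefore the integrated squared density is again a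
kernel statistic at bandwidth `h`, with kernel `K ∗ K`. -/
theorem scaledKernel_smooth (K : E d → ℝ) {h : ℝ} (hh : 0 < h) :
    scaledKernel (smooth K K) h = smooth (scaledKernel K h) (scaledKernel K h) := by
  ext v
  rw [scaledKernel, smooth, smooth, ← integral_scale_comp hh, ← integral_const_mul]
  refine integral_congr_ae (ae_of_all _ fun y => ?_)
  simp only [scaledKernel, smul_eq_mul, smul_sub]
  ring

/-- The squared `L²` error of a smoothing at bandwidth `h` is of the order `h^{2S}`. -/
theorem GoodKernel.exists_eLpNorm_smooth_sub_le {G : E d → ℝ} {P : ℝ} (hG : GoodKernel G P)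
    {f : E d → ℝ} (hf1 : Integrable f) {M : ℝ} (hM : ∀ x, |f x| ≤ M) {S C₀ : ℝ} (hS : 0 < S)
    (hSP : S < P) (hC₀ : 0 ≤ C₀) {m : ℕ}
    (hB : ∀ v, eLpNorm ((fwdDiff v)^[m] f) 2 volume ≤ ENNReal.ofReal (C₀ * ‖v‖ ^ S)) :
    ∃ C : ℝ, 0 ≤ C ∧ ∀ h, 0 < h → eLpNorm (smooth (scaledKernel G h) f - f) 2 volume ^ 2
      ≤ ENNReal.ofReal (C * (h ^ S) ^ 2) := by
  obtain ⟨D, hD⟩ := hG.flat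
  have hf2 := memLp_two_of_integrable_of_bounded hf1 hM
  obtain ⟨C, hC, hdy⟩ := exists_sq_le_dyadic_sum
    (F := fun ξ : E d => ‖𝓕 (fun u => (G u : ℂ)) ξ - 1‖) (A := (∫ u, |G u|) + 1) hG.order_pos
    (fun _ => norm_nonneg _)
    (fun ξ => (norm_sub_le _ _).trans (by rw [norm_one]; gcongr; exact norm_fourier_ofReal_le G ξ))
    hD m
  set W : ℝ := ∑' k : ℤ, dyadicWeight P k * (((2 : ℝ) ^ k) ^ S) ^ 2 with hW
  have hsum := summable_dyadicWeight hS hSP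
  have hW0 : 0 ≤ W := tsum_nonneg fun k => mul_nonneg (dyadicWeight_nonneg P k) (sq_nonneg _)
  refine ⟨C * (d * (C₀ ^ 2 * W)), by positivity, fun h hh => ?_⟩
  set Gh := scaledKernel G h with hGh
  have hGh1 : Integrable Gh := integrable_scaledKernel hG.integrable hh
  have hs1 : Integrable (smooth Gh f) := integrable_smooth hGh1 hf1
  have hs2 := memLp_two_of_integrable_of_bounded hs1 (abs_smooth_le hGh1 hM)
  have hd1 : Integrable (fun x => ((smooth Gh f x : ℂ) - (f x : ℂ))) := hs1.ofReal.sub hf1.ofReal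
  have hd2 : MemLp (fun x => ((smooth Gh f x : ℂ) - (f x : ℂ))) 2 := hs2.ofReal.sub hf2.ofReal
  have e1 : eLpNorm (smooth Gh f - f) 2 volume
      = eLpNorm (𝓕 (fun x => ((smooth Gh f x : ℂ) - (f x : ℂ)))) 2 volume := by
    rw [eLpNorm_fourier_eq hd1 hd2]
    refine eLpNorm_congr_norm_ae (ae_of_all _ fun x => ?_)
    rw [← Complex.ofReal_sub, Complex.norm_real, Pi.sub_apply]
  have e2 : ∀ ξ, 𝓕 (fun x => ((smooth Gh f x : ℂ) - (f x : ℂ))) ξ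
      = (𝓕 (fun u => (G u : ℂ)) (h • ξ) - 1) * 𝓕 (fun x => (f x : ℂ)) ξ := by
    intro ξ
    have : 𝓕 (fun x => ((smooth Gh f x : ℂ) - (f x : ℂ))) ξ
        = 𝓕 (fun x => (smooth Gh f x : ℂ)) ξ - 𝓕 (fun x => (f x : ℂ)) ξ := by
      simp only [Real.fourier_eq, smul_sub]
      exact integral_sub ((Real.fourierIntegral_convergent_iff ξ).2 hs1.ofReal)
        ((Real.fourierIntegral_convergent_iff ξ).2 hf1.ofReal)
    rw [this, fourier_smooth hGh1 hf1, hGh, fourier_scaledKernel hh]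
    ring
  have hfc : Continuous (𝓕 (fun x => (f x : ℂ))) :=
    VectorFourier.fourierIntegral_continuous Real.continuous_fourierChar (L := innerₗ (E d))
      continuous_inner hf1.ofReal
  have hcm : ∀ (i : Fin d) (k : ℤ), Measurable fun ξ : E d =>
      ‖(Real.fourierChar ((2 : ℝ) ^ k * (h • ξ) i) : ℂ) - 1‖ₑ ^ (2 * m)
        * ‖𝓕 (fun x => (f x : ℂ)) ξ‖ₑ ^ 2 := by
    intro i k
    have h1 : Measurable fun ξ : E d => ‖𝓕 (fun x => (f x : ℂ)) ξ‖ₑ ^ 2 :=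
      hfc.measurable.enorm.pow_const 2
    have h2 : Continuous fun ξ : E d =>
        (Real.fourierChar ((2 : ℝ) ^ k * (h • ξ) i) : ℂ) - 1 := by
      refine Continuous.sub ?_ continuous_const
      exact continuous_subtype_val.comp (Real.continuous_fourierChar.comp (by fun_prop))
    exact (h2.measurable.enorm.pow_const _).mul h1
  -- At frequency `h ξ`, the `k`-th dyadic symbol in coordinate `i` is the symbol of a difference
  -- with step `2 ^ k h` along the `i`-th axis. Plancherel turns its integral against `|𝓕 f|²` into
  -- the squared norm of that difference, which the smoothness bound controls.
  have hterm : ∀ (i : Fin d) (k : ℤ), ∫⁻ ξ : E d,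
      ‖(Real.fourierChar ((2 : ℝ) ^ k * (h • ξ) i) : ℂ) - 1‖ₑ ^ (2 * m)
        * ‖𝓕 (fun x => (f x : ℂ)) ξ‖ₑ ^ 2
      ≤ ENNReal.ofReal ((C₀ * h ^ S) ^ 2 * (((2 : ℝ) ^ k) ^ S) ^ 2) := by
    intro i k
    set v : E d := EuclideanSpace.single i ((2 : ℝ) ^ k * h) with hv
    have hτ : (0 : ℝ) < 2 ^ k := by positivity
    have hvn : ‖v‖ = 2 ^ k * h := by
      rw [hv, PiLp.norm_single, Real.norm_eq_abs, abs_of_pos (by positivity)]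
    have hin : ∀ ξ : E d, inner ℝ v ξ = (2 : ℝ) ^ k * (h • ξ) i := by
      intro ξ
      rw [hv, EuclideanSpace.inner_single_left]
      simp
      ring
    calc _ = eLpNorm ((fwdDiff v)^[m] f) 2 volume ^ 2 := by
          rw [← lintegral_symbol_mul_fourier hf1 hf2]
          simp_rw [hin]
      _ ≤ ENNReal.ofReal (C₀ * ‖v‖ ^ S) ^ 2 := by
          gcongr
          exact hB v
      _ = _ := by
          rw [← ENNReal.ofReal_pow (by positivity), hvn, Real.mul_rpow hτ.le hh.le]
          congr 1
          ring
  calc eLpNorm (smooth Gh f - f) 2 volume ^ 2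
      = ∫⁻ ξ, ENNReal.ofReal (‖𝓕 (fun u => (G u : ℂ)) (h • ξ) - 1‖ ^ 2)
          * ‖𝓕 (fun x => (f x : ℂ)) ξ‖ₑ ^ 2 := by
        rw [e1, eLpNorm_two_sq]
        refine lintegral_congr fun ξ => ?_
        rw [e2, enorm_mul, mul_pow, ENNReal.ofReal_pow (norm_nonneg _), ofReal_norm]
    _ ≤ ∫⁻ ξ, ENNReal.ofReal C * ∑ i : Fin d, ∑' k : ℤ, ENNReal.ofReal (dyadicWeight P k) *
          (‖(Real.fourierChar ((2 : ℝ) ^ k * (h • ξ) i) : ℂ) - 1‖ₑ ^ (2 * m)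
            * ‖𝓕 (fun x => (f x : ℂ)) ξ‖ₑ ^ 2) := by
        refine lintegral_mono fun ξ => ?_
        refine (mul_le_mul_left (hdy (h • ξ)) _).trans (le_of_eq ?_)
        rw [mul_assoc, Finset.sum_mul]
        simp_rw [← ENNReal.tsum_mul_right, mul_assoc]
    _ = ENNReal.ofReal C * ∑ i : Fin d, ∑' k : ℤ, ENNReal.ofReal (dyadicWeight P k) *
          ∫⁻ ξ : E d, (‖(Real.fourierChar ((2 : ℝ) ^ k * (h • ξ) i) : ℂ) - 1‖ₑ ^ (2 * m)
            * ‖𝓕 (fun x => (f x : ℂ)) ξ‖ₑ ^ 2) := by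
        have hm : ∀ (i : Fin d) (k : ℤ), Measurable fun ξ : E d =>
            ENNReal.ofReal (dyadicWeight P k) *
            (‖(Real.fourierChar ((2 : ℝ) ^ k * (h • ξ) i) : ℂ) - 1‖ₑ ^ (2 * m)
            * ‖𝓕 (fun x => (f x : ℂ)) ξ‖ₑ ^ 2) := fun i k => (hcm i k).const_mul _
        rw [lintegral_const_mul _ (Finset.measurable_sum _ fun i _ =>
          Measurable.tsum fun k => hm i k), lintegral_finsetSum _ fun i _ =>
          Measurable.tsum fun k => hm i k]
        congr 1
        refine Finset.sum_congr rfl fun i _ => ?_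
        rw [lintegral_tsum fun k => (hm i k).aemeasurable]
        exact tsum_congr fun k => lintegral_const_mul _ (hcm i k)
    _ ≤ ENNReal.ofReal C * ∑ i : Fin d, ∑' k : ℤ, ENNReal.ofReal (dyadicWeight P k) *
          ENNReal.ofReal ((C₀ * h ^ S) ^ 2 * (((2 : ℝ) ^ k) ^ S) ^ 2) := by
        gcongr with i _ k
        exact hterm i k
    _ = ENNReal.ofReal C * ∑ i : Fin d, ENNReal.ofReal ((C₀ * h ^ S) ^ 2 * W) := by
        congr 1
        refine Finset.sum_congr rfl fun i _ => ?_
        rw [hW, ← tsum_mul_left, ENNReal.ofReal_tsum_of_nonneg (fun k => by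
          have := dyadicWeight_nonneg P k
          positivity) (hsum.mul_left _)]
        refine tsum_congr fun k => ?_
        rw [← ENNReal.ofReal_mul (dyadicWeight_nonneg P k)]
        congr 1
        ring
    _ = _ := by
        rw [Finset.sum_const, Finset.card_univ, Fintype.card_fin, nsmul_eq_mul,
          ← ENNReal.ofReal_natCast, ← ENNReal.ofReal_mul (by positivity),
          ← ENNReal.ofReal_mul hC]
        congr 1
        ring

end Smoothing

/-! ### Kernel bounds under a bounded Besov density, and the locally robust bias. -/

section DensityBounds

variable {d : ℕ}

/-- The exponent drops from `s` to `S` while the order of the difference stays `⌊s⌋ + 1`. For `‖v‖ ≤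
1` the powers compare directly; for `‖v‖ ≥ 1` the trivial bound `2 ^ m ‖f‖` on the `m`-th difference
is enough. -/
theorem MemBesovTwoInfty.exists_le {s S : ℝ} {f : E d → ℝ} (hf : MemBesovTwoInfty s f)
    (hS : 0 < S) (hSs : S ≤ s) : ∃ C₀ : ℝ, 0 ≤ C₀ ∧ ∀ v,
      eLpNorm ((fwdDiff v)^[⌊s⌋₊ + 1] f) 2 volume ≤ ENNReal.ofReal (C₀ * ‖v‖ ^ S) := by
  obtain ⟨h2, C, hC⟩ := hf
  set N := (eLpNorm f 2 volume).toReal with hN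
  have hN0 : 0 ≤ N := ENNReal.toReal_nonneg
  refine ⟨|C| + 2 ^ (⌊s⌋₊ + 1) * N, by positivity, fun v => ?_⟩
  rcases le_total ‖v‖ 1 with h | h
  · refine (hC v).trans (ENNReal.ofReal_le_ofReal ?_)
    have hle : ‖v‖ ^ s ≤ ‖v‖ ^ S := by
      rcases eq_or_lt_of_le (norm_nonneg v) with h0 | h0
      · rw [← h0, Real.zero_rpow hS.ne', Real.zero_rpow (hS.trans_le hSs).ne']
      · exact Real.rpow_le_rpow_of_exponent_ge h0 h hSs
    calc C * ‖v‖ ^ s ≤ |C| * ‖v‖ ^ S := by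
          gcongr
          exact le_abs_self C
      _ ≤ _ := by
          gcongr
          exact le_add_of_nonneg_right (by positivity)
  · refine ((memLp_fwdDiff_iterate h2 v _).2).trans ?_
    rw [← ENNReal.ofReal_toReal h2.2.ne, ← hN,
      show (2 : ℝ≥0∞) ^ (⌊s⌋₊ + 1) = ENNReal.ofReal (2 ^ (⌊s⌋₊ + 1)) by
        rw [ENNReal.ofReal_pow (by norm_num)]; norm_num,
      ← ENNReal.ofReal_mul (by positivity)]
    refine ENNReal.ofReal_le_ofReal ?_
    calc (2 : ℝ) ^ (⌊s⌋₊ + 1) * N = 2 ^ (⌊s⌋₊ + 1) * N * 1 := (mul_one _).symm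
      _ ≤ (|C| + 2 ^ (⌊s⌋₊ + 1) * N) * ‖v‖ ^ S := by
          gcongr
          · exact le_add_of_nonneg_left (abs_nonneg C)
          · exact Real.one_le_rpow h hS.le

variable {f₀ : E d → ℝ}

theorem integral_densityLaw {F : Type*} [NormedAddCommGroup F] [NormedSpace ℝ F]
    (hf₀ : Measurable f₀) (h0 : ∀ x, 0 ≤ f₀ x) (g : E d → F) :
    ∫ x, g x ∂(densityLaw f₀) = ∫ x, f₀ x • g x := by
  rw [densityLaw, integral_withDensity_eq_integral_toReal_smul (by fun_prop)
    (ae_of_all _ fun _ => ENNReal.ofReal_lt_top)]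
  exact integral_congr_ae (ae_of_all _ fun x => by simp [ENNReal.toReal_ofReal (h0 x)])

theorem integrable_density [IsProbabilityMeasure (densityLaw f₀)] (hf₀ : Measurable f₀)
    (h0 : ∀ x, 0 ≤ f₀ x) : Integrable f₀ ∧ ∫ x, f₀ x = 1 := by
  have h1 : ∫⁻ x, ENNReal.ofReal (f₀ x) = 1 := by
    have := measure_univ (μ := densityLaw f₀)
    rwa [densityLaw, withDensity_apply _ MeasurableSet.univ, setLIntegral_univ] at this
  refine ⟨⟨hf₀.aestronglyMeasurable, ?_⟩, ?_⟩
  · rw [hasFiniteIntegral_iff_ofReal (ae_of_all _ h0), h1]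
    exact ENNReal.one_lt_top
  · rw [integral_eq_lintegral_of_nonneg_ae (ae_of_all _ h0) hf₀.aestronglyMeasurable, h1]
    rfl

theorem smooth_eq_integral_densityLaw (hf₀ : Measurable f₀) (h0 : ∀ x, 0 ≤ f₀ x) (H : E d → ℝ)
    (x : E d) : ∫ y, H (x - y) ∂(densityLaw f₀) = smooth H f₀ x := by
  rw [integral_densityLaw hf₀ h0, smooth]
  exact integral_congr_ae (ae_of_all _ fun y => by simp [mul_comm])

/-- Convolution with an even kernel is self-adjoint, by Fubini's theorem. -/
theorem integral_mul_smooth_comm {H f φ : E d → ℝ} (hH : Integrable H) (hHe : ∀ u, H (-u) = H u)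
    (hf : Measurable f) {M : ℝ} (hM : ∀ x, |f x| ≤ M) (hφ : Integrable φ) :
    ∫ x, f x * smooth H φ x = ∫ x, φ x * smooth H f x := by
  have hint : Integrable (Function.uncurry fun x w => f x * (H (x - w) * φ w))
      (volume.prod volume) := by
    have h1 : Integrable (fun p : E d × E d => φ p.2 * H (p.1 - p.2)) (volume.prod volume) :=
      hφ.convolution_integrand (ContinuousLinearMap.mul ℝ ℝ) hH
    have := h1.bdd_mul (c := M) (f := fun p : E d × E d => f p.1)
      (hf.comp measurable_fst).aestronglyMeasurable (ae_of_all _ fun p => hM p.1)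
    refine this.congr (ae_of_all _ fun p => ?_)
    simp only [Function.uncurry]
    ring
  simp_rw [smooth, ← integral_const_mul]
  rw [integral_integral_swap hint]
  refine integral_congr_ae (ae_of_all _ fun w => integral_congr_ae (ae_of_all _ fun x => ?_))
  simp only
  rw [← hHe (x - w), neg_sub]
  ring

/-- Associativity of convolution, read off from self-adjointness applied to the translate `w ↦ H (x
- w)`. -/
theorem smooth_smooth {H f : E d → ℝ} (hH : Integrable H) (hHe : ∀ u, H (-u) = H u)
    (hf : Measurable f) {M : ℝ} (hM : ∀ x, |f x| ≤ M) (x : E d) :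
    smooth (smooth H H) f x = smooth H (smooth H f) x := by
  have h1 : ∀ y, smooth H H (x - y) = smooth H (fun w => H (x - w)) y := by
    intro y
    simp only [smooth]
    rw [← integral_sub_left_eq_self _ volume (x - y)]
    rw [← integral_add_right_eq_self _ (-y)]
    refine integral_congr_ae (ae_of_all _ fun w => ?_)
    simp only
    rw [← hHe (y - w), show x - y - (x - y - (w + -y)) = -(y - w) by abel,
      show x - y - (w + -y) = x - w by abel]
  have h2 := integral_mul_smooth_comm hH hHe hf hM (hH.comp_sub_left x)
  rw [smooth, smooth, ← h2]
  refine integral_congr_ae (ae_of_all _ fun y => ?_)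
  simp only
  rw [h1, mul_comm]

/-- The bounds on a kernel at bandwidth `h`, with respect to a law with a density. -/
structure KernelBounds (G : E d → ℝ) (f₀ : E d → ℝ) (S C h : ℝ) : Prop where
  abs_smooth_le : ∀ x, |smooth (scaledKernel G h) f₀ x| ≤ C
  sq_le : ∀ x, ∫ y, scaledKernel G h (x - y) ^ 2 ∂(densityLaw f₀) ≤ C / h ^ d
  error_le : ∫ x, (smooth (scaledKernel G h) f₀ x - f₀ x) ^ 2 ≤ C * (h ^ S) ^ 2

/-- The sup bound and the second moment use only `|f₀| ≤ M`, the latter with `G_h² ≤ (A / h^d)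
|G_h|`. The error bound is the Plancherel estimate. One constant, independent of `h`, serves all
three. -/
theorem GoodKernel.exists_kernelBounds [IsProbabilityMeasure (densityLaw f₀)]
    {G : E d → ℝ} {P s S : ℝ} (hG : GoodKernel G P)
    (hf₀ : Measurable f₀) (h0 : ∀ x, 0 ≤ f₀ x) (hb : ∃ M : ℝ, ∀ x, |f₀ x| ≤ M)
    (hB : MemBesovTwoInfty s f₀) (hS : 0 < S) (hSs : S ≤ s) (hSP : S < P) :
    ∃ C : ℝ, 0 < C ∧ ∀ h, 0 < h → KernelBounds G f₀ S C h := by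
  obtain ⟨M, hM⟩ := hb
  obtain ⟨A, hA⟩ := hG.bounded
  obtain ⟨hf1, hf11⟩ := integrable_density hf₀ h0
  obtain ⟨C₀, hC₀, hB⟩ := hB.exists_le hS hSs
  obtain ⟨C₁, hC₁, hC₁'⟩ := hG.exists_eLpNorm_smooth_sub_le hf1 hM hS hSP hC₀ hB
  have hM0 : 0 ≤ M := (abs_nonneg _).trans (hM 0)
  have hA0 : 0 ≤ A := (abs_nonneg _).trans (hA 0)
  set I := ∫ u, |G u| with hI
  have hI0 : 0 ≤ I := integral_nonneg fun u => abs_nonneg _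
  refine ⟨A + M * I + M * A * I + C₁ + 1, by positivity, fun h hh => ?_⟩
  have hhd : 0 < h ^ d := pow_pos hh d
  have hH1 := integrable_scaledKernel hG.integrable hh
  refine ⟨fun x => ?_, fun x => ?_, ?_⟩
  · refine (AvgDensity.abs_smooth_le hH1 hM x).trans ?_
    rw [integral_abs_scaledKernel hh]
    nlinarith [mul_nonneg hM0 hI0, mul_nonneg (mul_nonneg hM0 hA0) hI0]
  · rw [integral_densityLaw hf₀ h0]
    have h1 : Integrable fun y => M * (A / h ^ d) * |scaledKernel G h (x - y)| :=
      (hH1.abs.comp_sub_left x).const_mul _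
    calc _ ≤ ∫ y, M * (A / h ^ d) * |scaledKernel G h (x - y)| := by
          refine integral_mono_of_nonneg (ae_of_all _ fun y => ?_) h1 (ae_of_all _ fun y => ?_)
          · exact mul_nonneg (h0 y) (sq_nonneg _)
          · simp only [smul_eq_mul]
            rw [← sq_abs, sq, mul_assoc]
            have h2 := abs_scaledKernel_le hA hh (x - y)
            have h3 : f₀ y ≤ M := (le_abs_self _).trans (hM y)
            gcongr
      _ = M * A * I / h ^ d := by
          rw [integral_const_mul, integral_sub_left_eq_self (fun u => |scaledKernel G h u|),
            integral_abs_scaledKernel hh]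
          ring
      _ ≤ _ := by
          gcongr
          nlinarith [mul_nonneg hM0 hI0, mul_nonneg (mul_nonneg hM0 hA0) hI0]
  · have h1 : ∫ x, (smooth (scaledKernel G h) f₀ x - f₀ x) ^ 2 ≤ C₁ * (h ^ S) ^ 2 := by
      have hm : Measurable fun x => (smooth (scaledKernel G h) f₀ x - f₀ x) ^ 2 :=
        ((measurable_smooth (measurable_scaledKernel hG.measurable h) hf₀).sub hf₀).pow_const 2
      rw [integral_eq_lintegral_of_nonneg_ae (ae_of_all _ fun _ => sq_nonneg _)
        hm.aestronglyMeasurable]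
      refine ENNReal.toReal_le_of_le_ofReal (by positivity) ?_
      refine le_trans (le_of_eq ?_) (hC₁' h hh)
      rw [eLpNorm_two_sq]
      refine lintegral_congr fun x => ?_
      rw [Real.enorm_eq_ofReal_abs, ← ENNReal.ofReal_pow (abs_nonneg _), sq_abs, Pi.sub_apply]
    refine h1.trans ?_
    gcongr
    nlinarith [mul_nonneg hM0 hI0, mul_nonneg (mul_nonneg hM0 hA0) hI0]

/-- The bias of the locally robust combination is minus the integrated squared error of the
smoothed density. -/
theorem locallyRobust_bias [IsProbabilityMeasure (densityLaw f₀)]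
    {K : E d → ℝ} {P h : ℝ} (hK : GoodKernel K P) (hh : 0 < h)
    (hf₀ : Measurable f₀) (h0 : ∀ x, 0 ≤ f₀ x) {M : ℝ} (hM : ∀ x, |f₀ x| ≤ M) :
    2 * ∫ x, smooth (scaledKernel K h) f₀ x ∂(densityLaw f₀)
      - ∫ x, smooth (scaledKernel (smooth K K) h) f₀ x ∂(densityLaw f₀) - averageDensity f₀
      = - ∫ x, (smooth (scaledKernel K h) f₀ x - f₀ x) ^ 2 := by
  obtain ⟨hf1, -⟩ := integrable_density hf₀ h0
  have hH1 := integrable_scaledKernel hK.integrable hh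
  have hHe : ∀ u, scaledKernel K h (-u) = scaledKernel K h u := scaledKernel_neg hK.even
  set g := smooth (scaledKernel K h) f₀ with hg
  have hg1 : Integrable g := integrable_smooth hH1 hf1
  have hg2 : MemLp g 2 := memLp_two_of_integrable_of_bounded hg1 (abs_smooth_le hH1 hM)
  have hf2 : MemLp f₀ 2 := memLp_two_of_integrable_of_bounded hf1 hM
  -- Self-adjointness moves one of the two convolutions onto `f₀`, so the mean for `K ∗ K` is `∫
  -- (K_h ∗ f₀)²`; what remains is completing the square.
  have e1 : ∫ x, smooth (scaledKernel (smooth K K) h) f₀ x ∂(densityLaw f₀) = ∫ x, g x ^ 2 := by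
    rw [integral_densityLaw hf₀ h0, scaledKernel_smooth K hh]
    simp_rw [smul_eq_mul, smooth_smooth hH1 hHe hf₀ hM]
    rw [integral_mul_smooth_comm hH1 hHe hf₀ hM hg1]
    simp_rw [sq]
    rfl
  have i1 : Integrable fun x => f₀ x * g x := hf2.integrable_mul hg2
  rw [e1, averageDensity, integral_densityLaw hf₀ h0, integral_densityLaw hf₀ h0]
  have i2 : Integrable fun x => 2 * (f₀ x * g x) := i1.const_mul 2
  have e2 : ∀ x, (g x - f₀ x) ^ 2 = g x ^ 2 - 2 * (f₀ x * g x) + f₀ x ^ 2 := fun x => by ring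
  have i3 : Integrable fun x => g x ^ 2 - 2 * (f₀ x * g x) := hg2.integrable_sq.sub i2
  simp_rw [e2, smul_eq_mul]
  rw [integral_add i3 hf2.integrable_sq, integral_sub hg2.integrable_sq i2, integral_const_mul]
  simp_rw [sq]
  ring

end DensityBounds

/-! ### Second moments of linear and degenerate quadratic statistics of an independent sample. -/

section PiMeasure

variable {α : Type*} [MeasurableSpace α] {n : ℕ}

/-- Replacing one coordinate by an independent copy does not change the product law, as is seen on
boxes. This is Fubini's theorem for a single coordinate without splitting the index set. -/
theorem measurePreserving_update (Q : Measure α) [IsProbabilityMeasure Q] (k : Fin n) :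
    MeasurePreserving (fun p : (Fin n → α) × α => Function.update p.1 k p.2)
      ((Measure.pi fun _ => Q).prod Q) (Measure.pi fun _ => Q) := by
  classical
  have hm : Measurable (fun p : (Fin n → α) × α => Function.update p.1 k p.2) := by
    refine measurable_pi_lambda _ fun i => ?_
    by_cases h : i = k
    · subst h
      simpa using measurable_snd
    · simpa [Function.update_of_ne h] using
        show Measurable fun p : (Fin n → α) × α => p.1 i by fun_prop
  refine ⟨hm, (Measure.pi_eq fun s hs => ?_).symm⟩
  rw [Measure.map_apply hm (MeasurableSet.univ_pi hs)]
  have hpre : (fun p : (Fin n → α) × α => Function.update p.1 k p.2) ⁻¹' Set.univ.pi s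
      = Set.univ.pi (Function.update s k Set.univ) ×ˢ s k := by
    ext p
    simp only [Set.mem_preimage, Set.mem_univ_pi, Set.mem_prod]
    constructor
    · refine fun h => ⟨fun i => ?_, by simpa using h k⟩
      by_cases hi : i = k
      · subst hi; simp
      · simpa [Function.update_of_ne hi] using h i
    · rintro ⟨h1, h2⟩ i
      by_cases hi : i = k
      · subst hi; simpa using h2
      · simpa [Function.update_of_ne hi] using h1 i
  rw [hpre, Measure.prod_prod, Measure.pi_pi, ← Finset.mul_prod_erase _ _ (Finset.mem_univ k),
    ← Finset.mul_prod_erase Finset.univ (fun i => Q (s i)) (Finset.mem_univ k)]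
  simp only [Function.update_self, measure_univ, one_mul]
  rw [mul_comm]
  congr 1
  refine Finset.prod_congr rfl fun i hi => ?_
  rw [Function.update_of_ne (Finset.ne_of_mem_erase hi)]

variable {Q : Measure α} [IsProbabilityMeasure Q]

/-- Integrating out one coordinate first. -/
theorem integral_pi_update {H : (Fin n → α) → ℝ} (hH : Integrable H (Measure.pi fun _ => Q))
    (k : Fin n) : ∫ y, H y ∂(Measure.pi fun _ => Q)
      = ∫ y, ∫ z, H (Function.update y k z) ∂Q ∂(Measure.pi fun _ => Q) := by
  have hp := measurePreserving_update Q k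
  have h1 : ∫ y, H y ∂(Measure.pi fun _ => Q) = ∫ p : (Fin n → α) × α,
      H (Function.update p.1 k p.2) ∂((Measure.pi fun _ => Q).prod Q) := by
    rw [← integral_map (f := H) hp.measurable.aemeasurable (by rw [hp.map_eq]; exact hH.1),
      hp.map_eq]
  rw [h1, integral_prod (fun p : (Fin n → α) × α => H (Function.update p.1 k p.2))
    (hp.integrable_comp_of_integrable hH)]

/-- The device that removes all cross moments. Integrability need not be assumed, because a
nonintegrable function has Bochner integral zero by convention. -/
theorem integral_pi_eq_zero {H : (Fin n → α) → ℝ} (k : Fin n)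
    (h0 : ∀ y, ∫ z, H (Function.update y k z) ∂Q = 0) :
    ∫ y, H y ∂(Measure.pi fun _ => Q) = 0 := by
  by_cases hH : Integrable H (Measure.pi fun _ => Q)
  · rw [integral_pi_update hH k]
    simp [h0]
  · exact integral_undef hH

theorem integral_pi_eval {φ : α → ℝ} (hφ : Measurable φ) (i : Fin n) :
    ∫ y, φ (y i) ∂(Measure.pi fun _ : Fin n => Q) = ∫ x, φ x ∂Q := by
  have hp := measurePreserving_eval (fun _ : Fin n => Q) i
  exact (integral_map hp.measurable.aemeasurable (by
    rw [hp.map_eq]; exact hφ.aestronglyMeasurable)).symm.trans (by rw [hp.map_eq])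

theorem integrable_of_bounded {β : Type*} [MeasurableSpace β] {μ : Measure β} [IsFiniteMeasure μ]
    {f : β → ℝ} (hf : Measurable f) (hb : ∃ M : ℝ, ∀ x, |f x| ≤ M) : Integrable f μ := by
  obtain ⟨M, hM⟩ := hb
  exact Integrable.of_bound hf.aestronglyMeasurable M (ae_of_all _ hM)

theorem measurable_uncurry_eval {φ : α → α → ℝ} (hφ : Measurable (Function.uncurry φ))
    (i j : Fin n) : Measurable fun y : Fin n → α => φ (y i) (y j) := by
  have : Measurable fun y : Fin n → α => (y i, y j) := by fun_prop
  exact hφ.comp this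

theorem integral_pi_eval_pair {φ : α → α → ℝ} (hφ : Measurable (Function.uncurry φ))
    (hb : ∃ M : ℝ, ∀ x y, |φ x y| ≤ M) {i j : Fin n} (hij : i ≠ j) :
    ∫ y, φ (y i) (y j) ∂(Measure.pi fun _ : Fin n => Q) = ∫ x, ∫ y, φ x y ∂Q ∂Q := by
  obtain ⟨M, hM⟩ := hb
  rw [integral_pi_update (integrable_of_bounded (f := fun y : Fin n → α => φ (y i) (y j))
    (measurable_uncurry_eval hφ i j) ⟨M, fun y => hM _ _⟩) j]
  simp only [Function.update_self, Function.update_of_ne hij]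
  exact integral_pi_eval (φ := fun x => ∫ y, φ x y ∂Q)
    (hφ.stronglyMeasurable.integral_prod_right (ν := Q)).measurable i

/-- Second moment of a weighted sum of independent centered summands. -/
theorem integral_sq_sum_eval_le {ψ : α → ℝ} (hψ : Measurable ψ) (hb : ∃ M : ℝ, ∀ x, |ψ x| ≤ M)
    (h0 : ∫ x, ψ x ∂Q = 0) {c : Fin n → ℝ} {β : ℝ} (hc : ∀ i, |c i| ≤ β) :
    ∫ y, (∑ i, c i * ψ (y i)) ^ 2 ∂(Measure.pi fun _ : Fin n => Q)
      ≤ n * β ^ 2 * ∫ x, ψ x ^ 2 ∂Q := by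
  obtain ⟨M, hM⟩ := hb
  have hV : 0 ≤ ∫ x, ψ x ^ 2 ∂Q := integral_nonneg fun x => sq_nonneg _
  have hint : ∀ i j : Fin n, Integrable (fun y : Fin n → α => c i * ψ (y i) * (c j * ψ (y j)))
      (Measure.pi fun _ : Fin n => Q) := by
    intro i j
    refine integrable_of_bounded (by fun_prop) ⟨|c i| * M * (|c j| * M), fun y => ?_⟩
    rw [abs_mul, abs_mul, abs_mul]
    have := hM (y i)
    have := hM (y j)
    have : 0 ≤ M := (abs_nonneg _).trans this
    gcongr
  have hcross : ∀ i j : Fin n, i ≠ j → ∫ y, c i * ψ (y i) * (c j * ψ (y j))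
      ∂(Measure.pi fun _ : Fin n => Q) = 0 := by
    intro i j hij
    refine integral_pi_eq_zero j fun y => ?_
    simp only [Function.update_self, Function.update_of_ne hij]
    rw [integral_const_mul, integral_const_mul, h0, mul_zero, mul_zero]
  simp_rw [sq, Finset.sum_mul_sum]
  rw [integral_finsetSum _ fun i _ => integrable_finsetSum _ fun j _ => hint i j]
  have hi : ∀ i : Fin n, ∫ y, ∑ j, c i * ψ (y i) * (c j * ψ (y j))
      ∂(Measure.pi fun _ : Fin n => Q) ≤ β ^ 2 * ∫ x, ψ x ^ 2 ∂Q := by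
    intro i
    rw [integral_finsetSum _ fun j _ => hint i j, Finset.sum_eq_single_of_mem i (Finset.mem_univ i)
      fun j _ hj => hcross i j hj.symm]
    have e : ∀ y : Fin n → α, c i * ψ (y i) * (c i * ψ (y i)) = c i ^ 2 * ψ (y i) ^ 2 :=
      fun y => by ring
    simp_rw [e]
    rw [integral_const_mul, integral_pi_eval (φ := fun x => ψ x ^ 2) (hψ.pow_const 2)]
    refine mul_le_mul_of_nonneg_right ?_ hV
    rw [← sq_abs]
    exact pow_le_pow_left₀ (abs_nonneg _) (hc i) 2
  calc _ ≤ ∑ i : Fin n, β ^ 2 * ∫ x, ψ x ^ 2 ∂Q := Finset.sum_le_sum fun i _ => hi i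
    _ = _ := by simp [sq, mul_assoc]

/-- Second moment of a weighted degenerate `U`-statistic. -/
theorem integral_sq_degenerate_le {φ : α → α → ℝ} (hφ : Measurable (Function.uncurry φ))
    (hb : ∃ M : ℝ, ∀ x y, |φ x y| ≤ M) (hs : ∀ x y, φ x y = φ y x)
    (h0 : ∀ x, ∫ y, φ x y ∂Q = 0) {b : Fin n → Fin n → ℝ} (hbd : ∀ i, b i i = 0) {β : ℝ}
    (hβ : ∀ i j, |b i j| ≤ β) :
    ∫ y, (∑ i, ∑ j, b i j * φ (y i) (y j)) ^ 2 ∂(Measure.pi fun _ : Fin n => Q)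
      ≤ 2 * n ^ 2 * β ^ 2 * ∫ x, ∫ y, φ x y ^ 2 ∂Q ∂Q := by
  classical
  obtain ⟨M, hM⟩ := hb
  set V := ∫ x, ∫ y, φ x y ^ 2 ∂Q ∂Q with hVdef
  have hV : 0 ≤ V := integral_nonneg fun x => integral_nonneg fun y => sq_nonneg _
  have hm : ∀ i j : Fin n, Measurable fun y : Fin n → α => φ (y i) (y j) := 
    measurable_uncurry_eval hφ
  have hint : ∀ p q : Fin n × Fin n, Integrable (fun y : Fin n → α =>
      b p.1 p.2 * φ (y p.1) (y p.2) * (b q.1 q.2 * φ (y q.1) (y q.2)))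
      (Measure.pi fun _ : Fin n => Q) := by
    intro p q
    refine integrable_of_bounded (((hm _ _).const_mul _).mul ((hm _ _).const_mul _))
      ⟨|b p.1 p.2| * M * (|b q.1 q.2| * M), fun y => ?_⟩
    rw [abs_mul, abs_mul, abs_mul]
    have h1 := hM (y p.1) (y p.2)
    have h2 := hM (y q.1) (y q.2)
    have : 0 ≤ M := (abs_nonneg _).trans h1
    gcongr
  -- If the index pairs `p` and `q` have distinct entries and do not coincide as unordered pairs,
  -- some index of `q` does not occur in `p`, and integrating that coordinate alone gives zero by
  -- degeneracy. Pairs on the diagonal carry zero weight.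
  have hcross : ∀ p q : Fin n × Fin n, q ≠ p → q ≠ p.swap → ∫ y : Fin n → α,
      b p.1 p.2 * φ (y p.1) (y p.2) * (b q.1 q.2 * φ (y q.1) (y q.2))
      ∂(Measure.pi fun _ : Fin n => Q) = 0 := by
    rintro ⟨i, j⟩ ⟨k, l⟩ h1 h2
    simp only
    by_cases hij : i = j
    · simp [hij, hbd]
    by_cases hkl : k = l
    · simp [hkl, hbd]
    by_cases hk : k = i ∨ k = j
    · have hl : l ≠ i ∧ l ≠ j := by
        simp only [ne_eq, Prod.mk.injEq, not_and, Prod.swap_prod_mk] at h1 h2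
        rcases hk with rfl | rfl
        · exact ⟨fun h => hkl h.symm, fun h => h1 rfl h⟩
        · exact ⟨fun h => h2 rfl h, fun h => hkl h.symm⟩
      refine integral_pi_eq_zero l fun y => ?_
      simp only [Function.update_self, Function.update_of_ne hl.1.symm,
        Function.update_of_ne hl.2.symm, Function.update_of_ne hkl]
      rw [integral_const_mul, integral_const_mul, h0, mul_zero, mul_zero]
    · rw [not_or] at hk
      refine integral_pi_eq_zero k fun y => ?_
      simp only [Function.update_self, Function.update_of_ne (Ne.symm hk.1),
        Function.update_of_ne (Ne.symm hk.2), Function.update_of_ne (Ne.symm hkl)]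
      simp_rw [fun z => hs z (y l)]
      rw [integral_const_mul, integral_const_mul, h0, mul_zero, mul_zero]
  have hdiag : ∀ p q : Fin n × Fin n, q = p ∨ q = p.swap → ∫ y : Fin n → α,
      b p.1 p.2 * φ (y p.1) (y p.2) * (b q.1 q.2 * φ (y q.1) (y q.2))
      ∂(Measure.pi fun _ : Fin n => Q) ≤ β ^ 2 * V := by
    rintro ⟨i, j⟩ q hq
    by_cases hij : i = j
    · simp only [hij, hbd, zero_mul, integral_zero]
      positivity
    have e : ∀ y : Fin n → α, b i j * φ (y i) (y j) * (b q.1 q.2 * φ (y q.1) (y q.2))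
        = (b i j * b q.1 q.2) * φ (y i) (y j) ^ 2 := by
      intro y
      rcases hq with rfl | rfl
      · simp only
        ring
      · simp only [Prod.swap_prod_mk]
        rw [hs (y j) (y i)]
        ring
    simp_rw [e]
    rw [integral_const_mul, integral_pi_eval_pair (φ := fun x y => φ x y ^ 2) (hφ.pow_const 2)
      ⟨M ^ 2, fun x y => by
        rw [abs_pow]
        exact pow_le_pow_left₀ (abs_nonneg _) (hM x y) 2⟩ hij, ← hVdef]
    gcongr
    calc b i j * b q.1 q.2 ≤ |b i j| * |b q.1 q.2| := by
          rw [← abs_mul]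
          exact le_abs_self _
      _ ≤ β * β := mul_le_mul (hβ _ _) (hβ _ _) (abs_nonneg _) ((abs_nonneg _).trans (hβ i j))
      _ = β ^ 2 := (sq β).symm
  have hsum : ∀ y : Fin n → α, ∑ i, ∑ j, b i j * φ (y i) (y j)
      = ∑ p : Fin n × Fin n, b p.1 p.2 * φ (y p.1) (y p.2) := fun y =>
    (Fintype.sum_prod_type (fun p : Fin n × Fin n => b p.1 p.2 * φ (y p.1) (y p.2))).symm
  simp_rw [hsum, sq (∑ p : Fin n × Fin n, _), Finset.sum_mul_sum]
  rw [integral_finsetSum _ fun p _ => integrable_finsetSum _ fun q _ => hint p q]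
  -- Only `q = p` and `q = p.swap` survive, which is the origin of the factor `2`.
  have hp : ∀ p : Fin n × Fin n, ∫ y : Fin n → α, ∑ q : Fin n × Fin n,
      b p.1 p.2 * φ (y p.1) (y p.2) * (b q.1 q.2 * φ (y q.1) (y q.2))
      ∂(Measure.pi fun _ : Fin n => Q) ≤ 2 * (β ^ 2 * V) := by
    intro p
    rw [integral_finsetSum _ fun q _ => hint p q,
      ← Finset.sum_subset (Finset.subset_univ ({p, p.swap} : Finset (Fin n × Fin n)))]
    · calc _ ≤ ∑ q ∈ ({p, p.swap} : Finset (Fin n × Fin n)), β ^ 2 * V :=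
            Finset.sum_le_sum fun q hq => hdiag p q (by simpa using hq)
        _ ≤ _ := by
            rw [Finset.sum_const, nsmul_eq_mul]
            gcongr
            exact_mod_cast Finset.card_le_two
    · intro q _ hq
      simp only [Finset.mem_insert, Finset.mem_singleton, not_or] at hq
      exact hcross p q hq.1 hq.2
  calc _ ≤ ∑ p : Fin n × Fin n, 2 * (β ^ 2 * V) := Finset.sum_le_sum fun p _ => hp p
    _ = _ := by
        rw [Finset.sum_const, Finset.card_univ, Fintype.card_prod, Fintype.card_fin, nsmul_eq_mul]
        push_cast
        ring

end PiMeasure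

/-! ### Hoeffding decomposition of a weighted pairwise statistic under an arbitrary law. -/

section Hoeffding

variable {α : Type*} [MeasurableSpace α] {n : ℕ}

/-- A weighted sum of a kernel over the pairs of observations. -/
def pairStat (a : Fin n → Fin n → ℝ) (G : α → α → ℝ) (y : Fin n → α) : ℝ :=
  ∑ i, ∑ j, a i j * G (y i) (y j)

/-- A bounded measurable symmetric kernel. -/
structure PairKernel (G : α → α → ℝ) : Prop where
  measurable : Measurable (Function.uncurry G)
  bounded : ∃ M : ℝ, ∀ x y, |G x y| ≤ M
  symm : ∀ x y, G x y = G y x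

theorem sq_integral_le_integral_sq {Q : Measure α} [IsProbabilityMeasure Q] {f : α → ℝ}
    (hf : Measurable f) (hb : ∃ M : ℝ, ∀ x, |f x| ≤ M) : (∫ x, f x ∂Q) ^ 2 ≤ ∫ x, f x ^ 2 ∂Q := by
  obtain ⟨M, hM⟩ := hb
  have hm : MemLp f 2 Q := MemLp.of_bound hf.aestronglyMeasurable M (ae_of_all _ hM)
  have h1 := variance_nonneg f Q
  rw [variance_eq_sub hm] at h1
  simp only [Pi.pow_apply] at h1
  linarith

theorem integral_sub_mean_sq_le {Q : Measure α} [IsProbabilityMeasure Q] {f : α → ℝ}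
    (hf : Measurable f) (hb : ∃ M : ℝ, ∀ x, |f x| ≤ M) :
    ∫ x, (f x - ∫ z, f z ∂Q) ^ 2 ∂Q ≤ ∫ x, f x ^ 2 ∂Q := by
  obtain ⟨M, hM⟩ := hb
  have hm : MemLp f 2 Q := MemLp.of_bound hf.aestronglyMeasurable M (ae_of_all _ hM)
  have h1 := variance_le_expectation_sq (X := f) (μ := Q) hf.aestronglyMeasurable
  rw [variance_eq_integral hf.aemeasurable] at h1
  simpa using h1

namespace PairKernel

variable {G : α → α → ℝ} (hG : PairKernel G) (Q : Measure α) [IsProbabilityMeasure Q]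
include hG

theorem measurable_section (x : α) : Measurable (G x) :=
  hG.measurable.comp measurable_prodMk_left

theorem integrable_section (x : α) : Integrable (G x) Q :=
  integrable_of_bounded (hG.measurable_section x) (hG.bounded.imp fun _ hM => hM x)

theorem measurable_proj : Measurable fun x => ∫ y, G x y ∂Q :=
  (hG.measurable.stronglyMeasurable.integral_prod_right (ν := Q)).measurable

omit hG in
theorem abs_proj_le {M : ℝ} (hM : ∀ x y, |G x y| ≤ M) (x : α) : |∫ y, G x y ∂Q| ≤ M := by
  have := norm_integral_le_of_norm_le_const (μ := Q) (f := G x) (C := M) (ae_of_all _ (hM x))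
  simpa using this

theorem measurable_sq_proj : Measurable fun x => ∫ y, G x y ^ 2 ∂Q :=
  ((hG.measurable.pow_const 2).stronglyMeasurable.integral_prod_right (ν := Q)).measurable

theorem bounded_sq_proj : ∃ M : ℝ, ∀ x, |∫ y, G x y ^ 2 ∂Q| ≤ M := by
  obtain ⟨M, hM⟩ := hG.bounded
  refine ⟨M ^ 2, fun x => ?_⟩
  have := norm_integral_le_of_norm_le_const (μ := Q) (f := fun y => G x y ^ 2) (C := M ^ 2)
    (ae_of_all _ fun y => by
      rw [Real.norm_eq_abs, abs_pow]
      exact pow_le_pow_left₀ (abs_nonneg _) (hM x y) 2)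
  simpa using this

theorem sq_proj_le (x : α) : (∫ y, G x y ∂Q) ^ 2 ≤ ∫ y, G x y ^ 2 ∂Q :=
  sq_integral_le_integral_sq (hG.measurable_section x) (hG.bounded.imp fun _ hM => hM x)

theorem integral_sq_proj_le :
    ∫ x, (∫ y, G x y ∂Q) ^ 2 ∂Q ≤ ∫ x, ∫ y, G x y ^ 2 ∂Q ∂Q := by
  obtain ⟨M, hM⟩ := hG.bounded
  refine integral_mono (integrable_of_bounded ((hG.measurable_proj Q).pow_const 2) ⟨M ^ 2,
    fun x => ?_⟩) (integrable_of_bounded (hG.measurable_sq_proj Q) (hG.bounded_sq_proj Q))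
    (hG.sq_proj_le Q)
  rw [abs_pow]
  exact pow_le_pow_left₀ (abs_nonneg _) (PairKernel.abs_proj_le Q hM x) 2

/-- Second moment of the part of the kernel that is orthogonal to functions of one variable. -/
theorem integral_sq_degenerate_part_le :
    ∫ x, ∫ y, (G x y - (∫ z, G x z ∂Q) - (∫ z, G y z ∂Q) + ∫ w, ∫ z, G w z ∂Q ∂Q) ^ 2 ∂Q ∂Q
      ≤ 16 * ∫ x, ∫ y, G x y ^ 2 ∂Q ∂Q := by
  obtain ⟨M, hM⟩ := hG.bounded
  set g : α → ℝ := fun x => ∫ z, G x z ∂Q with hg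
  set θ := ∫ w, g w ∂Q with hθ
  set v : α → ℝ := fun x => ∫ y, G x y ^ 2 ∂Q with hv
  have hgm : Measurable g := hG.measurable_proj Q
  have hgM : ∀ x, |g x| ≤ M := PairKernel.abs_proj_le Q hM
  have hvm : Measurable v := hG.measurable_sq_proj Q
  have hvi : Integrable v Q := integrable_of_bounded hvm (hG.bounded_sq_proj Q)
  have hg2 : Integrable (fun x => g x ^ 2) Q := integrable_of_bounded (hgm.pow_const 2)
    ⟨M ^ 2, fun x => by
      rw [abs_pow]
      exact pow_le_pow_left₀ (abs_nonneg _) (hgM x) 2⟩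
  have hgv : ∫ x, g x ^ 2 ∂Q ≤ ∫ x, v x ∂Q := hG.integral_sq_proj_le Q
  have hθg : θ ^ 2 ≤ ∫ x, g x ^ 2 ∂Q := sq_integral_le_integral_sq hgm ⟨M, hgM⟩
  have hG2 : ∀ x, Integrable (fun y => G x y ^ 2) Q := fun x => integrable_of_bounded
    ((hG.measurable_section x).pow_const 2) ⟨M ^ 2, fun y => by
      rw [abs_pow]
      exact pow_le_pow_left₀ (abs_nonneg _) (hM x y) 2⟩
  -- The square of a sum of four terms costs a factor `4`. Each of the four squares integrates to at
  -- most `∫∫ G²` by Jensen's inequality, so the total constant is `16`.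
  have hinner : ∀ x, ∫ y, (G x y - g x - g y + θ) ^ 2 ∂Q
      ≤ 4 * (v x + g x ^ 2 + ∫ y, g y ^ 2 ∂Q + θ ^ 2) := by
    intro x
    have i1 : Integrable (fun y => G x y ^ 2 + g x ^ 2) Q := (hG2 x).add (integrable_const _)
    have i2 : Integrable (fun y => G x y ^ 2 + g x ^ 2 + g y ^ 2) Q := i1.add hg2
    have i3 : Integrable (fun y => G x y ^ 2 + g x ^ 2 + g y ^ 2 + θ ^ 2) Q :=
      i2.add (integrable_const _)
    calc _ ≤ ∫ y, 4 * (G x y ^ 2 + g x ^ 2 + g y ^ 2 + θ ^ 2) ∂Q := by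
          refine integral_mono_of_nonneg (ae_of_all _ fun y => sq_nonneg _)
            (i3.const_mul 4) (ae_of_all _ fun y => ?_)
          simp only
          nlinarith [sq_nonneg (G x y + g x), sq_nonneg (G x y + g y), sq_nonneg (G x y - θ),
            sq_nonneg (g x - g y), sq_nonneg (g x + θ), sq_nonneg (g y + θ)]
      _ = _ := by
          rw [integral_const_mul, integral_add i2 (integrable_const _), integral_add i1 hg2,
            integral_add (hG2 x) (integrable_const _)]
          simp [hv]
  have j1 : Integrable (fun x => v x + g x ^ 2) Q := hvi.add hg2
  have j2 : Integrable (fun x => v x + g x ^ 2 + ∫ y, g y ^ 2 ∂Q) Q := j1.add (integrable_const _)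
  have j3 : Integrable (fun x => v x + g x ^ 2 + ∫ y, g y ^ 2 ∂Q + θ ^ 2) Q :=
    j2.add (integrable_const _)
  calc _ ≤ ∫ x, 4 * (v x + g x ^ 2 + ∫ y, g y ^ 2 ∂Q + θ ^ 2) ∂Q := by
        refine integral_mono_of_nonneg (ae_of_all _ fun x => integral_nonneg fun y => sq_nonneg _)
          (j3.const_mul 4) (ae_of_all _ hinner)
    _ = 4 * (∫ x, v x ∂Q + ∫ x, g x ^ 2 ∂Q + ∫ y, g y ^ 2 ∂Q + θ ^ 2) := by
        rw [integral_const_mul, integral_add j2 (integrable_const _),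
          integral_add j1 (integrable_const _), integral_add hvi hg2]
        simp
    _ ≤ _ := by linarith

omit hG in
theorem integral_sq_add_three_le {β : Type*} [MeasurableSpace β] {π : Measure β}
    {u v w : β → ℝ} (hu : Integrable (fun y => u y ^ 2) π) (hv : Integrable (fun y => v y ^ 2) π)
    (hw : Integrable (fun y => w y ^ 2) π) :
    ∫ y, (u y + v y + w y) ^ 2 ∂π
      ≤ 3 * (∫ y, u y ^ 2 ∂π + ∫ y, v y ^ 2 ∂π + ∫ y, w y ^ 2 ∂π) := by
  have h1 : Integrable (fun y => u y ^ 2 + v y ^ 2) π := hu.add hv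
  rw [← integral_add hu hv, ← integral_add h1 hw, ← integral_const_mul]
  refine integral_mono_of_nonneg (ae_of_all _ fun y => sq_nonneg _)
    (((hu.add hv).add hw).const_mul 3) (ae_of_all _ fun y => ?_)
  simp only
  nlinarith [sq_nonneg (u y - v y), sq_nonneg (u y - w y), sq_nonneg (v y - w y)]

end PairKernel

theorem abs_sum_mul_le {ι : Type*} (s : Finset ι) (c f : ι → ℝ) {M : ℝ} (hM : ∀ i, |f i| ≤ M) :
    |∑ i ∈ s, c i * f i| ≤ ∑ i ∈ s, |c i| * M := by
  refine (Finset.abs_sum_le_sum_abs _ _).trans (Finset.sum_le_sum fun i _ => ?_)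
  rw [abs_mul]
  exact mul_le_mul_of_nonneg_left (hM i) (abs_nonneg _)

theorem measurable_pairStat {a : Fin n → Fin n → ℝ} {G : α → α → ℝ}
    (hG : Measurable (Function.uncurry G)) : Measurable (pairStat a G) :=
  Finset.measurable_sum _ fun i _ => Finset.measurable_sum _ fun j _ =>
    (measurable_uncurry_eval hG i j).const_mul _

/-- The error of the linear expansion of an off-diagonal pairwise statistic. -/
theorem integral_sq_expansion_error_le {G : α → α → ℝ} (hG : PairKernel G) (Q : Measure α)
    [IsProbabilityMeasure Q] {ψ : α → ℝ} (hψ : Measurable ψ) (hψb : ∃ M : ℝ, ∀ x, |ψ x| ≤ M)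
    (hn : 0 < n) {b : Fin n → Fin n → ℝ} {C : ℝ} (hbd : ∀ i, b i i = 0)
    (hb : ∀ i j, |b i j| ≤ C / n ^ 2)
    (hr : ∀ i, |∑ j, (b i j + b j i) - 2 / n| ≤ C / n ^ 2) :
    n * ∫ y, (pairStat b G y - (∑ i, ∑ j, b i j) * (∫ x, ∫ z, G x z ∂Q ∂Q)
        - 2 / n * ∑ i, (ψ (y i) - ∫ x, ψ x ∂Q)) ^ 2 ∂(Measure.pi fun _ : Fin n => Q)
      ≤ (99 * C ^ 2 + 12) * ((∫ x, ∫ y, G x y ^ 2 ∂Q ∂Q) / n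
        + ∫ x, ((∫ z, G x z ∂Q) - ψ x) ^ 2 ∂Q) := by
  obtain ⟨M, hM⟩ := hG.bounded
  obtain ⟨A, hA⟩ := hψb
  set π : Measure (Fin n → α) := Measure.pi fun _ : Fin n => Q with hπ
  set g : α → ℝ := fun x => ∫ z, G x z ∂Q with hg
  set θ := ∫ w, g w ∂Q with hθ
  set ψm := ∫ x, ψ x ∂Q with hψm
  set V := ∫ x, ∫ y, G x y ^ 2 ∂Q ∂Q with hV
  set D := ∫ x, (g x - ψ x) ^ 2 ∂Q with hD
  have hn0 : (0 : ℝ) < n := Nat.cast_pos.2 hn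
  have hV0 : 0 ≤ V := integral_nonneg fun x => integral_nonneg fun y => sq_nonneg _
  have hD0 : 0 ≤ D := integral_nonneg fun x => sq_nonneg _
  have hgm : Measurable g := hG.measurable_proj Q
  have hgM : ∀ x, |g x| ≤ M := PairKernel.abs_proj_le Q hM
  have hgi : Integrable g Q := integrable_of_bounded hgm ⟨M, hgM⟩
  have hψi : Integrable ψ Q := integrable_of_bounded hψ ⟨A, hA⟩
  set φ : α → α → ℝ := fun x y => G x y - g x - g y + θ with hφ
  set ρ : Fin n → ℝ := fun i => ∑ j, (b i j + b j i) with hρ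
  -- The error has three orthogonal-type sources: `u` is the degenerate part of the kernel, `v`
  -- comes from marginal weights that are not exactly `2 / n`, and `w` from replacing the projection
  -- `g` by the target `ψ`.
  set u : (Fin n → α) → ℝ := fun y => ∑ i, ∑ j, b i j * φ (y i) (y j) with hu
  set v : (Fin n → α) → ℝ := fun y => ∑ i, (ρ i - 2 / n) * (g (y i) - θ) with hv
  set w : (Fin n → α) → ℝ := fun y => ∑ i, 2 / n * ((g (y i) - ψ (y i)) - (θ - ψm)) with hw
  have hφm : Measurable (Function.uncurry φ) := by
    refine ((hG.measurable.sub ?_).sub ?_).add_const θ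
    · exact hgm.comp measurable_fst
    · exact hgm.comp measurable_snd
  have hθM : |θ| ≤ M := by
    have := norm_integral_le_of_norm_le_const (μ := Q) (f := g) (C := M) (ae_of_all _ hgM)
    simpa using this
  have hψmA : |ψm| ≤ A := by
    have := norm_integral_le_of_norm_le_const (μ := Q) (f := ψ) (C := A) (ae_of_all _ hA)
    simpa using this
  have hφM : ∀ x y, |φ x y| ≤ 4 * M := by
    intro x y
    have h1 := abs_le.1 (hM x y)
    have h2 := abs_le.1 (hgM x)
    have h3 := abs_le.1 (hgM y)
    have h4 := abs_le.1 hθM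
    rw [abs_le]
    simp only [hφ]
    constructor <;> linarith
  have hφs : ∀ x y, φ x y = φ y x := by
    intro x y
    simp only [hφ]
    rw [hG.symm x y]
    ring
  have hφ0 : ∀ x, ∫ y, φ x y ∂Q = 0 := by
    intro x
    simp only [hφ]
    have i1 : Integrable (fun y => G x y - g x) Q :=
      (hG.integrable_section Q x).sub (integrable_const _)
    have i2 : Integrable (fun y => G x y - g x - g y) Q := i1.sub hgi
    rw [integral_add i2 (integrable_const _), integral_sub i1 hgi,
      integral_sub (hG.integrable_section Q x) (integrable_const _)]
    simp [hg, hθ]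
  have hvM : ∀ x, |g x - θ| ≤ 2 * M := fun x => (abs_sub _ _).trans (by linarith [hgM x])
  have hwM : ∀ x, |(g x - ψ x) - (θ - ψm)| ≤ 2 * M + 2 * A := by
    intro x
    have h2 := abs_le.1 (hgM x)
    have h3 := abs_le.1 (hA x)
    have h4 := abs_le.1 hθM
    have h5 := abs_le.1 hψmA
    rw [abs_le]
    constructor <;> linarith
  have hint : ∀ {f : (Fin n → α) → ℝ}, Measurable f → (∃ R : ℝ, ∀ y, |f y| ≤ R) →
      Integrable (fun y => f y ^ 2) π := by
    rintro f hf ⟨R, hR⟩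
    refine integrable_of_bounded (hf.pow_const 2) ⟨R ^ 2, fun y => ?_⟩
    rw [abs_pow]
    exact pow_le_pow_left₀ (abs_nonneg _) (hR y) 2
  have hui : Integrable (fun y => u y ^ 2) π := by
    refine hint (measurable_pairStat hφm) ⟨∑ i, ∑ j, |b i j| * (4 * M), fun y => ?_⟩
    exact (Finset.abs_sum_le_sum_abs _ _).trans (Finset.sum_le_sum fun i _ =>
      abs_sum_mul_le _ _ _ fun j => hφM _ _)
  have hvi : Integrable (fun y => v y ^ 2) π :=
    hint (by fun_prop) ⟨_, fun y => abs_sum_mul_le _ _ _ fun i => hvM (y i)⟩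
  have hwi : Integrable (fun y => w y ^ 2) π :=
    hint (by fun_prop) ⟨_, fun y => abs_sum_mul_le _ _ _ fun i => hwM (y i)⟩
  have hu2 : ∫ y, u y ^ 2 ∂π ≤ 2 * n ^ 2 * (C / n ^ 2) ^ 2 * (16 * V) := by
    refine (integral_sq_degenerate_le hφm ⟨_, hφM⟩ hφs hφ0 hbd hb).trans ?_
    gcongr
    exact hG.integral_sq_degenerate_part_le Q
  have hv2 : ∫ y, v y ^ 2 ∂π ≤ n * (C / n ^ 2) ^ 2 * V := by
    refine (integral_sq_sum_eval_le (ψ := fun x => g x - θ) (hgm.sub_const _) ⟨_, hvM⟩ ?_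
      hr).trans ?_
    · rw [integral_sub hgi (integrable_const _)]
      simp [hθ]
    · gcongr
      exact (integral_sub_mean_sq_le hgm ⟨M, hgM⟩).trans (hG.integral_sq_proj_le Q)
  have hw2 : ∫ y, w y ^ 2 ∂π ≤ n * (2 / n) ^ 2 * D := by
    refine (integral_sq_sum_eval_le (ψ := fun x => (g x - ψ x) - (θ - ψm)) (by fun_prop)
      ⟨_, hwM⟩ ?_ (c := fun _ => 2 / n) (β := 2 / n) fun i => ?_).trans ?_
    · have i1 : Integrable (fun x => g x - ψ x) Q := hgi.sub hψi
      rw [integral_sub i1 (integrable_const _), integral_sub hgi hψi]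
      simp [hθ, hψm]
    · rw [abs_of_pos (by positivity)]
    · gcongr
      have := integral_sub_mean_sq_le (Q := Q) (f := fun x => g x - ψ x) (hgm.sub hψ)
        ⟨M + A, fun x => (abs_sub _ _).trans (add_le_add (hgM x) (hA x))⟩
      rwa [integral_sub hgi hψi] at this
  have hdec : ∀ y, pairStat b G y - (∑ i, ∑ j, b i j) * θ - 2 / n * ∑ i, (ψ (y i) - ψm)
      = u y + v y + w y := by
    intro y
    have e1 : ∑ i, ρ i * (g (y i) - θ)
        = ∑ i, ∑ j, b i j * (g (y i) - θ) + ∑ i, ∑ j, b i j * (g (y j) - θ) := by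
      rw [Finset.sum_comm (f := fun i j => b i j * (g (y j) - θ)), ← Finset.sum_add_distrib]
      refine Finset.sum_congr rfl fun i _ => ?_
      simp only [hρ]
      rw [Finset.sum_mul, ← Finset.sum_add_distrib]
      exact Finset.sum_congr rfl fun j _ => by ring
    have e2 : u y = pairStat b G y - ∑ i, ρ i * (g (y i) - θ) - (∑ i, ∑ j, b i j) * θ := by
      rw [e1, Finset.sum_mul]
      simp only [hu, pairStat, hφ]
      simp_rw [Finset.sum_mul, ← Finset.sum_add_distrib, ← Finset.sum_sub_distrib]
      exact Finset.sum_congr rfl fun i _ => Finset.sum_congr rfl fun j _ => by ring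
    rw [e2]
    simp only [hv, hw, Finset.mul_sum]
    have e3 : ∑ i, 2 / (n : ℝ) * (ψ (y i) - ψm) = ∑ i, ρ i * (g (y i) - θ)
        - ∑ i, (ρ i - 2 / n) * (g (y i) - θ)
        - ∑ i, 2 / (n : ℝ) * ((g (y i) - ψ (y i)) - (θ - ψm)) := by
      simp_rw [← Finset.sum_sub_distrib]
      exact Finset.sum_congr rfl fun i _ => by ring
    rw [e3]
    ring
  simp_rw [hdec]
  have h3 := PairKernel.integral_sq_add_three_le hui hvi hwi
  have hn1 : (1 : ℝ) ≤ n := by exact_mod_cast hn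
  -- The square of three terms costs `3`. Hence `3 · 2 · 16 = 96` from `u`, `3` from `v`, and `3 ·
  -- 2² = 12` from `w`.
  calc (n : ℝ) * ∫ y, (u y + v y + w y) ^ 2 ∂π
      ≤ n * (3 * (2 * n ^ 2 * (C / n ^ 2) ^ 2 * (16 * V) + n * (C / n ^ 2) ^ 2 * V
        + n * (2 / n) ^ 2 * D)) := by
        gcongr
        linarith
    _ = 96 * C ^ 2 * (V / n) + 3 * C ^ 2 * (V / n) / n + 12 * D := by
        field_simp
        ring
    _ ≤ 96 * C ^ 2 * (V / n) + 3 * C ^ 2 * (V / n) + 12 * D := by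
        gcongr
        exact div_le_self (by positivity) hn1
    _ ≤ _ := by
        have : 0 ≤ V / n := by positivity
        nlinarith [mul_nonneg (sq_nonneg C) hD0]

end Hoeffding

/-! ### Expectations of the error bounds when the law is the empirical one. -/

section Empirical

variable {α : Type*} [MeasurableSpace α] {n : ℕ}

theorem abs_sq_le_of_abs_le {x M : ℝ} (h : |x| ≤ M) : |x ^ 2| ≤ M ^ 2 := by
  rw [abs_pow]
  exact pow_le_pow_left₀ (abs_nonneg _) h 2

/-- Expected second moment of the kernel under the empirical law. -/
theorem integral_empirical_sq_le {G : α → α → ℝ} (hG : PairKernel G) (Q : Measure α)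
    [IsProbabilityMeasure Q] {G₀ : ℝ} (hG₀ : ∀ x, |G x x| ≤ G₀) (hn : 0 < n) :
    ∫ x, (n : ℝ)⁻¹ * ∑ i, (n : ℝ)⁻¹ * ∑ j, G (x i) (x j) ^ 2 ∂(Measure.pi fun _ : Fin n => Q)
      ≤ G₀ ^ 2 / n + ∫ x, ∫ y, G x y ^ 2 ∂Q ∂Q := by
  classical
  obtain ⟨M, hM⟩ := hG.bounded
  set V := ∫ x, ∫ y, G x y ^ 2 ∂Q ∂Q with hV
  have hn0 : (0 : ℝ) < n := Nat.cast_pos.2 hn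
  have hV0 : 0 ≤ V := integral_nonneg fun x => integral_nonneg fun y => sq_nonneg _
  have hint : ∀ i j : Fin n, Integrable (fun x : Fin n → α => G (x i) (x j) ^ 2)
      (Measure.pi fun _ : Fin n => Q) := fun i j =>
    integrable_of_bounded ((measurable_uncurry_eval hG.measurable i j).pow_const 2)
      ⟨M ^ 2, fun x => abs_sq_le_of_abs_le (hM _ _)⟩
  have hterm : ∀ i j : Fin n, ∫ x, G (x i) (x j) ^ 2 ∂(Measure.pi fun _ : Fin n => Q)
      ≤ (if j = i then G₀ ^ 2 else 0) + V := by
    intro i j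
    split_ifs with hij
    · subst hij
      refine (integral_mono (hint j j) (integrable_const (G₀ ^ 2)) fun x => ?_).trans ?_
      · exact (le_abs_self _).trans (abs_sq_le_of_abs_le (hG₀ _))
      · simpa using hV0
    · rw [zero_add, integral_pi_eval_pair (φ := fun x y => G x y ^ 2) (hG.measurable.pow_const 2)
        ⟨M ^ 2, fun x y => abs_sq_le_of_abs_le (hM _ _)⟩ (Ne.symm hij)]
  rw [integral_const_mul, integral_finsetSum _ fun i _ =>
    (integrable_finsetSum _ fun j _ => hint i j).const_mul _]
  simp_rw [integral_const_mul]
  calc _ ≤ (n : ℝ)⁻¹ * ∑ i : Fin n, (n : ℝ)⁻¹ *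
        ∑ j : Fin n, ((if j = i then G₀ ^ 2 else 0) + V) := by
        gcongr with i _
        rw [integral_finsetSum _ fun j _ => hint i j]
        exact Finset.sum_le_sum fun j _ => hterm i j
    _ = _ := by
        simp_rw [Finset.sum_add_distrib, Finset.sum_ite_eq' Finset.univ]
        simp
        field_simp

/-- Expected mean square error of the kernel smooth under the empirical law. -/
theorem integral_empirical_error_le {G : α → α → ℝ} (hG : PairKernel G) (Q : Measure α)
    [IsProbabilityMeasure Q] {G₀ : ℝ} (hG₀ : ∀ x, |G x x| ≤ G₀) (hn : 0 < n)
    {ψ : α → ℝ} (hψ : Measurable ψ) (hψb : ∃ M : ℝ, ∀ x, |ψ x| ≤ M) :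
    ∫ x, (n : ℝ)⁻¹ * ∑ i, ((n : ℝ)⁻¹ * ∑ j, G (x i) (x j) - ψ (x i)) ^ 2
        ∂(Measure.pi fun _ : Fin n => Q)
      ≤ 4 * ((G₀ / n) ^ 2 + 5 * ((∫ x, ∫ y, G x y ^ 2 ∂Q ∂Q) / n)
        + ∫ x, ((∫ z, G x z ∂Q) - ψ x) ^ 2 ∂Q) := by
  classical
  obtain ⟨M, hM⟩ := hG.bounded
  obtain ⟨A, hA⟩ := hψb
  set π : Measure (Fin n → α) := Measure.pi fun _ : Fin n => Q with hπ
  set g : α → ℝ := fun x => ∫ z, G x z ∂Q with hg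
  set V := ∫ x, ∫ y, G x y ^ 2 ∂Q ∂Q with hV
  set D := ∫ x, (g x - ψ x) ^ 2 ∂Q with hD
  have hn0 : (0 : ℝ) < n := Nat.cast_pos.2 hn
  have hn1 : (1 : ℝ) ≤ n := by exact_mod_cast hn
  have hV0 : 0 ≤ V := integral_nonneg fun x => integral_nonneg fun y => sq_nonneg _
  have hD0 : 0 ≤ D := integral_nonneg fun x => sq_nonneg _
  have hgm : Measurable g := hG.measurable_proj Q
  have hgM : ∀ x, |g x| ≤ M := PairKernel.abs_proj_le Q hM
  have hg2 : Integrable (fun x => g x ^ 2) Q :=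
    integrable_of_bounded (hgm.pow_const 2) ⟨M ^ 2, fun x => abs_sq_le_of_abs_le (hgM x)⟩
  have hm : ∀ i j : Fin n, Measurable fun x : Fin n → α => G (x i) (x j) :=
    measurable_uncurry_eval hG.measurable
  set φ : α → α → ℝ := fun x y => G x y - g x with hφ
  have hφm : Measurable (Function.uncurry φ) :=
    hG.measurable.sub (hgm.comp measurable_fst)
  have hφM : ∀ x y, |φ x y| ≤ 2 * M := fun x y =>
    (abs_sub _ _).trans (by linarith [hM x y, hgM x])
  have hφ2 : ∫ x, ∫ y, φ x y ^ 2 ∂Q ∂Q ≤ V := by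
    refine integral_mono_of_nonneg (ae_of_all _ fun x => integral_nonneg fun y => sq_nonneg _)
      (integrable_of_bounded (hG.measurable_sq_proj Q) (hG.bounded_sq_proj Q))
      (ae_of_all _ fun x => ?_)
    exact integral_sub_mean_sq_le (hG.measurable_section x) ⟨M, hM x⟩
  have hφint : ∀ i j k : Fin n, Integrable
      (fun x : Fin n → α => φ (x i) (x j) * φ (x i) (x k)) π := by
    intro i j k
    refine integrable_of_bounded ((measurable_uncurry_eval hφm i j).mul
      (measurable_uncurry_eval hφm i k)) ⟨2 * M * (2 * M), fun x => ?_⟩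
    rw [abs_mul]
    exact mul_le_mul (hφM _ _) (hφM _ _) (abs_nonneg _) ((abs_nonneg _).trans (hφM (x i) (x i)))
  -- the centered part of the smooth at the `i`-th observation
  set R : Fin n → (Fin n → α) → ℝ := fun i x => ∑ j ∈ Finset.univ.erase i, φ (x i) (x j) with hR
  have hR2 : ∀ i, ∫ x, R i x ^ 2 ∂π ≤ n * V := by
    intro i
    simp only [hR, sq, Finset.sum_mul_sum]
    rw [integral_finsetSum _ fun j _ => integrable_finsetSum _ fun k _ => hφint i j k]
    calc _ ≤ ∑ j ∈ Finset.univ.erase i, V := by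
          refine Finset.sum_le_sum fun j hj => ?_
          have hji := Finset.ne_of_mem_erase hj
          rw [integral_finsetSum _ fun k _ => hφint i j k, Finset.sum_eq_single_of_mem j hj]
          · simp_rw [← sq]
            rw [integral_pi_eval_pair (φ := fun x y => φ x y ^ 2) (hφm.pow_const 2)
              ⟨_, fun x y => abs_sq_le_of_abs_le (hφM x y)⟩ hji.symm]
            exact hφ2
          · intro k hk hkj
            have hki := Finset.ne_of_mem_erase hk
            refine integral_pi_eq_zero k fun x => ?_
            simp only [Function.update_self, Function.update_of_ne hkj.symm,
              Function.update_of_ne hki.symm]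
            rw [integral_const_mul]
            simp only [hφ]
            rw [integral_sub (hG.integrable_section Q _) (integrable_const _)]
            simp [hg]
      _ ≤ n * V := by
          rw [Finset.sum_const, nsmul_eq_mul]
          gcongr
          exact (Finset.card_erase_le).trans (by simp)
  have hRm : ∀ i, Measurable (R i) := fun i =>
    Finset.measurable_sum _ fun j _ => measurable_uncurry_eval hφm i j
  have hRM : ∀ i x, |R i x| ≤ ∑ j ∈ Finset.univ.erase i, (2 * M) := fun i x =>
    (Finset.abs_sum_le_sum_abs _ _).trans (Finset.sum_le_sum fun j _ => hφM _ _)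
  have hRi : ∀ i, Integrable (fun x => R i x ^ 2) π := fun i =>
    integrable_of_bounded ((hRm i).pow_const 2) ⟨_, fun x => abs_sq_le_of_abs_le (hRM i x)⟩
  -- The four pieces are the diagonal term, the centred off-diagonal sum, the population smoothing
  -- error, and the correction `g / n` caused by having only `n - 1` off-diagonal terms.
  have hsq : ∀ i (x : Fin n → α), ((n : ℝ)⁻¹ * ∑ j, G (x i) (x j) - ψ (x i)) ^ 2
      ≤ 4 * ((G₀ / n) ^ 2 + (n : ℝ)⁻¹ ^ 2 * R i x ^ 2 + (g (x i) - ψ (x i)) ^ 2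
        + (n : ℝ)⁻¹ ^ 2 * g (x i) ^ 2) := by
    intro i x
    have e : (n : ℝ)⁻¹ * ∑ j, G (x i) (x j) - ψ (x i) = (n : ℝ)⁻¹ * G (x i) (x i)
        + (n : ℝ)⁻¹ * R i x + (g (x i) - ψ (x i)) - (n : ℝ)⁻¹ * g (x i) := by
      rw [← Finset.add_sum_erase _ _ (Finset.mem_univ i)]
      simp only [hR, hφ, Finset.sum_sub_distrib, Finset.sum_const, nsmul_eq_mul,
        Finset.card_erase_of_mem (Finset.mem_univ i), Finset.card_univ, Fintype.card_fin]
      rw [Nat.cast_sub hn]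
      field_simp
      push_cast
      ring
    have hG2 : ((n : ℝ)⁻¹ * G (x i) (x i)) ^ 2 ≤ (G₀ / n) ^ 2 := by
      rw [mul_pow, div_pow, div_eq_mul_inv, mul_comm, inv_pow]
      exact mul_le_mul_of_nonneg_right ((le_abs_self _).trans (abs_sq_le_of_abs_le (hG₀ _)))
        (by positivity)
    rw [e, ← mul_pow, ← mul_pow]
    set a := (n : ℝ)⁻¹ * G (x i) (x i)
    set b := (n : ℝ)⁻¹ * R i x
    set c := g (x i) - ψ (x i)
    set w := (n : ℝ)⁻¹ * g (x i)
    nlinarith [sq_nonneg (a - b), sq_nonneg (a - c), sq_nonneg (a + w), sq_nonneg (b - c),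
      sq_nonneg (b + w), sq_nonneg (c + w)]
  have hgψ : ∀ i, Integrable (fun x : Fin n → α => (g (x i) - ψ (x i)) ^ 2) π := fun i =>
    integrable_of_bounded (by fun_prop) ⟨(M + A) ^ 2, fun x => abs_sq_le_of_abs_le
      ((abs_sub _ _).trans (add_le_add (hgM _) (hA _)))⟩
  have hgi : ∀ i, Integrable (fun x : Fin n → α => g (x i) ^ 2) π := fun i =>
    integrable_of_bounded (by fun_prop) ⟨M ^ 2, fun x => abs_sq_le_of_abs_le (hgM _)⟩
  have hi : ∀ i, ∫ x, ((n : ℝ)⁻¹ * ∑ j, G (x i) (x j) - ψ (x i)) ^ 2 ∂π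
      ≤ 4 * ((G₀ / n) ^ 2 + 5 * (V / n) + D) := by
    intro i
    have i1 : Integrable (fun x => (G₀ / n) ^ 2 + (n : ℝ)⁻¹ ^ 2 * R i x ^ 2) π :=
      (integrable_const _).add ((hRi i).const_mul _)
    have i2 : Integrable (fun x => (G₀ / n) ^ 2 + (n : ℝ)⁻¹ ^ 2 * R i x ^ 2
      + (g (x i) - ψ (x i)) ^ 2) π := i1.add (hgψ i)
    have i3 : Integrable (fun x => (G₀ / n) ^ 2 + (n : ℝ)⁻¹ ^ 2 * R i x ^ 2
      + (g (x i) - ψ (x i)) ^ 2 + (n : ℝ)⁻¹ ^ 2 * g (x i) ^ 2) π :=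
      i2.add ((hgi i).const_mul _)
    calc _ ≤ ∫ x, 4 * ((G₀ / n) ^ 2 + (n : ℝ)⁻¹ ^ 2 * R i x ^ 2 + (g (x i) - ψ (x i)) ^ 2
        + (n : ℝ)⁻¹ ^ 2 * g (x i) ^ 2) ∂π :=
          integral_mono_of_nonneg (ae_of_all _ fun x => sq_nonneg _) (i3.const_mul 4)
            (ae_of_all _ (hsq i))
      _ = 4 * ((G₀ / n) ^ 2 + (n : ℝ)⁻¹ ^ 2 * ∫ x, R i x ^ 2 ∂π + D
          + (n : ℝ)⁻¹ ^ 2 * ∫ x, g x ^ 2 ∂Q) := by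
          rw [integral_const_mul, integral_add i2 ((hgi i).const_mul _), integral_add i1 (hgψ i),
            integral_add (integrable_const _) ((hRi i).const_mul _), integral_const_mul,
            integral_const_mul, integral_pi_eval (φ := fun x => (g x - ψ x) ^ 2) (by fun_prop),
            integral_pi_eval (φ := fun x => g x ^ 2) (by fun_prop)]
          simp [hD]
      _ ≤ 4 * ((G₀ / n) ^ 2 + (n : ℝ)⁻¹ ^ 2 * (n * V) + D + (n : ℝ)⁻¹ ^ 2 * V) := by
          have := hR2 i
          have : ∫ x, g x ^ 2 ∂Q ≤ V := hG.integral_sq_proj_le Q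
          gcongr
      _ = 4 * ((G₀ / n) ^ 2 + V / n + D + V / n * (n : ℝ)⁻¹) := by
          field_simp
      _ ≤ _ := by
          have h1 : V / n * (n : ℝ)⁻¹ ≤ V / n :=
            mul_le_of_le_one_right (by positivity) (inv_le_one_of_one_le₀ hn1)
          have h2 : 0 ≤ V / n := by positivity
          linarith
  have hint : ∀ i, Integrable (fun x : Fin n → α =>
      ((n : ℝ)⁻¹ * ∑ j, G (x i) (x j) - ψ (x i)) ^ 2) π := by
    intro i
    refine integrable_of_bounded ((((Finset.measurable_sum _ fun j _ => hm i j).const_mul _).sub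
      (hψ.comp (measurable_pi_apply i))).pow_const 2)
      ⟨((n : ℝ)⁻¹ * ∑ _j : Fin n, M + A) ^ 2, fun x => abs_sq_le_of_abs_le ?_⟩
    refine (abs_sub _ _).trans (add_le_add ?_ (hA _))
    rw [abs_mul, abs_of_pos (inv_pos.2 hn0)]
    gcongr
    exact (Finset.abs_sum_le_sum_abs _ _).trans (Finset.sum_le_sum fun j _ => hM _ _)
  rw [integral_const_mul, integral_finsetSum _ fun i _ => hint i]
  calc _ ≤ (n : ℝ)⁻¹ * ∑ i : Fin n, 4 * ((G₀ / n) ^ 2 + 5 * (V / n) + D) := by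
        gcongr with i _
        exact hi i
    _ = _ := by
        rw [Finset.sum_const, Finset.card_univ, Fintype.card_fin, nsmul_eq_mul, ← mul_assoc,
          inv_mul_cancel₀ hn0.ne', one_mul]

end Empirical

/-! ### Integration against the empirical law. -/

section EmpiricalLaw

variable {d n : ℕ}

theorem isProbabilityMeasure_empiricalLaw (hn : 0 < n) (x : Fin n → E d) :
    IsProbabilityMeasure (empiricalLaw x) := by
  refine ⟨?_⟩
  rw [empiricalLaw, Measure.smul_apply, Measure.finsetSum_apply]
  simp only [measure_univ, Finset.sum_const, Finset.card_univ, Fintype.card_fin, smul_eq_mul,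
    nsmul_eq_mul, mul_one]
  exact ENNReal.inv_mul_cancel (by exact_mod_cast hn.ne') (ENNReal.natCast_ne_top n)

theorem integral_empiricalLaw (x : Fin n → E d) (f : E d → ℝ) :
    ∫ z, f z ∂(empiricalLaw x) = (n : ℝ)⁻¹ * ∑ i, f (x i) := by
  rw [empiricalLaw, integral_smul_measure, integral_finsetSum_measure]
  · simp [integral_dirac]
  · exact fun i _ => integrable_dirac (by simp)

end EmpiricalLaw

/-! ### Uniform convergence of distribution functions to a normal one. -/

section Polya

/-- The normal density is bounded by `(2 π v)^{-1/2}`, which is therefore a Lipschitz constant of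
the distribution function. -/
theorem gaussianReal_Iic_add_le {v : ℝ≥0} (hv : v ≠ 0) (t : ℝ) {η : ℝ} (hη : 0 ≤ η) :
    (gaussianReal 0 v).real (Set.Iic (t + η))
      ≤ (gaussianReal 0 v).real (Set.Iic t) + (√(2 * Real.pi * v))⁻¹ * η := by
  have hsub : Set.Iic (t + η) ⊆ Set.Iic t ∪ Set.Ioc t (t + η) := fun x hx => by
    rcases le_or_gt x t with h | h
    · exact Or.inl h
    · exact Or.inr ⟨h, hx⟩
  refine (measureReal_mono hsub).trans ((measureReal_union_le _ _).trans ?_)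
  gcongr
  refine ENNReal.toReal_le_of_le_ofReal (by positivity) ?_
  rw [gaussianReal_of_var_ne_zero 0 hv, withDensity_apply _ measurableSet_Ioc]
  calc ∫⁻ x in Set.Ioc t (t + η), gaussianPDF 0 v x
      ≤ ∫⁻ _ in Set.Ioc t (t + η), ENNReal.ofReal ((√(2 * Real.pi * v))⁻¹) := by
        refine lintegral_mono fun x => ENNReal.ofReal_le_ofReal ?_
        rw [gaussianPDFReal_def]
        refine mul_le_of_le_one_right (by positivity) ?_
        refine Real.exp_le_one_iff.2 ?_
        rw [neg_div]
        have : 0 ≤ (x - 0) ^ 2 / (2 * v) := by positivity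
        linarith
    _ = _ := by
        rw [setLIntegral_const, Real.volume_Ioc, add_sub_cancel_left,
          ENNReal.ofReal_mul (by positivity)]

theorem continuous_gaussianReal_Iic {v : ℝ≥0} (hv : v ≠ 0) :
    Continuous fun t => (gaussianReal 0 v).real (Set.Iic t) := by
  have hL : LipschitzWith (Real.toNNReal ((√(2 * Real.pi * v))⁻¹))
      fun t => (gaussianReal 0 v).real (Set.Iic t) := by
    refine LipschitzWith.of_le_add_mul' _ fun x y => ?_
    rw [Real.dist_eq]
    rcases le_total x y with h | h
    · refine (measureReal_mono (Set.Iic_subset_Iic.2 h)).trans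
        (le_add_of_nonneg_right (by positivity))
    · have := gaussianReal_Iic_add_le hv y (sub_nonneg.2 h)
      rwa [add_sub_cancel, ← abs_of_nonneg (sub_nonneg.2 h)] at this
  exact hL.continuous

/-- **Pólya's theorem** for a sequence of laws converging weakly to a normal law. -/
theorem eventually_forall_abs_cdf_sub_le {v : ℝ≥0} (hv : v ≠ 0) {ν : ℕ → ProbabilityMeasure ℝ}
    (hν : Tendsto ν atTop (𝓝 ⟨gaussianReal 0 v, inferInstance⟩)) {ε : ℝ} (hε : 0 < ε) :
    ∀ᶠ k in atTop, ∀ t, |(ν k : Measure ℝ).real (Set.Iic t)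
      - (gaussianReal 0 v).real (Set.Iic t)| ≤ ε := by
  set F : ℝ → ℝ := fun t => (gaussianReal 0 v).real (Set.Iic t) with hF
  have hFc : Continuous F := continuous_gaussianReal_Iic hv
  have hFm : Monotone F := fun x y h => measureReal_mono (Set.Iic_subset_Iic.2 h)
  have hF0 : Tendsto F atBot (𝓝 0) := by
    refine (tendsto_cdf_atBot (gaussianReal 0 v)).congr fun t => cdf_eq_real _ t
  have hF1 : Tendsto F atTop (𝓝 1) := by
    refine (tendsto_cdf_atTop (gaussianReal 0 v)).congr fun t => cdf_eq_real _ t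
  have hF0' : ∀ t, 0 ≤ F t := fun t => measureReal_nonneg
  have hF1' : ∀ t, F t ≤ 1 := fun t => measureReal_le_one
  have hpt : ∀ t, Tendsto (fun k => (ν k : Measure ℝ).real (Set.Iic t)) atTop (𝓝 (F t)) := by
    intro t
    have h0 : (gaussianReal 0 v) (frontier (Set.Iic t)) = 0 := by
      have : NullSingletonClass (gaussianReal 0 v) := nullSingletonClass_gaussianReal hv
      rw [frontier_Iic]
      exact measure_singleton t
    have := ProbabilityMeasure.tendsto_measure_of_null_frontier_of_tendsto' hν h0
    exact (ENNReal.tendsto_toReal (measure_ne_top _ _)).comp this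
  -- The quantiles of the levels `j / N` form a finite grid. Once the distribution functions agree
  -- there up to `1 / N`, monotonicity gives agreement up to `2 / N` everywhere.
  obtain ⟨N, hN⟩ := exists_nat_gt (2 / ε)
  have hN0 : (0 : ℝ) < N := lt_trans (by positivity) hN
  have hNε : 2 / (N : ℝ) ≤ ε := by
    rw [div_le_iff₀ hN0]
    rw [div_lt_iff₀ hε] at hN
    linarith
  have hq : ∀ j : ℕ, 0 < j → j < N → ∃ q, F q = j / N := by
    intro j hj hjN
    have hj0 : (0 : ℝ) < j / N := div_pos (Nat.cast_pos.2 hj) hN0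
    have hj1 : (j : ℝ) / N < 1 := (div_lt_one hN0).2 (by exact_mod_cast hjN)
    obtain ⟨a, ha⟩ := (hF0.eventually (gt_mem_nhds hj0)).exists
    obtain ⟨b, hb⟩ := (hF1.eventually (lt_mem_nhds hj1)).exists
    exact mem_range_of_exists_le_of_exists_ge hFc ⟨a, ha.le⟩ ⟨b, hb.le⟩
  choose! q hq using hq
  have hev : ∀ᶠ k in atTop, ∀ j ∈ Finset.range N, 0 < j →
      |(ν k : Measure ℝ).real (Set.Iic (q j)) - j / N| < 1 / N := by
    rw [Finset.eventually_all]
    intro j hj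
    by_cases hj0 : 0 < j
    · have := hpt (q j)
      rw [hq j hj0 (Finset.mem_range.1 hj)] at this
      filter_upwards [Metric.tendsto_nhds.1 this (1 / N) (by positivity)] with k hk _
      exact hk
    · exact Eventually.of_forall fun k hk => absurd hk hj0
  filter_upwards [hev] with k hk t
  set Fk := fun t => (ν k : Measure ℝ).real (Set.Iic t) with hFk
  have hFkm : Monotone Fk := fun x y h => measureReal_mono (Set.Iic_subset_Iic.2 h)
  have hN2 : (2 : ℝ) / N = 1 / N + 1 / N := by ring
  have hcast : ∀ j : ℕ, ((j + 1 : ℕ) : ℝ) / N = j / N + 1 / N := fun j => by push_cast; ring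
  refine (abs_le.2 ⟨?_, ?_⟩).trans hNε
  · -- lower bound
    rcases le_or_gt (F t) (2 / N) with h | h
    · have : 0 ≤ Fk t := measureReal_nonneg
      linarith
    -- The grid level just below `F t`, so that `i / N < F t ≤ (i + 1) / N`. Since `N * F t > 2`,
    -- the index is positive and its quantile is available.
    · set i := ⌈N * F t⌉₊ - 1 with hi
      have hNF : 2 < N * F t := by rwa [div_lt_iff₀ hN0, mul_comm] at h
      have hc1 : 2 < ⌈N * F t⌉₊ := Nat.lt_ceil.2 (by exact_mod_cast hNF)
      have hi1 : i + 1 = ⌈N * F t⌉₊ := by omega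
      have hiN : i < N := by
        have : ⌈N * F t⌉₊ ≤ N := Nat.ceil_le.2 (mul_le_of_le_one_right hN0.le (hF1' t))
        omega
      have hilt : (i : ℝ) < N * F t := Nat.lt_ceil.1 (by omega)
      have hile : N * F t ≤ i + 1 := by
        have := Nat.le_ceil (N * F t)
        rw [← hi1] at this
        exact_mod_cast this
      have hFq := hq i (by omega) hiN
      have hqt : q i ≤ t := by
        by_contra! hcon
        have h1 := hFm hcon.le
        rw [hFq, le_div_iff₀ hN0] at h1
        linarith
      have h2 := (abs_lt.1 (hk i (Finset.mem_range.2 hiN) (by omega))).1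
      have h3 : Fk (q i) ≤ Fk t := hFkm hqt
      have h4 : F t ≤ i / N + 1 / N := by
        rw [← add_div, le_div_iff₀ hN0]
        linarith
      rw [hN2]
      linarith
  · -- upper bound
    set j := ⌊N * F t⌋₊ with hj
    have hj1 : N * F t < j + 1 := Nat.lt_floor_add_one _
    have hj2 : (j : ℝ) ≤ N * F t := Nat.floor_le (mul_nonneg hN0.le (hF0' t))
    have hj3 : (j : ℝ) / N ≤ F t := by
      rw [div_le_iff₀ hN0]
      linarith
    rcases lt_or_ge (j + 1) N with h | h
    · have hFq := hq (j + 1) (by omega) h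
      have hqt : t ≤ q (j + 1) := by
        by_contra! hcon
        have h1 := hFm hcon.le
        rw [hFq, div_le_iff₀ hN0] at h1
        push_cast at h1
        linarith
      have h2 := (abs_lt.1 (hk (j + 1) (Finset.mem_range.2 h) (by omega))).2
      have h3 : Fk t ≤ Fk (q (j + 1)) := hFkm hqt
      rw [hcast] at h2
      rw [hN2]
      linarith
    · have h1 : (N : ℝ) ≤ j + 1 := by exact_mod_cast h
      have h2 : Fk t ≤ 1 := measureReal_le_one
      have h3 : 1 - 1 / N ≤ F t := by
        have : (N : ℝ) / N ≤ (j + 1) / N := by gcongr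
        rw [div_self hN0.ne', add_div] at this
        linarith
      have h4 : 0 < 1 / (N : ℝ) := by positivity
      rw [hN2]
      linarith

end Polya

/-! ### A central limit theorem uniform in the sampling law. -/

section CentralLimit

/-- Telescoping in the unit disc. It reduces the comparison of characteristic functions of sums to
that of single summands. -/
theorem norm_pow_sub_pow_le {a b : ℂ} (ha : ‖a‖ ≤ 1) (hb : ‖b‖ ≤ 1) (n : ℕ) :
    ‖a ^ n - b ^ n‖ ≤ n * ‖a - b‖ := by
  induction n with
  | zero => simp
  | succ n ih =>
    have e : a ^ (n + 1) - b ^ (n + 1) = a ^ n * (a - b) + (a ^ n - b ^ n) * b := by ring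
    rw [e]
    refine (norm_add_le _ _).trans ?_
    rw [norm_mul, norm_mul, norm_pow]
    calc ‖a‖ ^ n * ‖a - b‖ + ‖a ^ n - b ^ n‖ * ‖b‖
        ≤ 1 * ‖a - b‖ + (n * ‖a - b‖) * 1 := by
          gcongr
          exact pow_le_one₀ (norm_nonneg _) ha
      _ = _ := by push_cast; ring

variable {α : Type*} [MeasurableSpace α]

/-- Taylor expansion of the characteristic function of a bounded centered variable. -/
theorem norm_charFun_sub_le {Q : Measure α} [IsProbabilityMeasure Q] {ψ : α → ℝ}
    (hψ : Measurable ψ) {R : ℝ} (hR : ∀ x, |ψ x| ≤ R) (h0 : ∫ x, ψ x ∂Q = 0) {s : ℝ}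
    (hs : |s| * R ≤ 1) :
    ‖charFun (Q.map ψ) s - ((1 - (∫ x, ψ x ^ 2 ∂Q) * s ^ 2 / 2 : ℝ) : ℂ)‖
      ≤ 3 * (|s| * R) ^ 3 := by
  have hψi : Integrable ψ Q := integrable_of_bounded hψ ⟨R, hR⟩
  have hψ2 : Integrable (fun x => ψ x ^ 2) Q :=
    integrable_of_bounded (hψ.pow_const 2) ⟨R ^ 2, fun x => abs_sq_le_of_abs_le (hR x)⟩
  have hc : charFun (Q.map ψ) s = ∫ x, Complex.exp ((s * ψ x : ℝ) * Complex.I) ∂Q := by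
    rw [charFun_apply_real, integral_map hψ.aemeasurable (by fun_prop)]
    push_cast
    rfl
  have hexp : Integrable (fun x => Complex.exp ((s * ψ x : ℝ) * Complex.I)) Q := by
    refine Integrable.of_bound (C := 1) (by fun_prop) (ae_of_all _ fun x => ?_)
    rw [Complex.norm_exp_ofReal_mul_I]
  have hT : Integrable (fun x => 1 + (s : ℂ) * Complex.I * (ψ x : ℂ)
      - (s : ℂ) ^ 2 / 2 * ((ψ x ^ 2 : ℝ) : ℂ)) Q :=
    ((integrable_const _).add (hψi.ofReal.const_mul _)).sub (hψ2.ofReal.const_mul _)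
  have hTi : ∫ x, (1 + (s : ℂ) * Complex.I * (ψ x : ℂ)
      - (s : ℂ) ^ 2 / 2 * ((ψ x ^ 2 : ℝ) : ℂ)) ∂Q
      = ((1 - (∫ x, ψ x ^ 2 ∂Q) * s ^ 2 / 2 : ℝ) : ℂ) := by
    have i1 : Integrable (fun x => 1 + (s : ℂ) * Complex.I * (ψ x : ℂ)) Q :=
      (integrable_const _).add (hψi.ofReal.const_mul _)
    have i2 : Integrable (fun x => (s : ℂ) * Complex.I * (ψ x : ℂ)) Q := hψi.ofReal.const_mul _
    have i3 : Integrable (fun x => (s : ℂ) ^ 2 / 2 * ((ψ x ^ 2 : ℝ) : ℂ)) Q :=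
      hψ2.ofReal.const_mul _
    rw [integral_sub i1 i3, integral_add (integrable_const _) i2, integral_const_mul,
      integral_const_mul, integral_complex_ofReal, integral_complex_ofReal, h0]
    simp
    ring
  rw [hc, ← hTi, ← integral_sub hexp hT]
  refine (norm_integral_le_of_norm_le_const (C := 3 * (|s| * R) ^ 3)
    (ae_of_all _ fun x => ?_)).trans (by simp)
  have h1 := Complex.norm_exp_sub_sum_le_norm_mul_exp ((s * ψ x : ℝ) * Complex.I) 3
  have hn : ‖((s * ψ x : ℝ) : ℂ) * Complex.I‖ = |s| * |ψ x| := by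
    rw [norm_mul, Complex.norm_I, mul_one, Complex.norm_real, Real.norm_eq_abs, abs_mul]
  have h2 : |s| * |ψ x| ≤ |s| * R := mul_le_mul_of_nonneg_left (hR x) (abs_nonneg s)
  rw [hn] at h1
  have e : ∑ m ∈ Finset.range 3, (((s * ψ x : ℝ) : ℂ) * Complex.I) ^ m / (m.factorial : ℂ)
      = 1 + (s : ℂ) * Complex.I * (ψ x : ℂ) - (s : ℂ) ^ 2 / 2 * ((ψ x ^ 2 : ℝ) : ℂ) := by
    simp only [Finset.sum_range_succ, Finset.sum_range_zero, mul_pow, Complex.I_sq]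
    simp [Nat.factorial]
    ring
  rw [e] at h1
  refine h1.trans ?_
  have h3 : Real.exp (|s| * |ψ x|) ≤ 3 := by
    have h4 := Real.exp_le_exp.2 (h2.trans hs)
    have := Real.exp_one_lt_d9
    linarith
  have h5 : 0 ≤ |s| * R := le_trans (by positivity) h2
  calc (|s| * |ψ x|) ^ 3 * Real.exp (|s| * |ψ x|) ≤ (|s| * R) ^ 3 * 3 := by gcongr
    _ = _ := mul_comm _ _

/-- The standardized sum of a function of the observations. -/
noncomputable def standardizedSum {n : ℕ} (φ : α → ℝ) (Q : Measure α) (y : Fin n → α) : ℝ :=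
  (√(n : ℝ))⁻¹ * ∑ i, (φ (y i) - ∫ x, φ x ∂Q)

theorem measurable_standardizedSum {n : ℕ} {φ : α → ℝ} (hφ : Measurable φ) (Q : Measure α) :
    Measurable (standardizedSum (n := n) φ Q) := by
  unfold standardizedSum
  fun_prop

theorem charFun_standardizedSum {n : ℕ} {φ : α → ℝ} (hφ : Measurable φ) (Q : Measure α)
    [IsProbabilityMeasure Q] (t : ℝ) :
    charFun ((Measure.pi fun _ : Fin n => Q).map (standardizedSum φ Q)) t
      = charFun (Q.map fun x => φ x - ∫ x, φ x ∂Q) ((√(n : ℝ))⁻¹ * t) ^ n := by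
  set ψ : α → ℝ := fun x => φ x - ∫ x, φ x ∂Q with hψdef
  have hψ : Measurable ψ := hφ.sub_const _
  have hind : iIndepFun (fun (i : Fin n) (y : Fin n → α) => ψ (y i))
      (Measure.pi fun _ : Fin n => Q) := iIndepFun_pi fun i => hψ.aemeasurable
  have hm : ∀ i : Fin n, Measurable fun y : Fin n → α => ψ (y i) := fun i => by fun_prop
  have h1 := hind.charFun_map_fun_sum_eq_prod (fun i => (hm i).aemeasurable)
  have h2 : ∀ i : Fin n, (Measure.pi fun _ : Fin n => Q).map (fun y => ψ (y i)) = Q.map ψ := by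
    intro i
    have hp := measurePreserving_eval (fun _ : Fin n => Q) i
    rw [← hp.map_eq, Measure.map_map hψ hp.measurable, hp.map_eq]
    rfl
  have h3 : (standardizedSum φ Q : (Fin n → α) → ℝ)
      = fun y => (√(n : ℝ))⁻¹ * ∑ i, ψ (y i) := rfl
  rw [h3, charFun_map_mul_comp (Finset.measurable_sum _ fun i _ => hm i).aemeasurable, h1]
  simp [h2]

/-- A central limit theorem for the mean of a bounded function, uniform in the sampling law. -/
theorem uniform_central_limit {φ : α → ℝ} (hφ : Measurable φ) {M : ℝ} (hM : ∀ x, |φ x| ≤ M)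
    {v : ℝ≥0} (hv : v ≠ 0) {ε : ℝ} (hε : 0 < ε) :
    ∃ δ : ℝ, 0 < δ ∧ ∃ N : ℕ, ∀ n : ℕ, N ≤ n → ∀ Q : Measure α, IsProbabilityMeasure Q →
      |∫ x, (φ x - ∫ z, φ z ∂Q) ^ 2 ∂Q - v| ≤ δ → ∀ t : ℝ,
        |(Measure.pi fun _ : Fin n => Q).real {y | standardizedSum φ Q y ≤ t}
          - (gaussianReal 0 v).real (Set.Iic t)| ≤ ε := by
  -- Failure of uniformity yields laws `Q k` and sample sizes `n k ≥ k` with variances tending to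
  -- `v` and a fixed gap `ε`. Lévy's continuity theorem for this triangular array, followed by
  -- Pólya's theorem, contradicts the gap.
  by_contra! hcon
  have hk : ∀ k : ℕ, ∃ n : ℕ, k ≤ n ∧ ∃ Q : Measure α, IsProbabilityMeasure Q ∧
      |∫ x, (φ x - ∫ z, φ z ∂Q) ^ 2 ∂Q - v| ≤ 1 / ((k : ℝ) + 1) ∧ ∃ t : ℝ,
        ε < |(Measure.pi fun _ : Fin n => Q).real {y | standardizedSum φ Q y ≤ t}
          - (gaussianReal 0 v).real (Set.Iic t)| := fun k =>
    hcon (1 / ((k : ℝ) + 1)) (by positivity) k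
  choose n hn Q hQ hvar t ht using hk
  have hnt : Tendsto n atTop atTop := tendsto_atTop_mono hn tendsto_id
  have hsq : Tendsto (fun k => √(n k : ℝ)) atTop atTop :=
    Real.tendsto_sqrt_atTop.comp (tendsto_natCast_atTop_atTop.comp hnt)
  have hM0 : 0 ≤ M := by
    have : Nonempty α := (hQ 0).neZero.1 |> fun h => by
      by_contra hne
      rw [not_nonempty_iff] at hne
      exact h (Measure.eq_zero_of_isEmpty _)
    exact (abs_nonneg _).trans (hM this.some)
  let ν : ℕ → ProbabilityMeasure ℝ := fun k =>
    ⟨(Measure.pi fun _ : Fin (n k) => Q k).map (standardizedSum φ (Q k)),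
      Measure.isProbabilityMeasure_map (measurable_standardizedSum hφ _).aemeasurable⟩
  have hν : Tendsto ν atTop (𝓝 ⟨gaussianReal 0 v, inferInstance⟩) := by
    refine ProbabilityMeasure.tendsto_of_tendsto_charFun fun s => ?_
    simp only [ν, ProbabilityMeasure.coe_mk, charFun_gaussianReal]
    rw [tendsto_iff_norm_sub_tendsto_zero]
    -- The three terms are the third-order Taylor remainder, the discrepancy between the variance
    -- and `v`, and the error of `exp (-x) ≈ 1 - x`, each multiplied by the `n k` factors.
    set bnd : ℕ → ℝ := fun k => 3 * (|s| * (2 * M)) ^ 3 * (√(n k : ℝ))⁻¹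
      + 1 / ((k : ℝ) + 1) * (s ^ 2 / 2) + (v * s ^ 2 / 2) ^ 2 * ((n k : ℝ))⁻¹ with hbnd
    have hb0 : Tendsto bnd atTop (𝓝 0) := by
      have h1 : Tendsto (fun k => (√(n k : ℝ))⁻¹) atTop (𝓝 0) := tendsto_inv_atTop_zero.comp hsq
      have h2 : Tendsto (fun k : ℕ => 1 / ((k : ℝ) + 1)) atTop (𝓝 0) :=
        tendsto_one_div_add_atTop_nhds_zero_nat
      have h3 : Tendsto (fun k => ((n k : ℝ))⁻¹) atTop (𝓝 0) :=
        tendsto_inv_atTop_zero.comp (tendsto_natCast_atTop_atTop.comp hnt)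
      simpa only [mul_zero, zero_mul, add_zero] using
        ((h1.const_mul (3 * (|s| * (2 * M)) ^ 3)).add (h2.mul_const (s ^ 2 / 2))).add
          (h3.const_mul ((v * s ^ 2 / 2) ^ 2))
    refine squeeze_zero' (Eventually.of_forall fun k => norm_nonneg _) ?_ hb0
    filter_upwards [hsq.eventually_ge_atTop (|s| * (2 * M)),
      (tendsto_natCast_atTop_atTop.comp hnt).eventually_ge_atTop (v * s ^ 2 / 2),
      hnt.eventually_ge_atTop 1] with k hk1 hk2 hk3
    have := hQ k
    have hn0 : (0 : ℝ) < n k := by exact_mod_cast hk3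
    set r := √(n k : ℝ) with hr
    have hr0 : 0 < r := Real.sqrt_pos.2 hn0
    have hr2 : r ^ 2 = n k := Real.sq_sqrt hn0.le
    set m := ∫ z, φ z ∂(Q k) with hm
    have hmM : |m| ≤ M := by
      have := norm_integral_le_of_norm_le_const (μ := Q k) (f := φ) (C := M) (ae_of_all _ hM)
      simpa using this
    set w := ∫ x, (φ x - m) ^ 2 ∂(Q k) with hw
    rw [charFun_standardizedSum hφ]
    set c := charFun ((Q k).map fun x => φ x - m) (r⁻¹ * s) with hc
    -- The `n k`-th root of the Gaussian characteristic function at `s`.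
    set b : ℂ := ((Real.exp (-(v * s ^ 2 / 2 / n k)) : ℝ) : ℂ) with hb
    have hbn : b ^ (n k) = Complex.exp (s * (0 : ℝ) * Complex.I - (v : ℝ) * s ^ 2 / 2) := by
      have hnC : (n k : ℂ) ≠ 0 := by exact_mod_cast hn0.ne'
      rw [hb, ← Complex.ofReal_pow, ← Real.exp_nat_mul]
      push_cast
      congr 1
      field_simp
      ring
    have hc1 : ‖c‖ ≤ 1 := by
      have : IsProbabilityMeasure ((Q k).map fun x => φ x - m) :=
        Measure.isProbabilityMeasure_map (hφ.sub_const _).aemeasurable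
      exact norm_charFun_le_one _
    have hb1 : ‖b‖ ≤ 1 := by
      rw [hb, Complex.norm_real, Real.norm_eq_abs, abs_of_pos (Real.exp_pos _)]
      refine Real.exp_le_one_iff.2 ?_
      have : 0 ≤ v * s ^ 2 / 2 / n k := by positivity
      linarith
    have hsr : |r⁻¹ * s| * (2 * M) = (|s| * (2 * M)) * r⁻¹ := by
      rw [abs_mul, abs_of_pos (inv_pos.2 hr0)]
      ring
    have hT := norm_charFun_sub_le (Q := Q k) (ψ := fun x => φ x - m) (hφ.sub_const _)
      (R := 2 * M) (fun x => (abs_sub _ _).trans (by linarith [hM x])) (by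
        rw [integral_sub (integrable_of_bounded hφ ⟨M, hM⟩) (integrable_const _)]
        simp [hm]) (s := r⁻¹ * s) (by
        rw [hsr, ← div_eq_mul_inv]
        exact (div_le_one hr0).2 hk1)
    rw [← hw, ← hc, hsr] at hT
    have hu0 : 0 ≤ v * s ^ 2 / 2 / n k := by positivity
    have hu1 : v * s ^ 2 / 2 / n k ≤ 1 := (div_le_one hn0).2 hk2
    have hE := Real.abs_exp_sub_one_sub_id_le (x := -(v * s ^ 2 / 2 / n k)) (by
      rw [abs_neg, abs_of_nonneg hu0]
      exact hu1)
    have hB : ‖((1 - w * (r⁻¹ * s) ^ 2 / 2 : ℝ) : ℂ) - b‖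
        ≤ 1 / ((k : ℝ) + 1) * (s ^ 2 / 2) * (n k : ℝ)⁻¹
          + (v * s ^ 2 / 2) ^ 2 * ((n k : ℝ)⁻¹) ^ 2 := by
      rw [hb, ← Complex.ofReal_sub, Complex.norm_real, Real.norm_eq_abs]
      have e1 : (r⁻¹ * s) ^ 2 = s ^ 2 * (n k : ℝ)⁻¹ := by
        rw [mul_pow, inv_pow, hr2]
        ring
      rw [e1]
      have e2 : 1 - w * (s ^ 2 * (n k : ℝ)⁻¹) / 2 - Real.exp (-(v * s ^ 2 / 2 / n k))
          = -((w - v) * (s ^ 2 / 2) * (n k : ℝ)⁻¹)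
            - (Real.exp (-(v * s ^ 2 / 2 / n k)) - 1 - -(v * s ^ 2 / 2 / n k)) := by
        field_simp
        ring
      rw [e2]
      refine (abs_sub _ _).trans (add_le_add ?_ (hE.trans (le_of_eq ?_)))
      · rw [abs_neg, abs_mul, abs_mul, abs_of_nonneg (a := s ^ 2 / 2) (by positivity),
          abs_of_pos (inv_pos.2 hn0)]
        gcongr
        exact hvar k
      · rw [neg_sq, div_eq_mul_inv _ (n k : ℝ), mul_pow]
    rw [← hbn]
    calc ‖c ^ n k - b ^ n k‖ ≤ n k * ‖c - b‖ := norm_pow_sub_pow_le hc1 hb1 _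
      _ ≤ n k * (3 * ((|s| * (2 * M)) * r⁻¹) ^ 3
          + (1 / ((k : ℝ) + 1) * (s ^ 2 / 2) * (n k : ℝ)⁻¹
          + (v * s ^ 2 / 2) ^ 2 * ((n k : ℝ)⁻¹) ^ 2)) := by
          gcongr
          calc ‖c - b‖ = ‖(c - ((1 - w * (r⁻¹ * s) ^ 2 / 2 : ℝ) : ℂ))
              + (((1 - w * (r⁻¹ * s) ^ 2 / 2 : ℝ) : ℂ) - b)‖ := by congr 1; ring
            _ ≤ _ := (norm_add_le _ _).trans (add_le_add hT hB)
      _ = bnd k := by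
          simp only [hbnd]
          rw [← hr, ← hr2]
          field_simp
          ring
  obtain ⟨k, hk⟩ := (eventually_forall_abs_cdf_sub_le hv hν hε).exists
  have h1 := hk (t k)
  have h2 : (ν k : Measure ℝ).real (Set.Iic (t k))
      = (Measure.pi fun _ : Fin (n k) => Q k).real {y | standardizedSum φ (Q k) y ≤ t k} := by
    simp only [ν, ProbabilityMeasure.coe_mk]
    rw [map_measureReal_apply (measurable_standardizedSum hφ _) measurableSet_Iic]
    rfl
  rw [h2] at h1
  exact absurd h1 (not_le.2 (ht k))

end CentralLimit

/-! ### Convergence in probability of statistics of an independent sample. -/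

section Negligible

variable {α : Type*} [MeasurableSpace α]

/-- Convergence to zero in probability of a sequence of statistics `r n`, where `r n` is a function
of an independent sample of size `n` from `Q`. -/
def Negligible (Q : Measure α) (r : (n : ℕ) → (Fin n → α) → ℝ) : Prop :=
  ∀ ε : ℝ, 0 < ε →
    Tendsto (fun n => (Measure.pi fun _ : Fin n => Q).real {x | ε ≤ |r n x|}) atTop (𝓝 0)

variable {Q : Measure α} [IsProbabilityMeasure Q] {r r' : (n : ℕ) → (Fin n → α) → ℝ}

theorem Negligible.mono (hr : Negligible Q r) (h : ∀ᶠ n in atTop, ∀ x, |r' n x| ≤ |r n x|) :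
    Negligible Q r' := fun ε hε => by
  refine squeeze_zero' (Eventually.of_forall fun n => measureReal_nonneg) ?_ (hr ε hε)
  filter_upwards [h] with n hn
  exact measureReal_mono fun x (hx : ε ≤ _) => hx.trans (hn x)

theorem Negligible.add (hr : Negligible Q r) (hr' : Negligible Q r') :
    Negligible Q fun n x => r n x + r' n x := fun ε hε => by
  have h := (hr (ε / 2) (half_pos hε)).add (hr' (ε / 2) (half_pos hε))
  rw [add_zero] at h
  refine squeeze_zero (fun n => measureReal_nonneg) (fun n => ?_) h
  refine (measureReal_mono fun x (hx : ε ≤ _) => ?_).trans (measureReal_union_le _ _)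
  by_contra hc
  simp only [Set.mem_union, Set.mem_ofPred_eq, not_or, not_le] at hc
  linarith [abs_add_le (r n x) (r' n x)]

omit [IsProbabilityMeasure Q] in
theorem Negligible.of_tendsto {a : ℕ → ℝ} (ha : Tendsto a atTop (𝓝 0)) :
    Negligible Q fun n _ => a n := fun ε hε => by
  refine tendsto_const_nhds.congr' ?_
  filter_upwards [(tendsto_order.1 (ha.abs)).2 ε (by simpa using hε)] with n hn
  have : {x : Fin n → α | ε ≤ |a n|} = ∅ := by ext x; simpa using hn
  rw [this, measureReal_empty]

theorem Negligible.const_mul (hr : Negligible Q r) (c : ℝ) :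
    Negligible Q fun n x => c * r n x := fun ε hε => by
  have hc : 0 < |c| + 1 := by positivity
  refine squeeze_zero (fun n => measureReal_nonneg) (fun n => ?_)
    (hr (ε / (|c| + 1)) (div_pos hε hc))
  refine measureReal_mono fun x (hx : ε ≤ _) => ?_
  rw [Set.mem_ofPred_eq, div_le_iff₀ hc]
  rw [abs_mul] at hx
  nlinarith [abs_nonneg (r n x)]

theorem Negligible.abs (hr : Negligible Q r) : Negligible Q fun n x => |r n x| :=
  hr.mono (Eventually.of_forall fun _ _ => (abs_abs _).le)

theorem Negligible.congr (hr : Negligible Q r) (h : ∀ᶠ n in atTop, ∀ x, r' n x = r n x) :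
    Negligible Q r' :=
  hr.mono (h.mono fun n hn x => by rw [hn x])

omit [IsProbabilityMeasure Q] in
theorem Negligible.of_sq (hr : Negligible Q fun n x => r n x ^ 2) : Negligible Q r :=
  fun ε hε => by
  refine (hr (ε ^ 2) (by positivity)).congr fun n => ?_
  congr 1
  ext x
  simp only [Set.mem_ofPred_eq, abs_pow]
  exact pow_le_pow_iff_left₀ hε.le (abs_nonneg _) two_ne_zero

theorem measureReal_le_integral_div {β : Type*} [MeasurableSpace β] {ν : Measure β}
    [IsFiniteMeasure ν] {f : β → ℝ} (hf : Integrable f ν) (h0 : ∀ x, 0 ≤ f x) {ε : ℝ}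
    (hε : 0 < ε) : ν.real {x | ε ≤ f x} ≤ (∫ x, f x ∂ν) / ε := by
  rw [le_div_iff₀ hε, mul_comm]
  exact mul_meas_ge_le_integral_of_nonneg (Eventually.of_forall h0) hf ε

theorem Negligible.of_integral (hm : ∀ᶠ n in atTop, Integrable (r n) (Measure.pi fun _ => Q))
    (h0 : ∀ n x, 0 ≤ r n x)
    (hl : Tendsto (fun n => ∫ x, r n x ∂(Measure.pi fun _ : Fin n => Q)) atTop (𝓝 0)) :
    Negligible Q r := fun ε hε => by
  have h := hl.div_const ε
  rw [zero_div] at h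
  refine squeeze_zero' (Eventually.of_forall fun n => measureReal_nonneg) ?_ h
  filter_upwards [hm] with n hn
  simp_rw [abs_of_nonneg (h0 n _)]
  exact measureReal_le_integral_div hn (h0 n) hε

/-- The weak law of large numbers. -/
theorem negligible_mean_sub {g : α → ℝ} (hg : Measurable g) (hb : ∃ M : ℝ, ∀ x, |g x| ≤ M) :
    Negligible Q fun n x => (n : ℝ)⁻¹ * ∑ i, g (x i) - ∫ z, g z ∂Q := by
  obtain ⟨M, hM⟩ := hb
  have hgi : Integrable g Q := integrable_of_bounded hg ⟨M, hM⟩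
  set m := ∫ z, g z ∂Q with hm
  have hψ : Measurable fun z => g z - m := hg.sub_const _
  have hψb : ∀ z, |g z - m| ≤ M + |m| := fun z =>
    (abs_sub _ _).trans (by gcongr; exact hM z)
  have h0 : ∫ z, (g z - m) ∂Q = 0 := by
    rw [integral_sub hgi (integrable_const _)]; simp [hm]
  refine Negligible.of_sq (Negligible.of_integral ?_ (fun n x => sq_nonneg _) ?_)
  · refine Eventually.of_forall fun n => integrable_of_bounded (by fun_prop)
      ⟨(M + |m|) ^ 2, fun x => abs_sq_le_of_abs_le ?_⟩
    have hM0 : 0 ≤ M := by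
      have : Nonempty α := nonempty_of_isProbabilityMeasure Q
      exact (abs_nonneg _).trans (hM (Classical.arbitrary α))
    refine (abs_sub _ _).trans (add_le_add ?_ le_rfl)
    rw [abs_mul, abs_of_nonneg (by positivity : (0 : ℝ) ≤ (n : ℝ)⁻¹)]
    rcases Nat.eq_zero_or_pos n with rfl | hn
    · simpa using hM0
    have hn0 : (0 : ℝ) < n := Nat.cast_pos.2 hn
    rw [inv_mul_le_iff₀ hn0]
    refine (Finset.abs_sum_le_sum_abs _ _).trans ((Finset.sum_le_sum fun i _ => hM (x i)).trans ?_)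
    simp
  · set V := ∫ z, (g z - m) ^ 2 ∂Q with hV
    have hlim : Tendsto (fun n : ℕ => V * (n : ℝ)⁻¹) atTop (𝓝 0) := by
      simpa using tendsto_inv_atTop_nhds_zero_nat (𝕜 := ℝ) |>.const_mul V
    refine squeeze_zero' (Eventually.of_forall fun n => integral_nonneg fun x => sq_nonneg _) ?_ hlim
    filter_upwards [eventually_gt_atTop 0] with n hn
    have hn0 : (0 : ℝ) < n := Nat.cast_pos.2 hn
    have key := integral_sq_sum_eval_le (n := n) (Q := Q) (c := fun _ => (n : ℝ)⁻¹)
      (β := (n : ℝ)⁻¹) hψ ⟨_, hψb⟩ h0 (fun i => by rw [abs_of_nonneg (by positivity)])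
    calc ∫ x : Fin n → α, ((n : ℝ)⁻¹ * ∑ i, g (x i) - m) ^ 2 ∂(Measure.pi fun _ => Q)
        = ∫ x : Fin n → α, (∑ i, (n : ℝ)⁻¹ * (g (x i) - m)) ^ 2 ∂(Measure.pi fun _ => Q) := by
          congr 1; ext x; rw [← Finset.mul_sum, Finset.sum_sub_distrib]; simp; field_simp
      _ ≤ n * (n : ℝ)⁻¹ ^ 2 * V := key
      _ = V * (n : ℝ)⁻¹ := by field_simp

end Negligible

/-! ### Linear expansions valid under sampling and under the bootstrap. -/

section Expansion

variable {d : ℕ} {Q : Measure (E d)} [IsProbabilityMeasure Q] {φ : E d → ℝ}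

/-- The asymptotic linear representation of a sequence of statistics `T n`, both under independent
sampling from `Q` and under the bootstrap: up to the bias terms `b n` common to both, `T n` is
`A` times a centred sample mean of `φ`. -/
structure LinearExpansion (Q : Measure (E d)) (φ : E d → ℝ) (T : (n : ℕ) → (Fin n → E d) → ℝ)
    (A : ℝ) (θ b : ℕ → ℝ) : Prop where
  measurable : ∀ n, Measurable (T n)
  sampling : Negligible Q fun n x =>
    √(n : ℝ) * (T n x - θ n - b n) - A * standardizedSum φ Q x
  bootstrap : ∀ ε : ℝ, 0 < ε → Negligible Q fun n x => (bootstrapLaw x).real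
    {y | ε ≤ |√(n : ℝ) * (T n y - T n x - b n) - A * standardizedSum φ (empiricalLaw x) y|}

theorem isProbabilityMeasure_bootstrapLaw {n : ℕ} (hn : 0 < n) (x : Fin n → E d) :
    IsProbabilityMeasure (bootstrapLaw x) := by
  have := isProbabilityMeasure_empiricalLaw hn x
  unfold bootstrapLaw
  infer_instance

variable {T T₁ T₂ : (n : ℕ) → (Fin n → E d) → ℝ} {A A₁ A₂ : ℝ} {θ θ₁ θ₂ b b₁ b₂ : ℕ → ℝ}

theorem LinearExpansion.add (h₁ : LinearExpansion Q φ T₁ A₁ θ₁ b₁)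
    (h₂ : LinearExpansion Q φ T₂ A₂ θ₂ b₂) :
    LinearExpansion Q φ (fun n x => T₁ n x + T₂ n x) (A₁ + A₂) (fun n => θ₁ n + θ₂ n)
      (fun n => b₁ n + b₂ n) where
  measurable n := (h₁.measurable n).add (h₂.measurable n)
  sampling := (h₁.sampling.add h₂.sampling).congr (Eventually.of_forall fun n x => by ring)
  bootstrap ε hε := by
    refine ((h₁.bootstrap _ (half_pos hε)).add (h₂.bootstrap _ (half_pos hε))).mono ?_
    filter_upwards [eventually_gt_atTop 0] with n hn x
    have := isProbabilityMeasure_bootstrapLaw hn x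
    rw [abs_of_nonneg measureReal_nonneg,
      abs_of_nonneg (add_nonneg measureReal_nonneg measureReal_nonneg)]
    refine (measureReal_mono fun y (hy : ε ≤ _) => ?_).trans (measureReal_union_le _ _)
    by_contra hc
    simp only [Set.mem_union, Set.mem_ofPred_eq, not_or, not_le] at hc
    have h := abs_add_le
      (√(n : ℝ) * (T₁ n y - T₁ n x - b₁ n) - A₁ * standardizedSum φ (empiricalLaw x) y)
      (√(n : ℝ) * (T₂ n y - T₂ n x - b₂ n) - A₂ * standardizedSum φ (empiricalLaw x) y)
    refine absurd (hy.trans ?_) (not_le.2 (h.trans_lt (add_lt_add hc.1 hc.2 |>.trans_eq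
      (add_halves ε))))
    exact le_of_eq (by congr 1; ring)

theorem LinearExpansion.const_mul (h : LinearExpansion Q φ T A θ b) (c : ℝ) :
    LinearExpansion Q φ (fun n x => c * T n x) (c * A) (fun n => c * θ n)
      (fun n => c * b n) where
  measurable n := (h.measurable n).const_mul c
  sampling := (h.sampling.const_mul c).congr (Eventually.of_forall fun n x => by ring)
  bootstrap ε hε := by
    have hc : 0 < |c| + 1 := by positivity
    refine (h.bootstrap (ε / (|c| + 1)) (div_pos hε hc)).mono ?_
    filter_upwards [eventually_gt_atTop 0] with n hn x
    have := isProbabilityMeasure_bootstrapLaw hn x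
    rw [abs_of_nonneg measureReal_nonneg, abs_of_nonneg measureReal_nonneg]
    refine measureReal_mono fun y (hy : ε ≤ _) => ?_
    rw [Set.mem_ofPred_eq, div_le_iff₀ hc]
    have e : √(n : ℝ) * (c * T n y - c * T n x - c * b n)
        - c * A * standardizedSum φ (empiricalLaw x) y
        = c * (√(n : ℝ) * (T n y - T n x - b n) - A * standardizedSum φ (empiricalLaw x) y) := by
      ring
    rw [e, abs_mul] at hy
    nlinarith [abs_nonneg
      (√(n : ℝ) * (T n y - T n x - b n) - A * standardizedSum φ (empiricalLaw x) y)]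

/-- Changing the statistic by constants, and the centring and bias terms by `o(n^{-1/2})`. -/
theorem LinearExpansion.recenter (h : LinearExpansion Q φ T A θ b) {θ' b' κ : ℕ → ℝ}
    (hθ : Tendsto (fun n : ℕ => √(n : ℝ) * (θ n - κ n - θ' n)) atTop (𝓝 0))
    (hb : Tendsto (fun n : ℕ => √(n : ℝ) * (b n - b' n)) atTop (𝓝 0)) :
    LinearExpansion Q φ (fun n x => T n x - κ n) A θ' b' where
  measurable n := (h.measurable n).sub_const _
  sampling := ((h.sampling.add (Negligible.of_tendsto hθ)).add (Negligible.of_tendsto hb)).congr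
    (Eventually.of_forall fun n x => by ring)
  bootstrap ε hε := by
    refine (h.bootstrap _ (half_pos hε)).mono ?_
    filter_upwards [eventually_gt_atTop 0,
      (tendsto_order.1 hb.abs).2 (ε / 2) (by simpa using half_pos hε)] with n hn hbn x
    have := isProbabilityMeasure_bootstrapLaw hn x
    rw [abs_of_nonneg measureReal_nonneg, abs_of_nonneg measureReal_nonneg]
    refine measureReal_mono fun y (hy : ε ≤ _) => ?_
    -- The constant `κ n` cancels from the bootstrap difference, so a deterministic correction
    -- leaves the bootstrap bias as it was; it acts only through the centring under sampling.
    have e : √(n : ℝ) * (T n y - κ n - (T n x - κ n) - b' n)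
        - A * standardizedSum φ (empiricalLaw x) y
        = √(n : ℝ) * (T n y - T n x - b n) - A * standardizedSum φ (empiricalLaw x) y
          + √(n : ℝ) * (b n - b' n) := by ring
    rw [e] at hy
    have := abs_add_le
      (√(n : ℝ) * (T n y - T n x - b n) - A * standardizedSum φ (empiricalLaw x) y)
      (√(n : ℝ) * (b n - b' n))
    rw [Set.mem_ofPred_eq]
    linarith

omit [IsProbabilityMeasure Q] in
theorem LinearExpansion.congr (h : LinearExpansion Q φ T A θ b)
    {T' : (n : ℕ) → (Fin n → E d) → ℝ} {A' : ℝ} {θ' b' : ℕ → ℝ} (hT : T' = T) (hA : A' = A)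
    (hθ : θ' = θ) (hb : b' = b) : LinearExpansion Q φ T' A' θ' b' := by
  subst hT hA hθ hb
  exact h

end Expansion

/-! ### From a linear expansion to bootstrap consistency. -/

theorem integral_sub_integral_sq {α : Type*} [MeasurableSpace α] {Q : Measure α}
    [IsProbabilityMeasure Q] {φ : α → ℝ} (hφ : Measurable φ) (hφb : ∃ M : ℝ, ∀ x, |φ x| ≤ M) :
    ∫ x, (φ x - ∫ z, φ z ∂Q) ^ 2 ∂Q = ∫ x, φ x ^ 2 ∂Q - (∫ x, φ x ∂Q) ^ 2 := by
  obtain ⟨M, hM⟩ := hφb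
  have h1 : Integrable φ Q := integrable_of_bounded hφ ⟨M, hM⟩
  have h2 : Integrable (fun x => φ x ^ 2) Q :=
    integrable_of_bounded (hφ.pow_const 2) ⟨M ^ 2, fun x => abs_sq_le_of_abs_le (hM x)⟩
  set m := ∫ z, φ z ∂Q with hm
  have e : ∀ x, (φ x - m) ^ 2 = φ x ^ 2 - 2 * m * φ x + m ^ 2 := fun x => by ring
  simp_rw [e]
  rw [integral_add (f := fun x => φ x ^ 2 - 2 * m * φ x) (h2.sub (h1.const_mul _))
      (integrable_const _), integral_sub h2 (h1.const_mul _), integral_const_mul, ← hm]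
  simp
  ring

/-- The law of large numbers for `φ` and `φ²`; the squared means are compared through a difference
of squares with a bounded factor. Hence with probability tending to one the empirical law meets the
variance condition of `uniform_central_limit`. -/
theorem negligible_empirical_variance_sub {d : ℕ} {Q : Measure (E d)} [IsProbabilityMeasure Q]
    {φ : E d → ℝ} (hφ : Measurable φ) (hφb : ∃ M : ℝ, ∀ x, |φ x| ≤ M) :
    Negligible Q fun _ x =>
      ∫ z, (φ z - ∫ w, φ w ∂(empiricalLaw x)) ^ 2 ∂(empiricalLaw x)
        - ∫ z, (φ z - ∫ w, φ w ∂Q) ^ 2 ∂Q := by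
  obtain ⟨M, hM⟩ := hφb
  have h1 := negligible_mean_sub (Q := Q) hφ ⟨M, hM⟩
  have h2 := negligible_mean_sub (Q := Q) (hφ.pow_const 2)
    ⟨M ^ 2, fun x => abs_sq_le_of_abs_le (hM x)⟩
  have hmean : ∀ P : Measure (E d), IsProbabilityMeasure P → |∫ w, φ w ∂P| ≤ M := fun P _ => by
    simpa using norm_integral_le_of_norm_le_const (μ := P) (f := φ) (Eventually.of_forall hM)
  have h3 : Negligible Q fun n x =>
      ((n : ℝ)⁻¹ * ∑ i, φ (x i) - ∫ z, φ z ∂Q) * ((n : ℝ)⁻¹ * ∑ i, φ (x i) + ∫ z, φ z ∂Q) := by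
    refine (h1.const_mul (2 * M)).mono ?_
    filter_upwards [eventually_gt_atTop 0] with n hn x
    have := isProbabilityMeasure_empiricalLaw hn x
    rw [abs_mul, abs_mul, mul_comm]
    refine mul_le_mul_of_nonneg_right ?_ (abs_nonneg _)
    rw [← integral_empiricalLaw x φ]
    refine (abs_add_le _ _).trans (le_trans ?_ (le_abs_self _))
    linarith [hmean _ this, hmean Q inferInstance]
  refine (h2.add (h3.const_mul (-1))).congr ?_
  filter_upwards [eventually_gt_atTop 0] with n hn x
  have := isProbabilityMeasure_empiricalLaw hn x
  rw [integral_sub_integral_sq hφ ⟨M, hM⟩, integral_sub_integral_sq hφ ⟨M, hM⟩,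
    integral_empiricalLaw, integral_empiricalLaw]
  ring

/-- A shifted perturbation of an almost Gaussian variable is almost Gaussian. -/
theorem abs_cdf_sub_gaussian_le {β : Type*} [MeasurableSpace β] {ν : Measure β}
    [IsProbabilityMeasure ν] {v : ℝ≥0} (hv : v ≠ 0) {W Z : β → ℝ} {c η ε : ℝ} (hη : 0 ≤ η)
    (hZ : ∀ t, |ν.real {y | Z y ≤ t} - (gaussianReal 0 v).real (Set.Iic t)| ≤ ε)
    (hW : ν.real {y | η ≤ |W y - c - Z y|} ≤ ε) (hε : (√(2 * Real.pi * v))⁻¹ * η ≤ ε) (t : ℝ) :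
    |ν.real {y | W y ≤ t} - (gaussianReal 0 v).real (Set.Iic (t - c))| ≤ 3 * ε := by
  have hup : ν.real {y | W y ≤ t} ≤ ν.real {y | Z y ≤ t - c + η} + ε := by
    refine le_trans ?_ (add_le_add le_rfl hW)
    refine (measureReal_mono fun y (hy : W y ≤ t) => ?_).trans (measureReal_union_le _ _)
    by_contra hc
    simp only [Set.mem_union, Set.mem_ofPred_eq, not_or, not_le] at hc
    linarith [(abs_lt.1 hc.2).1]
  have hlow : ν.real {y | Z y ≤ t - c - η} ≤ ν.real {y | W y ≤ t} + ε := by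
    refine le_trans ?_ (add_le_add le_rfl hW)
    refine (measureReal_mono fun y (hy : Z y ≤ t - c - η) => ?_).trans (measureReal_union_le _ _)
    by_contra hc
    simp only [Set.mem_union, Set.mem_ofPred_eq, not_or, not_le] at hc
    linarith [(abs_lt.1 hc.2).2]
  have g1 := gaussianReal_Iic_add_le hv (t - c) hη
  have g2 := gaussianReal_Iic_add_le hv (t - c - η) hη
  rw [sub_add_cancel] at g2
  have z1 := abs_le.1 (hZ (t - c + η))
  have z2 := abs_le.1 (hZ (t - c - η))
  rw [abs_le]
  constructor <;> linarith [z1.1, z1.2, z2.1, z2.2]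

theorem map_sample {d : ℕ} {Ω : Type*} [MeasurableSpace Ω] {μ : Measure Ω}
    [IsProbabilityMeasure μ] {X : ℕ → Ω → E d} {Q : Measure (E d)} (hX : ∀ i, Measurable (X i))
    (hind : iIndepFun X μ) (hlaw : ∀ i, μ.map (X i) = Q) (n : ℕ) :
    μ.map (sample X n) = Measure.pi fun _ : Fin n => Q := by
  have h := (hind.precomp (g := fun i : Fin n => (i : ℕ)) Fin.val_injective)
  have h2 := (iIndepFun_iff_map_fun_eq_pi_map fun i : Fin n => (hX i).aemeasurable).1 h
  simp_rw [hlaw] at h2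
  exact h2

/-- Only an inequality, because `A` is not assumed measurable and both sides are outer measures. It
is the direction needed to bound the probability of bad data, an event whose measurability is never
checked. -/
theorem measureReal_sample_le {d : ℕ} {Ω : Type*} [MeasurableSpace Ω] {μ : Measure Ω}
    [IsProbabilityMeasure μ] {X : ℕ → Ω → E d} {Q : Measure (E d)} [IsProbabilityMeasure Q]
    (hX : ∀ i, Measurable (X i))
    (hind : iIndepFun X μ) (hlaw : ∀ i, μ.map (X i) = Q) {n : ℕ} (A : Set (Fin n → E d)) :
    μ.real (sample X n ⁻¹' A) ≤ (Measure.pi fun _ : Fin n => Q).real A := by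
  have hm : Measurable (sample X n) := measurable_pi_lambda _ fun i => hX i
  rw [← map_sample hX hind hlaw n]
  have : IsProbabilityMeasure (μ.map (sample X n)) := Measure.isProbabilityMeasure_map hm.aemeasurable
  exact ENNReal.toReal_mono (measure_ne_top _ _) (Measure.le_map_apply hm.aemeasurable A)

/-- A statistic with a linear expansion is bootstrap consistent. -/
theorem LinearExpansion.bootstrapConsistent {d : ℕ} {Ω : Type*} [MeasurableSpace Ω]
    {μ : Measure Ω} [IsProbabilityMeasure μ] {X : ℕ → Ω → E d} {Q : Measure (E d)}
    [IsProbabilityMeasure Q] (hX : ∀ i, Measurable (X i)) (hind : iIndepFun X μ)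
    (hlaw : ∀ i, μ.map (X i) = Q) {φ : E d → ℝ} (hφ : Measurable φ)
    (hφb : ∃ M : ℝ, ∀ x, |φ x| ≤ M) (hv : 0 < ∫ x, (φ x - ∫ z, φ z ∂Q) ^ 2 ∂Q)
    {T : (n : ℕ) → (Fin n → E d) → ℝ} {θ₀ : ℝ} {b : ℕ → ℝ}
    (h : LinearExpansion Q φ T 1 (fun _ => θ₀) b) : BootstrapConsistent μ X θ₀ T := by
  obtain ⟨M, hM⟩ := hφb
  set v : ℝ≥0 := ⟨∫ x, (φ x - ∫ z, φ z ∂Q) ^ 2 ∂Q, hv.le⟩ with hvdef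
  have hv0 : v ≠ 0 := fun hc => hv.ne' (congrArg NNReal.toReal hc)
  unfold BootstrapConsistent
  rw [tendstoInMeasure_iff_measureReal_norm]
  intro ε hε
  -- Each of the two distribution functions will be within `3 ε'` of the shifted normal one, so
  -- their distance is at most `6 ε' < ε`.
  obtain ⟨ε', hε', hεε'⟩ : ∃ ε' : ℝ, 0 < ε' ∧ 6 * ε' < ε := ⟨ε / 7, by positivity, by linarith⟩
  set L : ℝ := (√(2 * Real.pi * v))⁻¹ with hL
  have hL0 : 0 ≤ L := by positivity
  obtain ⟨η, hη, hLη⟩ : ∃ η : ℝ, 0 < η ∧ L * η ≤ ε' := by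
    refine ⟨ε' / (L + 1), by positivity, ?_⟩
    rw [mul_div_assoc', div_le_iff₀ (by positivity)]
    nlinarith
  obtain ⟨δ, hδ, N, hN⟩ := uniform_central_limit hφ hM hv0 hε'
  have hvar := negligible_empirical_variance_sub (Q := Q) hφ ⟨M, hM⟩ δ hδ
  have hboot := h.bootstrap η hη ε' hε'
  have hsum := hvar.add hboot
  rw [add_zero] at hsum
  refine squeeze_zero' (Eventually.of_forall fun n => measureReal_nonneg) ?_ hsum
  filter_upwards [eventually_ge_atTop N, eventually_gt_atTop 0,
    (tendsto_order.1 (h.sampling η hη)).2 ε' hε'] with n hnN hn hsamp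
  refine le_trans ?_ (measureReal_union_le _ _)
  refine le_trans ?_ (measureReal_sample_le hX hind hlaw _)
  refine measureReal_mono fun ω (hω : ε ≤ _) => ?_
  by_contra hc
  rw [Set.mem_preimage] at hc
  set x := sample X n ω with hx
  simp only [Set.mem_union, Set.mem_ofPred_eq, not_or, not_le] at hc
  have := isProbabilityMeasure_empiricalLaw hn x
  have := isProbabilityMeasure_bootstrapLaw hn x
  have hc2 := hc.2
  rw [abs_of_nonneg measureReal_nonneg] at hc2
  -- The common shift. It may diverge, but both worlds are compared with the same normal
  -- distribution function evaluated at `t - c`.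
  set c := √(n : ℝ) * b n with hcdef
  have side1 : ∀ t, |μ.real {ω' | √(n : ℝ) * (T n (sample X n ω') - θ₀) ≤ t}
      - (gaussianReal 0 v).real (Set.Iic (t - c))| ≤ 3 * ε' := fun t => by
    have hm : Measurable (sample X n) := measurable_pi_lambda _ fun i => hX i
    have e : μ.real {ω' | √(n : ℝ) * (T n (sample X n ω') - θ₀) ≤ t}
        = (Measure.pi fun _ : Fin n => Q).real {y | √(n : ℝ) * (T n y - θ₀) ≤ t} := by
      rw [← map_sample hX hind hlaw n, map_measureReal_apply hm
        (measurableSet_le (((h.measurable n).sub_const _).const_mul _) measurable_const)]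
      rfl
    rw [e]
    refine abs_cdf_sub_gaussian_le hv0 hη.le (hN n hnN Q inferInstance ?_) ?_ hLη t
    · change |(v : ℝ) - v| ≤ δ
      simpa using hδ.le
    · refine le_of_eq_of_le ?_ hsamp.le
      congr 1
      ext y
      simp only [Set.mem_ofPred_eq, one_mul, hcdef]
      rw [show √(n : ℝ) * (T n y - θ₀) - √(n : ℝ) * b n = √(n : ℝ) * (T n y - θ₀ - b n) by ring]
  have side2 : ∀ t, |(bootstrapLaw x).real {y | √(n : ℝ) * (T n y - T n x) ≤ t}
      - (gaussianReal 0 v).real (Set.Iic (t - c))| ≤ 3 * ε' := fun t => by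
    refine abs_cdf_sub_gaussian_le hv0 hη.le (hN n hnN (empiricalLaw x) inferInstance hc.1.le) ?_
      hLη t
    refine le_of_eq_of_le ?_ hc2.le
    congr 1
    ext y
    simp only [Set.mem_ofPred_eq, one_mul, hcdef]
    rw [show √(n : ℝ) * (T n y - T n x) - √(n : ℝ) * b n
      = √(n : ℝ) * (T n y - T n x - b n) by ring]
  rw [sub_zero, Real.norm_eq_abs, abs_of_nonneg (Real.iSup_nonneg fun t => abs_nonneg _)] at hω
  refine absurd (hω.trans (ciSup_le fun t => ?_)) (not_le.2 hεε')
  have e1 := abs_le.1 (side1 t)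
  have e2 := abs_le.1 (side2 t)
  rw [abs_le]
  constructor <;> linarith [e1.1, e1.2, e2.1, e2.2]

/-! ### Nearly uniform weights and the removal of the diagonal. -/

section ExpansionError

variable {α : Type*} [MeasurableSpace α] {n : ℕ}

/-- Weights on pairs with total mass one that are close to the uniform weights `n⁻²`. -/
structure NearUniform (C : ℝ) (a : Fin n → Fin n → ℝ) : Prop where
  sum_eq_one : ∑ i, ∑ j, a i j = 1
  abs_le : ∀ i j, |a i j| ≤ C / n ^ 2
  marginal : ∀ i, |∑ j, (a i j + a j i) - 2 / n| ≤ C / n ^ 2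

theorem nearUniform_const (hn : 0 < n) :
    NearUniform 1 fun _ _ : Fin n => ((n : ℝ) ^ 2)⁻¹ := by
  have hn0 : (n : ℝ) ≠ 0 := Nat.cast_ne_zero.2 hn.ne'
  refine ⟨?_, fun i j => ?_, fun i => ?_⟩
  · simp
    field_simp
  · rw [abs_of_nonneg (by positivity), one_div]
  · have : ∑ _j : Fin n, (((n : ℝ) ^ 2)⁻¹ + ((n : ℝ) ^ 2)⁻¹) - 2 / n = 0 := by
      simp
      field_simp
      ring
    rw [this, abs_zero]
    positivity

/-- The weights with the diagonal removed. -/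
def offDiag (a : Fin n → Fin n → ℝ) (i j : Fin n) : ℝ := if i = j then 0 else a i j

theorem offDiag_self (a : Fin n → Fin n → ℝ) (i : Fin n) : offDiag a i i = 0 := if_pos rfl

theorem offDiag_eq_sub (a : Fin n → Fin n → ℝ) (i j : Fin n) :
    offDiag a i j = a i j - if i = j then a i i else 0 := by
  unfold offDiag
  split_ifs with h
  · rw [h, sub_self]
  · rw [sub_zero]

theorem sum_offDiag (a : Fin n → Fin n → ℝ) :
    ∑ i, ∑ j, offDiag a i j = ∑ i, ∑ j, a i j - ∑ i, a i i := by
  simp_rw [offDiag_eq_sub, Finset.sum_sub_distrib]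
  simp

omit [MeasurableSpace α] in
-- As `G` takes a single value on the diagonal, the diagonal terms are deterministic and contribute
-- bias only.
theorem pairStat_eq_offDiag (a : Fin n → Fin n → ℝ) {G : α → α → ℝ} {g : ℝ}
    (hg : ∀ x, G x x = g) (y : Fin n → α) :
    pairStat a G y = pairStat (offDiag a) G y + (∑ i, a i i) * g := by
  unfold pairStat
  simp_rw [offDiag_eq_sub, sub_mul, Finset.sum_sub_distrib, ite_mul, zero_mul]
  simp [hg, Finset.sum_mul]

namespace NearUniform

variable {C : ℝ} {a : Fin n → Fin n → ℝ}

theorem const_nonneg (h : NearUniform C a) (hn : 0 < n) : 0 ≤ C := by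
  have h1 := (abs_nonneg _).trans (h.abs_le ⟨0, hn⟩ ⟨0, hn⟩)
  have hn0 : (0 : ℝ) < n := Nat.cast_pos.2 hn
  by_contra hc
  exact absurd h1 (not_le.2 (div_neg_of_neg_of_pos (not_le.1 hc) (by positivity)))

theorem abs_offDiag_le (h : NearUniform C a) (hn : 0 < n) (i j : Fin n) :
    |offDiag a i j| ≤ 3 * C / n ^ 2 := by
  have hC := h.const_nonneg hn
  unfold offDiag
  split_ifs
  · rw [abs_zero]; positivity
  · refine (h.abs_le i j).trans ?_
    gcongr
    linarith

/-- Dropping the diagonal changes the marginal by `2 * a i i`, so the constant grows from `C` to `C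
+ 2 C`. -/
theorem abs_marginal_offDiag_le (h : NearUniform C a) (i : Fin n) :
    |∑ j, (offDiag a i j + offDiag a j i) - 2 / n| ≤ 3 * C / n ^ 2 := by
  have e : ∑ j, (offDiag a i j + offDiag a j i) - 2 / n
      = (∑ j, (a i j + a j i) - 2 / n) - 2 * a i i := by
    simp_rw [offDiag_eq_sub, Finset.sum_add_distrib, Finset.sum_sub_distrib]
    simp
    ring
  rw [e]
  refine (abs_sub _ _).trans ?_
  rw [abs_mul, abs_two]
  have := h.abs_le i i
  have := h.marginal i
  have e2 : 3 * C / (n : ℝ) ^ 2 = C / n ^ 2 + 2 * (C / n ^ 2) := by ring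
  rw [e2]
  linarith

theorem abs_sum_diag_le (h : NearUniform C a) (hn : 0 < n) : |∑ i, a i i| ≤ C / n := by
  have hn0 : (n : ℝ) ≠ 0 := Nat.cast_ne_zero.2 hn.ne'
  refine (Finset.abs_sum_le_sum_abs _ _).trans
    ((Finset.sum_le_sum fun i _ => h.abs_le i i).trans (le_of_eq ?_))
  simp
  field_simp

end NearUniform

/-- The error of the linear expansion of a pairwise statistic. -/
noncomputable def expansionError (b : Fin n → Fin n → ℝ) (G : α → α → ℝ) (ψ : α → ℝ)
    (Q : Measure α) (y : Fin n → α) : ℝ :=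
  pairStat b G y - (∑ i, ∑ j, b i j) * (∫ x, ∫ z, G x z ∂Q ∂Q)
    - 2 / n * ∑ i, (ψ (y i) - ∫ x, ψ x ∂Q)

theorem integrable_sq_expansionError (b : Fin n → Fin n → ℝ) {G : α → α → ℝ} (hG : PairKernel G)
    {ψ : α → ℝ} (hψ : Measurable ψ) (hψb : ∃ M : ℝ, ∀ x, |ψ x| ≤ M) (Q : Measure α)
    {ν : Measure (Fin n → α)} [IsFiniteMeasure ν] :
    Integrable (fun y => expansionError b G ψ Q y ^ 2) ν := by
  unfold expansionError
  obtain ⟨M, hM⟩ := hG.bounded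
  obtain ⟨A, hA⟩ := hψb
  refine integrable_of_bounded ((((measurable_pairStat hG.measurable).sub_const _).sub
    (by fun_prop)).pow_const 2) ⟨(∑ i, ∑ j, |b i j| * M
      + |(∑ i, ∑ j, b i j) * ∫ x, ∫ z, G x z ∂Q ∂Q|
      + |2 / (n : ℝ)| * ∑ _i : Fin n, (A + |∫ x, ψ x ∂Q|)) ^ 2, fun y => abs_sq_le_of_abs_le
      ((abs_sub _ _).trans (add_le_add ((abs_sub _ _).trans (add_le_add ?_ le_rfl)) ?_))⟩
  · exact (Finset.abs_sum_le_sum_abs _ _).trans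
      (Finset.sum_le_sum fun i _ => abs_sum_mul_le _ _ _ fun j => hM _ _)
  · rw [abs_mul]
    refine mul_le_mul_of_nonneg_left ?_ (abs_nonneg _)
    exact (Finset.abs_sum_le_sum_abs _ _).trans (Finset.sum_le_sum fun i _ =>
      (abs_sub _ _).trans (add_le_add (hA _) le_rfl))

theorem integral_sq_expansionError_le {G : α → α → ℝ} (hG : PairKernel G) (Q : Measure α)
    [IsProbabilityMeasure Q] {ψ : α → ℝ} (hψ : Measurable ψ) (hψb : ∃ M : ℝ, ∀ x, |ψ x| ≤ M)
    (hn : 0 < n) {C : ℝ} {a : Fin n → Fin n → ℝ} (ha : NearUniform C a) :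
    n * ∫ y, expansionError (offDiag a) G ψ Q y ^ 2 ∂(Measure.pi fun _ : Fin n => Q)
      ≤ (891 * C ^ 2 + 12) * ((∫ x, ∫ y, G x y ^ 2 ∂Q ∂Q) / n
        + ∫ x, ((∫ z, G x z ∂Q) - ψ x) ^ 2 ∂Q) := by
  have h := integral_sq_expansion_error_le hG Q hψ hψb hn (offDiag_self a)
    (ha.abs_offDiag_le hn) ha.abs_marginal_offDiag_le
  rwa [show 99 * (3 * C) ^ 2 + 12 = 891 * C ^ 2 + 12 by ring] at h

/-- Decomposition of a normalized pairwise statistic. -/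
theorem sqrt_mul_pairStat_sub (hn : 0 < n) {C : ℝ} {a : Fin n → Fin n → ℝ} (ha : NearUniform C a)
    {G : α → α → ℝ} {g : ℝ} (hg : ∀ x, G x x = g) (ψ : α → ℝ) (Q : Measure α) (β : ℝ)
    (y : Fin n → α) :
    √(n : ℝ) * (pairStat a G y - β) - standardizedSum (fun x => 2 * ψ x) Q y
      = √(n : ℝ) * expansionError (offDiag a) G ψ Q y
        + √(n : ℝ) * ((∑ i, a i i) * g + (1 - ∑ i, a i i) * (∫ x, ∫ z, G x z ∂Q ∂Q) - β) := by
  have hn0 : (0 : ℝ) < n := Nat.cast_pos.2 hn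
  have e : standardizedSum (fun x => 2 * ψ x) Q y
      = √(n : ℝ) * (2 / n * ∑ i, (ψ (y i) - ∫ x, ψ x ∂Q)) := by
    unfold standardizedSum
    rw [integral_const_mul]
    simp_rw [← mul_sub, ← Finset.mul_sum]
    have hs : (√(n : ℝ))⁻¹ = √(n : ℝ) / n := by
      rw [inv_eq_one_div, div_eq_div_iff (by positivity) (by positivity), one_mul,
        Real.mul_self_sqrt hn0.le]
    rw [hs]
    ring
  rw [e, pairStat_eq_offDiag a hg, expansionError, sum_offDiag, ha.sum_eq_one]
  ring

theorem abs_standardizedSum_le (hn : 0 < n) {φ : α → ℝ} {M : ℝ} (hM : ∀ x, |φ x| ≤ M)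
    (Q : Measure α) [IsProbabilityMeasure Q] (y : Fin n → α) :
    |standardizedSum φ Q y| ≤ √(n : ℝ) * (2 * M) := by
  have hn0 : (0 : ℝ) < n := Nat.cast_pos.2 hn
  have hm : |∫ x, φ x ∂Q| ≤ M := by
    simpa using norm_integral_le_of_norm_le_const (μ := Q) (f := φ) (Eventually.of_forall hM)
  unfold standardizedSum
  rw [abs_mul, abs_of_nonneg (by positivity), inv_mul_le_iff₀ (by positivity), ← mul_assoc,
    Real.mul_self_sqrt hn0.le]
  refine (Finset.abs_sum_le_sum_abs _ _).trans ((Finset.sum_le_sum fun i _ =>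
    (abs_sub _ _).trans (add_le_add (hM (y i)) hm)).trans (le_of_eq ?_))
  simp
  ring

theorem abs_mean_le (hn : 0 < n) {f : Fin n → ℝ} {M : ℝ} (hM : ∀ i, |f i| ≤ M) :
    |(n : ℝ)⁻¹ * ∑ i, f i| ≤ M := by
  have hn0 : (0 : ℝ) < n := Nat.cast_pos.2 hn
  rw [abs_mul, abs_of_nonneg (by positivity), inv_mul_le_iff₀ hn0]
  refine (Finset.abs_sum_le_sum_abs _ _).trans ((Finset.sum_le_sum fun i _ => hM i).trans ?_)
  simp

end ExpansionError

/-! ### Linear expansion of pairwise statistics in both worlds. -/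

section PairwiseExpansion

variable {d : ℕ} {Q : Measure (E d)} [IsProbabilityMeasure Q]

/-- Adding a negligible function of the data to a bootstrap statistic. -/
theorem negligible_bootstrap_add {r : (n : ℕ) → (Fin n → E d) → (Fin n → E d) → ℝ}
    (hr : ∀ ε : ℝ, 0 < ε → Negligible Q fun n x => (bootstrapLaw x).real {y | ε ≤ |r n x y|})
    {e : (n : ℕ) → (Fin n → E d) → ℝ} (he : Negligible Q e) {ε : ℝ} (hε : 0 < ε) :
    Negligible Q fun n x => (bootstrapLaw x).real {y | ε ≤ |r n x y + e n x|} := fun δ hδ => by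
  have h := (hr _ (half_pos hε) δ hδ).add (he _ (half_pos hε))
  rw [add_zero] at h
  refine squeeze_zero' (Eventually.of_forall fun n => measureReal_nonneg) ?_ h
  filter_upwards [eventually_gt_atTop 0] with n hn
  refine (measureReal_mono fun x (hx : δ ≤ _) => ?_).trans (measureReal_union_le _ _)
  by_contra hc
  simp only [Set.mem_union, Set.mem_ofPred_eq, not_or, not_le] at hc
  have := isProbabilityMeasure_bootstrapLaw hn x
  rw [abs_of_nonneg measureReal_nonneg] at hx
  rw [abs_of_nonneg measureReal_nonneg] at hc
  refine absurd (hx.trans (measureReal_mono fun y (hy : ε ≤ _) => ?_)) (not_le.2 hc.1)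
  rw [Set.mem_ofPred_eq]
  linarith [abs_add_le (r n x y) (e n x), hc.2]

variable {G : ℕ → E d → E d → ℝ} {ψ : E d → ℝ}

/-- Uniform weights have diagonal mass exactly `1 / n`, so the sequence is eventually zero for any
`g`. For this reason the plug-in estimators need no condition on `√n g n / n`. -/
theorem tendsto_uniform_diagonal (g : ℕ → ℝ) :
    Tendsto (fun n : ℕ => √(n : ℝ) * ((1 / n - ∑ _i : Fin n, ((n : ℝ) ^ 2)⁻¹) * g n)) atTop
      (𝓝 0) := by
  refine tendsto_const_nhds.congr' ?_
  filter_upwards [eventually_gt_atTop 0] with n hn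
  have hn0 : (n : ℝ) ≠ 0 := Nat.cast_ne_zero.2 hn.ne'
  have : (1 / n - ∑ _i : Fin n, ((n : ℝ) ^ 2)⁻¹) = 0 := by
    simp
    field_simp
    simp
  rw [this]
  simp

theorem tendsto_const_mul_add_zero {u v : ℕ → ℝ} (hu : Tendsto u atTop (𝓝 0))
    (hv : Tendsto v atTop (𝓝 0)) (C : ℝ) : Tendsto (fun n => C * (u n + v n)) atTop (𝓝 0) := by
  simpa using (hu.add hv).const_mul C

/-- The expansion error is negligible under independent sampling. -/
theorem negligible_expansionError (hG : ∀ n, PairKernel (G n)) (hψ : Measurable ψ)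
    (hψb : ∃ M : ℝ, ∀ x, |ψ x| ≤ M) {C : ℝ} {a : (n : ℕ) → Fin n → Fin n → ℝ}
    (ha : ∀ᶠ n in atTop, NearUniform C (a n))
    (hV : Tendsto (fun n : ℕ => (∫ x, ∫ y, G n x y ^ 2 ∂Q ∂Q) / n) atTop (𝓝 0))
    (hE : Tendsto (fun n : ℕ => ∫ x, ((∫ z, G n x z ∂Q) - ψ x) ^ 2 ∂Q) atTop (𝓝 0)) :
    Negligible Q fun n y => √(n : ℝ) * expansionError (offDiag (a n)) (G n) ψ Q y := by
  refine Negligible.of_sq (Negligible.of_integral ?_ (fun n x => sq_nonneg _) ?_)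
  · refine Eventually.of_forall fun n => ?_
    simp_rw [mul_pow]
    exact (integrable_sq_expansionError _ (hG n) hψ hψb _).const_mul _
  · refine squeeze_zero' (Eventually.of_forall fun n => integral_nonneg fun x => sq_nonneg _) ?_
      (tendsto_const_mul_add_zero hV hE (891 * C ^ 2 + 12))
    filter_upwards [eventually_gt_atTop 0, ha] with n hn ha
    simp_rw [mul_pow, integral_const_mul, Real.sq_sqrt (Nat.cast_nonneg (α := ℝ) n)]
    exact integral_sq_expansionError_le (hG n) Q hψ hψb hn ha

/-- The expansion error is negligible under the bootstrap. -/
theorem negligible_bootstrap_expansionError (hG : ∀ n, PairKernel (G n)) (hψ : Measurable ψ)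
    (hψb : ∃ M : ℝ, ∀ x, |ψ x| ≤ M) {C : ℝ} {a : (n : ℕ) → Fin n → Fin n → ℝ}
    (ha : ∀ᶠ n in atTop, NearUniform C (a n)) {g : ℕ → ℝ} (hg : ∀ n x, G n x x = g n)
    (hg0 : Tendsto (fun n : ℕ => g n / n) atTop (𝓝 0))
    (hV : Tendsto (fun n : ℕ => (∫ x, ∫ y, G n x y ^ 2 ∂Q ∂Q) / n) atTop (𝓝 0))
    (hE : Tendsto (fun n : ℕ => ∫ x, ((∫ z, G n x z ∂Q) - ψ x) ^ 2 ∂Q) atTop (𝓝 0))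
    {ε : ℝ} (hε : 0 < ε) :
    Negligible Q fun n x => (bootstrapLaw x).real
      {y | ε ≤ |√(n : ℝ) * expansionError (offDiag (a n)) (G n) ψ (empiricalLaw x) y|} := by
  obtain ⟨A, hA⟩ := hψb
  have hg1 : Tendsto (fun n : ℕ => (|g n| / n) ^ 2) atTop (𝓝 0) := by
    have := (hg0.pow 2)
    rw [zero_pow two_ne_zero] at this
    refine this.congr fun n => ?_
    rw [div_pow, div_pow, sq_abs]
  -- Under the empirical law the second-moment bound is a random variable. `h1` and `h2` treat its
  -- two pieces through their expectations; the diagonal pairs of the empirical double sums add `(g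
  -- n / n)²`.
  have h1 : Negligible Q fun n (x : Fin n → E d) =>
      ((n : ℝ)⁻¹ * ∑ i, (n : ℝ)⁻¹ * ∑ j, G n (x i) (x j) ^ 2) / n := by
    refine Negligible.of_integral ?_ (fun n x => by positivity) ?_
    · filter_upwards [eventually_gt_atTop 0] with n hn
      obtain ⟨M, hM⟩ := (hG n).bounded
      refine Integrable.div_const (integrable_of_bounded ?_ ⟨M ^ 2, fun x => abs_mean_le hn
        fun i => abs_mean_le hn fun j => abs_sq_le_of_abs_le (hM _ _)⟩) _
      exact (Finset.measurable_sum _ fun i _ => (Finset.measurable_sum _ fun j _ =>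
        (measurable_uncurry_eval (hG n).measurable i j).pow_const 2).const_mul _).const_mul _
    · have hl := hg1.add hV
      rw [add_zero] at hl
      refine squeeze_zero' (Eventually.of_forall fun n => integral_nonneg fun x => by positivity)
        ?_ hl
      filter_upwards [eventually_gt_atTop 0] with n hn
      have hn0 : (0 : ℝ) < n := Nat.cast_pos.2 hn
      rw [integral_div, div_pow, sq (n : ℝ), ← div_div, ← add_div]
      gcongr
      exact integral_empirical_sq_le (hG n) Q (fun x => (congrArg abs (hg n x)).le) hn
  have h2 : Negligible Q fun n (x : Fin n → E d) =>
      (n : ℝ)⁻¹ * ∑ i, ((n : ℝ)⁻¹ * ∑ j, G n (x i) (x j) - ψ (x i)) ^ 2 := by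
    refine Negligible.of_integral ?_ (fun n x => by positivity) ?_
    · filter_upwards [eventually_gt_atTop 0] with n hn
      obtain ⟨M, hM⟩ := (hG n).bounded
      refine integrable_of_bounded ?_ ⟨(M + A) ^ 2, fun x => abs_mean_le hn
        fun i => abs_sq_le_of_abs_le ((abs_sub _ _).trans (add_le_add
          (abs_mean_le hn fun j => hM _ _) (hA _)))⟩
      refine (Finset.measurable_sum _ fun i _ => ((Measurable.const_mul (Finset.measurable_sum _
        fun j _ => measurable_uncurry_eval (hG n).measurable i j) _).sub ?_).pow_const 2).const_mul _
      fun_prop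
    · have hl := ((hg1.add (hV.const_mul 5)).add hE).const_mul 4
      rw [mul_zero, add_zero, add_zero, mul_zero] at hl
      refine squeeze_zero' (Eventually.of_forall fun n => integral_nonneg fun x => by positivity)
        ?_ hl
      filter_upwards [eventually_gt_atTop 0] with n hn
      exact integral_empirical_error_le (hG n) Q (fun x => (congrArg abs (hg n x)).le) hn hψ
        ⟨A, hA⟩
  -- Chebyshev's inequality conditionally on the data.
  refine ((h1.add h2).const_mul ((891 * C ^ 2 + 12) / ε ^ 2)).mono ?_
  filter_upwards [eventually_gt_atTop 0, ha] with n hn ha x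
  have := isProbabilityMeasure_bootstrapLaw hn x
  have := isProbabilityMeasure_empiricalLaw hn x
  rw [abs_of_nonneg measureReal_nonneg]
  refine le_trans ?_ (le_abs_self _)
  have key := integral_sq_expansionError_le (hG n) (empiricalLaw x) hψ ⟨A, hA⟩ hn ha
  simp only [integral_empiricalLaw] at key
  have hm := measureReal_le_integral_div (ν := bootstrapLaw x) (ε := ε ^ 2)
    (f := fun y => (√(n : ℝ) * expansionError (offDiag (a n)) (G n) ψ (empiricalLaw x) y) ^ 2)
    (by
      simp_rw [mul_pow]
      exact (integrable_sq_expansionError _ (hG n) hψ ⟨A, hA⟩ _).const_mul _)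
    (fun y => sq_nonneg _) (by positivity)
  refine le_trans (measureReal_mono fun y (hy : ε ≤ _) => ?_) (hm.trans ?_)
  · rw [Set.mem_ofPred_eq, ← sq_abs (_ * _)]
    gcongr
  · simp_rw [mul_pow, integral_const_mul, Real.sq_sqrt (Nat.cast_nonneg (α := ℝ) n)]
    rw [div_mul_eq_mul_div]
    exact div_le_div_of_nonneg_right key (by positivity)

/-- A sequence of pairwise statistics with nearly uniform weights has a linear expansion. -/
theorem linearExpansion_pairStat (hG : ∀ n, PairKernel (G n)) (hψ : Measurable ψ)
    (hψb : ∃ M : ℝ, ∀ x, |ψ x| ≤ M) {C : ℝ} {a : (n : ℕ) → Fin n → Fin n → ℝ}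
    (ha : ∀ᶠ n in atTop, NearUniform C (a n)) {g : ℕ → ℝ} (hg : ∀ n x, G n x x = g n)
    (hg0 : Tendsto (fun n : ℕ => g n / n) atTop (𝓝 0))
    (hag : Tendsto (fun n : ℕ => √(n : ℝ) * ((1 / n - ∑ i, a n i i) * g n)) atTop (𝓝 0))
    (hV : Tendsto (fun n : ℕ => (∫ x, ∫ y, G n x y ^ 2 ∂Q ∂Q) / n) atTop (𝓝 0))
    (hE : Tendsto (fun n : ℕ => ∫ x, ((∫ z, G n x z ∂Q) - ψ x) ^ 2 ∂Q) atTop (𝓝 0))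
    (hD : ∃ D : ℝ, ∀ n, |∫ x, ∫ z, G n x z ∂Q ∂Q| ≤ D) :
    LinearExpansion Q (fun x => 2 * ψ x) (fun n => pairStat (a n) (G n)) 1
      (fun n => ∫ x, ∫ z, G n x z ∂Q ∂Q) (fun n => g n / n) := by
  obtain ⟨D, hD⟩ := hD
  set θ : ℕ → ℝ := fun n => ∫ x, ∫ z, G n x z ∂Q ∂Q with hθ
  have hsqrt : Tendsto (fun n : ℕ => √(n : ℝ) / n) atTop (𝓝 0) := by
    have : Tendsto (fun n : ℕ => (√(n : ℝ))⁻¹) atTop (𝓝 0) :=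
      (Real.tendsto_sqrt_atTop.comp tendsto_natCast_atTop_atTop).inv_tendsto_atTop
    refine this.congr fun n => ?_
    rw [Real.sqrt_div_self', one_div]
  -- the expansion under sampling, for arbitrary weights
  have hsamp : ∀ {C : ℝ} {a : (n : ℕ) → Fin n → Fin n → ℝ},
      (∀ᶠ n in atTop, NearUniform C (a n)) →
      Tendsto (fun n : ℕ => √(n : ℝ) * ((1 / n - ∑ i, a n i i) * g n)) atTop (𝓝 0) →
      Negligible Q fun n x => √(n : ℝ) * (pairStat (a n) (G n) x - θ n - g n / n)
        - 1 * standardizedSum (fun x => 2 * ψ x) Q x := by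
    intro C a ha hag
    have hdiag : Tendsto (fun n : ℕ => √(n : ℝ) * ((∑ i, a n i i) * θ n)) atTop (𝓝 0) := by
      have hl := hsqrt.mul_const (C * D)
      rw [zero_mul] at hl
      refine squeeze_zero_norm' ?_ hl
      filter_upwards [eventually_gt_atTop 0, ha] with n hn ha
      have h1 := ha.abs_sum_diag_le hn
      have hC := ha.const_nonneg hn
      rw [Real.norm_eq_abs, abs_mul, abs_mul, abs_of_nonneg (Real.sqrt_nonneg _)]
      calc √(n : ℝ) * (|∑ i, a n i i| * |θ n|) ≤ √(n : ℝ) * (C / n * D) := by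
            gcongr
            exact hD n
        _ = _ := by ring
    refine (((negligible_expansionError hG hψ hψb ha hV hE).add
      ((Negligible.of_tendsto hag).const_mul (-1))).add
      ((Negligible.of_tendsto hdiag).const_mul (-1))).congr ?_
    filter_upwards [eventually_gt_atTop 0, ha] with n hn ha x
    rw [one_mul, sub_sub, sqrt_mul_pairStat_sub hn ha (hg n)]
    ring
  have hunif : ∀ᶠ n : ℕ in atTop, NearUniform 1 fun _ _ : Fin n => ((n : ℝ) ^ 2)⁻¹ :=
    (eventually_gt_atTop 0).mono fun n hn => nearUniform_const hn
  have hV0 := hsamp hunif (tendsto_uniform_diagonal g)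
  refine ⟨fun n => measurable_pairStat (hG n).measurable, hsamp ha hag, fun ε hε => ?_⟩
  obtain ⟨A, hA⟩ := hψb
  -- The kernel mean under the empirical law, the bootstrap counterpart of `θ n`. It includes the
  -- diagonal pairs, which is how the bootstrap acquires the bias `g n / n`.
  set V : (n : ℕ) → (Fin n → E d) → ℝ :=
    fun n => pairStat (fun _ _ : Fin n => ((n : ℝ) ^ 2)⁻¹) (G n) with hVdef
  have hVeq : ∀ n (x : Fin n → E d), ∫ y, ∫ z, G n y z ∂(empiricalLaw x) ∂(empiricalLaw x)
      = V n x := fun n x => by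
    simp only [integral_empiricalLaw, hVdef, pairStat, ← Finset.mul_sum]
    ring
  -- The bootstrap mean is built on `V`, whereas the bootstrap difference is centred at the
  -- statistic itself. The two have the same sampling expansion, so their difference is
  -- `o(n^{-1/2})` in probability.
  have hdiff := hV0.add ((hsamp ha hag).const_mul (-1))
  -- The diagonal mass is `O(1/n)`. Writing `√n V` as remainder, mean with bias, and standardized
  -- sum, each of the last two is `O(√n)` by crude bounds and disappears after division by `n`.
  have hdV : Negligible Q fun n x => √(n : ℝ) * ((∑ i, a n i i) * V n x) := by
    have hC : ∃ n : ℕ, 0 < n ∧ NearUniform C (a n) :=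
      ((eventually_gt_atTop 0).and ha).exists
    obtain ⟨m, hm, ham⟩ := hC
    have hC := ham.const_nonneg hm
    have hl1 : Tendsto (fun n : ℕ => C * (√(n : ℝ) / n * (D + |g n / n|))) atTop (𝓝 0) := by
      have := ((hsqrt.mul (tendsto_const_nhds (x := D) |>.add hg0.abs))).const_mul C
      simpa using this
    have hl2 : Tendsto (fun n : ℕ => C * (√(n : ℝ) / n * (2 * (2 * A)))) atTop (𝓝 0) := by
      simpa using (hsqrt.mul_const (2 * (2 * A))).const_mul C
    refine (((hV0.const_mul C).abs.add (Negligible.of_tendsto hl1)).add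
      (Negligible.of_tendsto hl2)).mono ?_
    filter_upwards [eventually_gt_atTop 0, ha] with n hn ha x
    have hn0 : (0 : ℝ) < n := Nat.cast_pos.2 hn
    have hn1 : (1 : ℝ) ≤ n := by exact_mod_cast hn
    refine le_trans ?_ (le_abs_self _)
    set r := √(n : ℝ) * (V n x - θ n - g n / n)
      - 1 * standardizedSum (fun x => 2 * ψ x) Q x with hr
    set Z := standardizedSum (fun x => 2 * ψ x) Q x with hZ
    have hZle : |Z| ≤ √(n : ℝ) * (2 * (2 * A)) :=
      abs_standardizedSum_le hn (fun z => by rw [abs_mul, abs_two]; gcongr; exact hA z) Q x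
    have e : √(n : ℝ) * ((∑ i, a n i i) * V n x)
        = (∑ i, a n i i) * (r + √(n : ℝ) * (θ n + g n / n) + Z) := by
      rw [hr]; ring
    rw [e, abs_mul]
    have hsum : |r + √(n : ℝ) * (θ n + g n / n) + Z|
        ≤ |r| + √(n : ℝ) * (D + |g n / n|) + √(n : ℝ) * (2 * (2 * A)) := by
      refine (abs_add_le _ _).trans (add_le_add ((abs_add_le _ _).trans (add_le_add le_rfl ?_)) hZle)
      rw [abs_mul, abs_of_nonneg (Real.sqrt_nonneg _)]
      refine mul_le_mul_of_nonneg_left ?_ (Real.sqrt_nonneg _)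
      exact (abs_add_le _ _).trans (add_le_add (hD n) le_rfl)
    calc |∑ i, a n i i| * |r + √(n : ℝ) * (θ n + g n / n) + Z|
        ≤ C / n * (|r| + √(n : ℝ) * (D + |g n / n|) + √(n : ℝ) * (2 * (2 * A))) :=
          mul_le_mul (ha.abs_sum_diag_le hn) hsum (abs_nonneg _) (by positivity)
      _ = C * |r| / n + C * (√(n : ℝ) / n * (D + |g n / n|))
          + C * (√(n : ℝ) / n * (2 * (2 * A))) := by ring
      _ ≤ |C * r| + C * (√(n : ℝ) / n * (D + |g n / n|))
          + C * (√(n : ℝ) / n * (2 * (2 * A))) := by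
          rw [abs_mul, abs_of_nonneg hC]
          gcongr
          exact div_le_self (by positivity) hn1
  refine (negligible_bootstrap_add (fun ε hε => negligible_bootstrap_expansionError hG hψ ⟨A, hA⟩
    ha hg hg0 hV hE hε) ((hdiff.add ((Negligible.of_tendsto hag).const_mul (-1))).add
      (hdV.const_mul (-1))) hε).congr ?_
  filter_upwards [eventually_gt_atTop 0, ha] with n hn ha x
  congr 1
  ext y
  simp only [Set.mem_ofPred_eq]
  rw [one_mul, sub_sub, sqrt_mul_pairStat_sub hn ha (hg n), hVeq, hVdef]
  apply iff_of_eq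
  congr 2
  ring

end PairwiseExpansion

/-! ### Bandwidth conditions and the expansion of kernel statistics. -/

section KernelStatistics

variable {d : ℕ}

/-- The pair kernel `(x, y) ↦ G_h (x - y)`. -/
noncomputable def diffKernel (G : E d → ℝ) (h : ℝ) (x y : E d) : ℝ := scaledKernel G h (x - y)

/-- The mean of the density smoothed by the kernel `G` at bandwidth `h`. -/
noncomputable def smoothedMean (f₀ G : E d → ℝ) (h : ℝ) : ℝ :=
  ∫ x, smooth (scaledKernel G h) f₀ x ∂(densityLaw f₀)

/-- Bandwidths for which both the squared bias and the variance of the density estimator vanish,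
the former at rate `o(n^{-1/2})`. -/
structure AdmissibleBandwidth (d : ℕ) (S : ℝ) (h : ℕ → ℝ) : Prop where
  pos : ∀ n, 0 < h n
  bias : Tendsto (fun n : ℕ => √(n : ℝ) * (h n ^ S) ^ 2) atTop (𝓝 0)
  var : Tendsto (fun n : ℕ => (n : ℝ) * h n ^ d) atTop atTop

theorem AdmissibleBandwidth.bias_zero {S : ℝ} {h : ℕ → ℝ} (hh : AdmissibleBandwidth d S h) :
    Tendsto (fun n : ℕ => (h n ^ S) ^ 2) atTop (𝓝 0) := by
  refine squeeze_zero' (Eventually.of_forall fun n => sq_nonneg _) ?_ hh.bias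
  filter_upwards [eventually_ge_atTop 1] with n hn
  have : (1 : ℝ) ≤ √(n : ℝ) := Real.one_le_sqrt.2 (by exact_mod_cast hn)
  nlinarith [sq_nonneg (h n ^ S)]

theorem AdmissibleBandwidth.const_mul {S : ℝ} {h : ℕ → ℝ} (hh : AdmissibleBandwidth d S h) {c : ℝ}
    (hc : 0 < c) : AdmissibleBandwidth d S fun n => c * h n where
  pos n := mul_pos hc (hh.pos n)
  bias := by
    have := hh.bias.const_mul ((c ^ S) ^ 2)
    rw [mul_zero] at this
    refine this.congr fun n => ?_
    rw [Real.mul_rpow hc.le (hh.pos n).le]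
    ring
  var := by
    refine (hh.var.const_mul_atTop (pow_pos hc d)).congr fun n => ?_
    rw [mul_pow]
    ring

theorem AdmissibleBandwidth.tendsto_div {S : ℝ} {h : ℕ → ℝ} (hh : AdmissibleBandwidth d S h)
    (C : ℝ) : Tendsto (fun n : ℕ => C / h n ^ d / n) atTop (𝓝 0) := by
  refine (hh.var.const_div_atTop C).congr fun n => ?_
  rw [div_div, mul_comm]

theorem tendsto_sqrt_mul_rpow {S : ℝ} {h : ℕ → ℝ} (hh : ∀ n, 0 < h n)
    (hu : Tendsto (fun n : ℕ => (n : ℝ) * h n ^ (4 * S)) atTop (𝓝 0)) :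
    Tendsto (fun n : ℕ => √(n : ℝ) * (h n ^ S) ^ 2) atTop (𝓝 0) := by
  have := (Real.continuous_sqrt.tendsto 0).comp hu
  rw [Real.sqrt_zero] at this
  refine this.congr fun n => ?_
  have e : h n ^ (4 * S) = ((h n ^ S) ^ 2) ^ 2 := by
    rw [mul_comm, Real.rpow_mul (hh n).le, ← pow_mul]
    exact_mod_cast Real.rpow_natCast _ 4
  rw [Function.comp_apply, e, Real.sqrt_mul (Nat.cast_nonneg n), Real.sqrt_sq (sq_nonneg _)]

theorem ConditionB.admissibleBandwidth {P s : ℝ} {h : ℕ → ℝ} (hB : ConditionB d P s h)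
    (hh : ∀ n, 0 < h n) : AdmissibleBandwidth d (exponentS P s) h :=
  ⟨hh, tendsto_sqrt_mul_rpow hh hB.upper, hB.lower⟩

theorem ConditionBPlus.tendsto_sqrt_mul {P s : ℝ} {h : ℕ → ℝ} (hB : ConditionBPlus d P s h)
    (hh : ∀ n, 0 < h n) : Tendsto (fun n : ℕ => √(n : ℝ) * h n ^ d) atTop atTop := by
  refine (Real.tendsto_sqrt_atTop.comp hB.lower).congr fun n => ?_
  rw [Function.comp_apply, Real.sqrt_mul (Nat.cast_nonneg n), mul_comm 2 d, pow_mul,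
    Real.sqrt_sq (pow_pos (hh n) d).le]

theorem ConditionBPlus.admissibleBandwidth {P s : ℝ} {h : ℕ → ℝ} (hB : ConditionBPlus d P s h)
    (hh : ∀ n, 0 < h n) : AdmissibleBandwidth d (exponentS P s) h := by
  refine ⟨hh, tendsto_sqrt_mul_rpow hh hB.upper, ?_⟩
  refine tendsto_atTop_mono' _ ?_ (hB.tendsto_sqrt_mul hh)
  filter_upwards [eventually_ge_atTop 1] with n hn
  have : √(n : ℝ) ≤ n := Real.sqrt_le_iff.2 ⟨Nat.cast_nonneg n, by
    have : (1 : ℝ) ≤ n := by exact_mod_cast hn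
    nlinarith⟩
  have := hh n
  gcongr

/-- What (B⁺) adds to (B): diagonal terms, of order `1 / (n h^d)`, become `o(n^{-1/2})`. -/
theorem ConditionBPlus.tendsto_sqrt_mul_div {P s : ℝ} {h : ℕ → ℝ} (hB : ConditionBPlus d P s h)
    (hh : ∀ n, 0 < h n) (C : ℝ) :
    Tendsto (fun n : ℕ => √(n : ℝ) * (C / h n ^ d / n)) atTop (𝓝 0) := by
  refine ((hB.tendsto_sqrt_mul hh).const_div_atTop C).congr' ?_
  filter_upwards [eventually_gt_atTop 0] with n hn
  have hn0 : (0 : ℝ) < n := Nat.cast_pos.2 hn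
  have := hh n
  have hs : √(n : ℝ) ≠ 0 := by positivity
  rw [div_div, mul_div_assoc', div_eq_div_iff (by positivity) (by positivity)]
  linear_combination C * h n ^ d * (-Real.mul_self_sqrt hn0.le)

variable {f₀ : E d → ℝ}

theorem GoodKernel.pairKernel {G : E d → ℝ} {P : ℝ} (hG : GoodKernel G P) {h : ℝ} (hh : 0 < h) :
    PairKernel (diffKernel G h) := by
  obtain ⟨M, hM⟩ := hG.bounded
  refine ⟨(measurable_scaledKernel hG.measurable h).comp (measurable_fst.sub measurable_snd),
    ⟨_, fun x y => abs_scaledKernel_le hM hh _⟩, fun x y => ?_⟩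
  rw [diffKernel, ← neg_sub, scaledKernel_neg hG.even, diffKernel]

theorem integral_densityLaw_le [IsProbabilityMeasure (densityLaw f₀)] (hf₀ : Measurable f₀)
    (h0 : ∀ x, 0 ≤ f₀ x) {M : ℝ} (hM : ∀ x, |f₀ x| ≤ M) {g : E d → ℝ} (hg : Integrable g)
    (hg0 : ∀ x, 0 ≤ g x) : ∫ x, g x ∂(densityLaw f₀) ≤ M * ∫ x, g x := by
  rw [integral_densityLaw hf₀ h0, ← integral_const_mul]
  refine integral_mono_of_nonneg (ae_of_all _ fun x => mul_nonneg (h0 x) (hg0 x))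
    (hg.const_mul M) (ae_of_all _ fun x => ?_)
  exact mul_le_mul_of_nonneg_right ((le_abs_self _).trans (hM x)) (hg0 x)

/-- Kernel pairwise statistics with nearly uniform weights have a linear expansion. -/
theorem GoodKernel.linearExpansion [IsProbabilityMeasure (densityLaw f₀)] {G : E d → ℝ}
    {P s S : ℝ} (hG : GoodKernel G P) (hf₀ : Measurable f₀) (h0 : ∀ x, 0 ≤ f₀ x)
    (hb : ∃ M : ℝ, ∀ x, |f₀ x| ≤ M) (hB : MemBesovTwoInfty s f₀) (hS : 0 < S) (hSs : S ≤ s)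
    (hSP : S < P) {h : ℕ → ℝ} (hh : AdmissibleBandwidth d S h) {C : ℝ}
    {a : (n : ℕ) → Fin n → Fin n → ℝ} (ha : ∀ᶠ n in atTop, NearUniform C (a n))
    (hag : Tendsto (fun n : ℕ => √(n : ℝ) * ((1 / n - ∑ i, a n i i) * (G 0 / h n ^ d))) atTop
      (𝓝 0)) :
    LinearExpansion (densityLaw f₀) (fun x => 2 * f₀ x)
      (fun n => pairStat (a n) (diffKernel G (h n))) 1
      (fun n => smoothedMean f₀ G (h n)) (fun n => G 0 / h n ^ d / n) := by
  obtain ⟨D, hD0, hD⟩ := hG.exists_kernelBounds hf₀ h0 hb hB hS hSs hSP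
  have hsm : ∀ n x, ∫ z, diffKernel G (h n) x z ∂(densityLaw f₀)
      = smooth (scaledKernel G (h n)) f₀ x := fun n x =>
    smooth_eq_integral_densityLaw hf₀ h0 _ x
  have hmean : ∀ n, ∫ x, ∫ z, diffKernel G (h n) x z ∂(densityLaw f₀) ∂(densityLaw f₀)
      = smoothedMean f₀ G (h n) := fun n => by simp_rw [hsm]; rfl
  simp_rw [← hmean]
  refine linearExpansion_pairStat (fun n => hG.pairKernel (hh.pos n)) hf₀ hb ha
    (fun n x => ?_) (hh.tendsto_div _) hag ?_ ?_ ?_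
  · rw [diffKernel, sub_self, scaledKernel_zero]
  -- The kernel has second moment `O(h^{-d})`, so this is the place where `n h^d → ∞` gives a
  -- negligible degenerate part.
  · refine squeeze_zero (fun n => by positivity) (fun n => ?_) (hh.tendsto_div D)
    have h1 := norm_integral_le_of_norm_le_const (μ := densityLaw f₀) (C := D / h n ^ d)
      (f := fun x => ∫ y, diffKernel G (h n) x y ^ 2 ∂(densityLaw f₀)) (ae_of_all _ fun x => by
        rw [Real.norm_of_nonneg (integral_nonneg fun y => sq_nonneg _)]
        exact (hD _ (hh.pos n)).sq_le x)
    rw [probReal_univ, mul_one] at h1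
    exact div_le_div_of_nonneg_right ((le_abs_self _).trans h1) (Nat.cast_nonneg n)
  · obtain ⟨M, hM⟩ := hb
    simp_rw [hsm]
    have hl := (hh.bias_zero.const_mul D).const_mul M
    rw [mul_zero, mul_zero] at hl
    refine squeeze_zero (fun n => integral_nonneg fun x => sq_nonneg _) (fun n => ?_) hl
    have hf1 := (integrable_density hf₀ h0).1
    have hi := integrable_scaledKernel hG.integrable (hh.pos n)
    have hm2 : MemLp (fun x => smooth (scaledKernel G (h n)) f₀ x - f₀ x) 2 :=
      memLp_two_of_integrable_of_bounded ((integrable_smooth hi hf1).sub hf1) (M := D + M)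
        fun x => (abs_sub _ _).trans (add_le_add ((hD _ (hh.pos n)).abs_smooth_le x) (hM x))
    have hM0 : 0 ≤ M := (abs_nonneg _).trans (hM 0)
    exact (integral_densityLaw_le hf₀ h0 hM hm2.integrable_sq fun x => sq_nonneg _).trans
      (mul_le_mul_of_nonneg_left (hD _ (hh.pos n)).error_le hM0)
  · refine ⟨D, fun n => ?_⟩
    have h1 := norm_integral_le_of_norm_le_const (μ := densityLaw f₀) (C := D)
      (f := fun x => ∫ y, diffKernel G (h n) x y ∂(densityLaw f₀)) (ae_of_all _ fun x => by
        rw [hsm]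
        exact (hD _ (hh.pos n)).abs_smooth_le x)
    rwa [probReal_univ, mul_one] at h1

/-- The locally robust combination has bias `o(n^{-1/2})`. -/
theorem GoodKernel.tendsto_locallyRobust_bias [IsProbabilityMeasure (densityLaw f₀)] {K : E d → ℝ}
    {P s S : ℝ} (hK : GoodKernel K P) (hf₀ : Measurable f₀) (h0 : ∀ x, 0 ≤ f₀ x)
    (hb : ∃ M : ℝ, ∀ x, |f₀ x| ≤ M) (hB : MemBesovTwoInfty s f₀) (hS : 0 < S) (hSs : S ≤ s)
    (hSP : S < P) {h : ℕ → ℝ} (hh : AdmissibleBandwidth d S h) :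
    Tendsto (fun n : ℕ => √(n : ℝ) * (2 * smoothedMean f₀ K (h n)
      - smoothedMean f₀ (smooth K K) (h n) - averageDensity f₀)) atTop (𝓝 0) := by
  obtain ⟨D, hD0, hD⟩ := hK.exists_kernelBounds hf₀ h0 hb hB hS hSs hSP
  obtain ⟨M, hM⟩ := hb
  have hl := hh.bias.const_mul D
  rw [mul_zero] at hl
  refine squeeze_zero_norm (fun n => ?_) hl
  rw [smoothedMean, smoothedMean, locallyRobust_bias hK (hh.pos n) hf₀ h0 hM, Real.norm_eq_abs,
    abs_mul, abs_neg, abs_of_nonneg (Real.sqrt_nonneg _),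
    abs_of_nonneg (integral_nonneg fun x => sq_nonneg _), mul_left_comm]
  exact mul_le_mul_of_nonneg_left (hD _ (hh.pos n)).error_le (Real.sqrt_nonneg _)

end KernelStatistics

/-! ### The estimators as pairwise statistics. -/

section Representations

variable {d n : ℕ} {K : E d → ℝ}

theorem thetaAD_eq_pairStat (K : E d → ℝ) (h : ℝ) (x : Fin n → E d) :
    thetaAD K h x = pairStat (fun _ _ => ((n : ℝ) ^ 2)⁻¹) (diffKernel K h) x := by
  simp only [thetaAD, kde, pairStat, diffKernel, ← Finset.mul_sum]
  ring

theorem thetaADLO_eq_pairStat (b : ℕ) (K : E d → ℝ) (h : ℝ) (x : Fin n → E d) :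
    thetaADLO b K h x
      = pairStat (fun i j => (n : ℝ)⁻¹ * leaveOutWeight b i j) (diffKernel K h) x := by
  simp only [thetaADLO, kdeLO, pairStat, diffKernel, Finset.mul_sum, mul_assoc]

/-- Expanding the square leaves integrals of products of two translates of `K_h`; as `K` is even,
these are values of `K_h ∗ K_h` at differences of observations. -/
theorem integral_sq_weighted_kernel {P h : ℝ} (hK : GoodKernel K P) (hh : 0 < h) (c : Fin n → ℝ)
    (x : Fin n → E d) :
    ∫ u, (∑ j, c j * scaledKernel K h (u - x j)) ^ 2
      = ∑ i, ∑ j, c i * c j * diffKernel (smooth K K) h (x i) (x j) := by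
  obtain ⟨M, hM⟩ := hK.bounded
  set H := scaledKernel K h with hH
  have h1 : ∀ i, MemLp (fun u => H (u - x i)) 2 := fun i =>
    memLp_two_of_integrable_of_bounded
      ((integrable_scaledKernel hK.integrable hh).comp_sub_right (x i))
      fun u => abs_scaledKernel_le hM hh _
  have h2 : ∀ i j, ∫ u, H (u - x i) * H (u - x j) = diffKernel (smooth K K) h (x i) (x j) := by
    intro i j
    rw [diffKernel, scaledKernel_smooth K hh, smooth, ← integral_add_right_eq_self _ (x j)]
    refine integral_congr_ae (ae_of_all _ fun u => ?_)
    simp only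
    rw [← scaledKernel_neg hK.even (x i - x j - u), add_sub_cancel_right,
      show -(x i - x j - u) = u + x j - x i by abel]
  have h3 : ∀ i j, Integrable fun u => c i * c j * (H (u - x i) * H (u - x j)) := fun i j =>
    ((h1 i).integrable_mul (h1 j)).const_mul _
  have e : ∀ u, (∑ j, c j * H (u - x j)) ^ 2
      = ∑ i, ∑ j, c i * c j * (H (u - x i) * H (u - x j)) := fun u => by
    rw [sq, Finset.sum_mul_sum]
    exact Finset.sum_congr rfl fun i _ => Finset.sum_congr rfl fun j _ => by ring
  simp_rw [e]
  rw [integral_finsetSum _ fun i _ => integrable_finsetSum _ fun j _ => h3 i j]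
  refine Finset.sum_congr rfl fun i _ => ?_
  rw [integral_finsetSum _ fun j _ => h3 i j]
  refine Finset.sum_congr rfl fun j _ => ?_
  rw [integral_const_mul, h2]

theorem thetaISD_eq_pairStat {P h : ℝ} (hK : GoodKernel K P) (hh : 0 < h) (x : Fin n → E d) :
    thetaISD K h x = pairStat (fun _ _ => ((n : ℝ) ^ 2)⁻¹) (diffKernel (smooth K K) h) x := by
  simp only [thetaISD, kde, Finset.mul_sum]
  rw [integral_sq_weighted_kernel hK hh fun _ => (n : ℝ)⁻¹]
  simp only [pairStat]
  rw [← sq, inv_pow]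

theorem thetaISDLO_eq_pairStat {P h : ℝ} (hK : GoodKernel K P) (hh : 0 < h) (b : ℕ)
    (x : Fin n → E d) :
    thetaISDLO b K h x = pairStat
      (fun i j => (n : ℝ)⁻¹ * ∑ k, leaveOutWeight b k i * leaveOutWeight b k j)
      (diffKernel (smooth K K) h) x := by
  simp only [thetaISDLO, kdeLO, pairStat, integral_sq_weighted_kernel hK hh]
  simp_rw [Finset.mul_sum, Finset.sum_mul]
  rw [Finset.sum_comm]
  refine Finset.sum_congr rfl fun i _ => ?_
  rw [Finset.sum_comm]
  exact Finset.sum_congr rfl fun j _ => Finset.sum_congr rfl fun k _ => by ring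

/-- Identifies the diagonal value of the kernel `K ∗ K` with the constant in the bias correction of
the integrated squared density estimator. -/
theorem smooth_self_zero (hK : ∀ u, K (-u) = K u) : smooth K K 0 = ∫ u, K u ^ 2 := by
  rw [smooth]
  refine integral_congr_ae (ae_of_all _ fun u => ?_)
  simp only
  rw [zero_sub, hK, sq]

end Representations

/-! ### Near uniformity of the leave-out weights. -/

section LeaveOut

variable {n b : ℕ}

/-- In zero-based positions block `p + 1` is the interval from `⌊p n / b⌋` up to but excluding `⌊(p
+ 1) n / b⌋`; the divisions on the right are in `ℕ`. -/
theorem block_eq_succ_iff (hn : 0 < n) (hb : 0 < b) (i : Fin n) (p : ℕ) :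
    block b i = p + 1 ↔ p * n / b ≤ (i : ℕ) ∧ (i : ℕ) < (p + 1) * n / b := by
  have hn0 : (0 : ℝ) < n := Nat.cast_pos.2 hn
  rw [block, Nat.ceil_eq_iff (Nat.succ_ne_zero p), Nat.succ_sub_one, lt_div_iff₀ hn0,
    div_le_iff₀ hn0]
  have e1 : ((p : ℝ) * n < ((i : ℕ) + 1 : ℕ) * (b : ℝ)) ↔ p * n / b ≤ (i : ℕ) := by
    rw [← Nat.lt_succ_iff, Nat.div_lt_iff_lt_mul hb]
    exact_mod_cast Iff.rfl
  have e2 : (((i : ℕ) + 1 : ℕ) * (b : ℝ) ≤ ((p + 1 : ℕ) : ℝ) * n)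
      ↔ (i : ℕ) < (p + 1) * n / b := by
    rw [← Nat.succ_le_iff, Nat.le_div_iff_mul_le hb]
    exact_mod_cast Iff.rfl
  exact and_congr e1 e2

theorem exists_block_eq_succ (hn : 0 < n) (hb : 0 < b) (i : Fin n) :
    ∃ p < b, block b i = p + 1 := by
  have hn0 : (0 : ℝ) < n := Nat.cast_pos.2 hn
  have hb0 : (0 : ℝ) < b := Nat.cast_pos.2 hb
  have h1 : 0 < block b i := Nat.ceil_pos.2 (by positivity)
  have h2 : block b i ≤ b := Nat.ceil_le.2 (by
    rw [div_le_iff₀ hn0, mul_comm]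
    have : (((i : ℕ) + 1 : ℕ) : ℝ) ≤ n := by exact_mod_cast i.2
    gcongr)
  exact ⟨block b i - 1, by omega, by omega⟩

/-- Blocks have sizes `⌊n / b⌋` or `⌊n / b⌋ + 1`. -/
theorem card_block (hn : 0 < n) (hb : 0 < b) (i : Fin n) :
    n / b ≤ (Finset.univ.filter fun k : Fin n => block b i = block b k).card ∧
      (Finset.univ.filter fun k : Fin n => block b i = block b k).card ≤ n / b + 1 := by
  obtain ⟨p, hp, hi⟩ := exists_block_eq_succ hn hb i
  have e : (Finset.univ.filter fun k : Fin n => block b i = block b k).map Fin.valEmbedding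
      = Finset.Ico (p * n / b) ((p + 1) * n / b) := by
    ext k
    simp only [Finset.mem_map, Finset.mem_filter, Finset.mem_univ, true_and,
      Fin.valEmbedding_apply, Finset.mem_Ico]
    constructor
    · rintro ⟨j, hj, rfl⟩
      exact (block_eq_succ_iff hn hb j p).1 (hj ▸ hi)
    · intro hk
      have hkn : k < n := hk.2.trans_le (Nat.div_le_of_le_mul (Nat.mul_le_mul_right n hp))
      exact ⟨⟨k, hkn⟩, by rw [hi, (block_eq_succ_iff hn hb ⟨k, hkn⟩ p).2 hk], rfl⟩
  have hc := congrArg Finset.card e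
  rw [Finset.card_map, Nat.card_Ico, add_mul, one_mul] at hc
  rw [hc, Nat.add_div hb, add_assoc, Nat.add_sub_cancel_left]
  split_ifs <;> simp

/-- The number of observations outside the block of `i`. -/
noncomputable def leaveOutCount (b : ℕ) (i : Fin n) : ℝ :=
  ∑ k : Fin n, if block b i ≠ block b k then 1 else 0

theorem leaveOutCount_eq (i : Fin n) : leaveOutCount b i
    = n - (Finset.univ.filter fun k : Fin n => block b i = block b k).card := by
  have h := Finset.card_filter_add_card_filter_not (s := (Finset.univ : Finset (Fin n)))
    fun k : Fin n => block b i = block b k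
  rw [Finset.card_univ, Fintype.card_fin] at h
  rw [leaveOutCount, Finset.sum_boole, eq_sub_iff_add_eq, add_comm]
  exact_mod_cast h

/-- Block sizes take only two consecutive values. This makes the weights almost symmetric in `i` and
`j`. -/
theorem abs_leaveOutCount_sub_le (hn : 0 < n) (hb : 0 < b) (i j : Fin n) :
    |leaveOutCount b i - leaveOutCount b j| ≤ 1 := by
  obtain ⟨h1, h2⟩ := card_block hn hb i
  obtain ⟨h3, h4⟩ := card_block hn hb j
  rw [leaveOutCount_eq, leaveOutCount_eq, abs_le]
  have h5 : ((Finset.univ.filter fun k : Fin n => block b i = block b k).card : ℝ)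
    ≤ (Finset.univ.filter fun k : Fin n => block b j = block b k).card + 1 := by
    exact_mod_cast by omega
  have h6 : ((Finset.univ.filter fun k : Fin n => block b j = block b k).card : ℝ)
    ≤ (Finset.univ.filter fun k : Fin n => block b i = block b k).card + 1 := by
    exact_mod_cast by omega
  constructor <;> linarith

/-- With at least two blocks a block has at most `n / 2 + 1` members, so at least `n / 2 - 1`
observations remain, and this is at least `n / 4` once `n ≥ 4`. -/
theorem le_leaveOutCount (hn : 4 ≤ n) (hb : 2 ≤ b) (i : Fin n) :
    (n : ℝ) / 4 ≤ leaveOutCount b i := by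
  obtain ⟨h1, h2⟩ := card_block (n := n) (b := b) (by omega) (by omega) i
  have h3 : n / b ≤ n / 2 := Nat.div_le_div_left hb two_pos
  have h6 : 2 * (Finset.univ.filter fun k : Fin n => block b i = block b k).card ≤ n + 2 := by
    generalize (Finset.univ.filter fun k : Fin n => block b i = block b k).card = m at *
    generalize n / b = q at *
    omega
  have h4 : (2 * (Finset.univ.filter fun k : Fin n => block b i = block b k).card : ℝ)
      ≤ n + 2 := by
    exact_mod_cast h6
  have h5 : (4 : ℝ) ≤ n := by exact_mod_cast hn
  rw [leaveOutCount_eq]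
  linarith

theorem leaveOutWeight_eq (i j : Fin n) : leaveOutWeight b i j
    = (if block b i ≠ block b j then 1 else 0) / leaveOutCount b i := rfl

section

variable (hn : 4 ≤ n) (hb : 2 ≤ b)
include hn hb

theorem sum_leaveOutWeight (i : Fin n) : ∑ j, leaveOutWeight b i j = 1 := by
  have h4 : (4 : ℝ) ≤ n := by exact_mod_cast hn
  have h := le_leaveOutCount hn hb i
  simp_rw [leaveOutWeight_eq, ← Finset.sum_div]
  exact div_self (by linarith : (0 : ℝ) < leaveOutCount b i).ne'

theorem abs_leaveOutWeight_le (i j : Fin n) : |leaveOutWeight b i j| ≤ 4 / n := by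
  have h4 : (4 : ℝ) ≤ n := by exact_mod_cast hn
  have h := le_leaveOutCount hn hb i
  have h0 : 0 < leaveOutCount b i := by linarith
  rw [leaveOutWeight_eq, abs_div, abs_of_pos h0, div_le_div_iff₀ h0 (by linarith)]
  split_ifs <;> simp <;> linarith

/-- Row sums are one, and column sums are compared with them term by term. For different blocks the
weights `1 / N_j` and `1 / N_i` differ by `|N_i - N_j| / (N_i N_j) ≤ 16 / n²`, where `N` is the
leave-out count. -/
theorem abs_sum_leaveOutWeight_sub_one_le (i : Fin n) :
    |∑ j, leaveOutWeight b j i - 1| ≤ 16 / n := by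
  have h4 : (4 : ℝ) ≤ n := by exact_mod_cast hn
  rw [← sum_leaveOutWeight hn hb i, ← Finset.sum_sub_distrib]
  have key : ∀ j, |leaveOutWeight b j i - leaveOutWeight b i j| ≤ 16 / n ^ 2 := fun j => by
    have hi := le_leaveOutCount hn hb i
    have hj := le_leaveOutCount hn hb j
    have hi0 : 0 < leaveOutCount b i := by linarith
    have hj0 : 0 < leaveOutCount b j := by linarith
    have hd := abs_leaveOutCount_sub_le (b := b) (by omega) (by omega) i j
    rw [leaveOutWeight_eq, leaveOutWeight_eq]
    simp only [ne_comm (a := block b j)]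
    split_ifs
    · rw [div_sub_div _ _ hj0.ne' hi0.ne', abs_div, abs_of_pos (mul_pos hj0 hi0), one_mul, mul_one,
        div_le_div_iff₀ (mul_pos hj0 hi0) (by positivity)]
      nlinarith [mul_le_mul hj hi (by positivity) hj0.le]
    · simp
      positivity
  refine (Finset.abs_sum_le_sum_abs _ _).trans ((Finset.sum_le_sum fun j _ => key j).trans
    (le_of_eq ?_))
  simp
  field_simp

/-- The constant `16` would do. The value `32` is the one needed by the integrated squared density
weights, so that the two systems share a constant. -/
theorem nearUniform_leaveOutWeight :
    NearUniform 32 fun i j : Fin n => (n : ℝ)⁻¹ * leaveOutWeight b i j := by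
  have h4 : (4 : ℝ) ≤ n := by exact_mod_cast hn
  have hn0 : (0 : ℝ) < n := by linarith
  refine ⟨?_, fun i j => ?_, fun i => ?_⟩
  · simp_rw [← Finset.mul_sum, sum_leaveOutWeight hn hb]
    simp
    field_simp
  · rw [abs_mul, abs_of_pos (inv_pos.2 hn0)]
    calc (n : ℝ)⁻¹ * |leaveOutWeight b i j| ≤ (n : ℝ)⁻¹ * (4 / n) := by
          gcongr
          exact abs_leaveOutWeight_le hn hb i j
      _ = 4 / n ^ 2 := by field_simp
      _ ≤ _ := by gcongr; norm_num
  · have e : ∑ j, ((n : ℝ)⁻¹ * leaveOutWeight b i j + (n : ℝ)⁻¹ * leaveOutWeight b j i) - 2 / n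
        = (n : ℝ)⁻¹ * (∑ j, leaveOutWeight b j i - 1) := by
      rw [Finset.sum_add_distrib, ← Finset.mul_sum, ← Finset.mul_sum, sum_leaveOutWeight hn hb]
      field_simp
      ring
    rw [e, abs_mul, abs_of_pos (inv_pos.2 hn0)]
    calc (n : ℝ)⁻¹ * |∑ j, leaveOutWeight b j i - 1| ≤ (n : ℝ)⁻¹ * (16 / n) := by
          gcongr
          exact abs_sum_leaveOutWeight_sub_one_le hn hb i
      _ = 16 / n ^ 2 := by field_simp
      _ ≤ _ := by gcongr; norm_num

/-- These weights are symmetric, and because the leave-out rows sum to one, both marginals are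
column sums of the leave-out weights divided by `n`; hence `2 · 16 = 32`. -/
theorem nearUniform_leaveOutWeight_mul : NearUniform 32 fun i j : Fin n =>
    (n : ℝ)⁻¹ * ∑ k, leaveOutWeight b k i * leaveOutWeight b k j := by
  have h4 : (4 : ℝ) ≤ n := by exact_mod_cast hn
  have hn0 : (0 : ℝ) < n := by linarith
  have hrow : ∀ i : Fin n, ∑ j, ∑ k, leaveOutWeight b k i * leaveOutWeight b k j
      = ∑ k, leaveOutWeight b k i := fun i => by
    rw [Finset.sum_comm]
    simp_rw [← Finset.mul_sum, sum_leaveOutWeight hn hb, mul_one]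
  refine ⟨?_, fun i j => ?_, fun i => ?_⟩
  · simp_rw [← Finset.mul_sum, hrow]
    rw [Finset.sum_comm]
    simp_rw [sum_leaveOutWeight hn hb]
    simp
    field_simp
  · calc |(n : ℝ)⁻¹ * ∑ k, leaveOutWeight b k i * leaveOutWeight b k j| ≤ (4 / n) * (4 / n) :=
          abs_mean_le (by omega) fun k => by
            rw [abs_mul]
            exact mul_le_mul (abs_leaveOutWeight_le hn hb _ _) (abs_leaveOutWeight_le hn hb _ _)
              (abs_nonneg _) (by positivity)
      _ = 16 / n ^ 2 := by field_simp; norm_num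
      _ ≤ _ := by gcongr; norm_num
  · have e : ∑ j, ((n : ℝ)⁻¹ * ∑ k, leaveOutWeight b k i * leaveOutWeight b k j
          + (n : ℝ)⁻¹ * ∑ k, leaveOutWeight b k j * leaveOutWeight b k i) - 2 / n
        = 2 * ((n : ℝ)⁻¹ * (∑ k, leaveOutWeight b k i - 1)) := by
      simp_rw [mul_comm (leaveOutWeight b _ _) (leaveOutWeight b _ i), ← two_mul,
        ← Finset.mul_sum, hrow]
      field_simp
    rw [e, abs_mul, abs_mul, abs_two, abs_of_pos (inv_pos.2 hn0)]
    calc 2 * ((n : ℝ)⁻¹ * |∑ k, leaveOutWeight b k i - 1|) ≤ 2 * ((n : ℝ)⁻¹ * (16 / n)) := by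
          gcongr
          exact abs_sum_leaveOutWeight_sub_one_le hn hb i
      _ = 32 / n ^ 2 := by field_simp; norm_num

end

end LeaveOut

/-! ### The locally robust estimators. -/

section LocallyRobust

variable {d : ℕ}

theorem ConditionD.exponentS_pos {f₀ : E d → ℝ} {s P : ℝ} (hD : ConditionD f₀ s) (hP : 0 < P) :
    0 < exponentS P s :=
  lt_min (half_pos hP) (lt_of_le_of_lt (by positivity) hD.lt_smoothness)

theorem exponentS_lt {s P : ℝ} (hP : 0 < P) : exponentS P s < P :=
  (min_le_left _ _).trans_lt (half_lt_self hP)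

/-- For general nearly uniform weights the diagonal mass is only `O(1/n)`, not `1/n`, so the
diagonal itself must be `o(n^{-1/2})`. -/
theorem NearUniform.tendsto_diagonal {C : ℝ} {a : (n : ℕ) → Fin n → Fin n → ℝ}
    (ha : ∀ᶠ n in atTop, NearUniform C (a n)) {g : ℕ → ℝ}
    (hg : Tendsto (fun n : ℕ => √(n : ℝ) * (g n / n)) atTop (𝓝 0)) :
    Tendsto (fun n : ℕ => √(n : ℝ) * ((1 / n - ∑ i, a n i i) * g n)) atTop (𝓝 0) := by
  have hl := hg.abs.const_mul (1 + C)
  rw [abs_zero, mul_zero] at hl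
  refine squeeze_zero_norm' ?_ hl
  filter_upwards [eventually_gt_atTop 0, ha] with n hn ha
  have hn0 : (0 : ℝ) < n := Nat.cast_pos.2 hn
  have h1 : |1 / (n : ℝ) - ∑ i, a n i i| ≤ 1 / n + C / n :=
    (abs_sub _ _).trans (add_le_add (abs_of_nonneg (by positivity)).le (ha.abs_sum_diag_le hn))
  rw [Real.norm_eq_abs, abs_mul, abs_mul, abs_mul, abs_div, abs_of_pos hn0]
  calc |√(n : ℝ)| * (|1 / (n : ℝ) - ∑ i, a n i i| * |g n|)
      ≤ |√(n : ℝ)| * ((1 / n + C / n) * |g n|) := by gcongr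
    _ = _ := by ring

/-- The standing assumptions on the density, the kernel and the bandwidth. -/
structure Setting (f₀ K : E d → ℝ) (s P : ℝ) (h : ℕ → ℝ) : Prop where
  measurable : Measurable f₀
  nonneg : ∀ x, 0 ≤ f₀ x
  density : ConditionD f₀ s
  kernel : GoodKernel K P
  bandwidth : AdmissibleBandwidth d (exponentS P s) h

namespace Setting

variable {f₀ K : E d → ℝ} {s P : ℝ} {h : ℕ → ℝ} [IsProbabilityMeasure (densityLaw f₀)]

/-- The bias of the locally robust plug-in estimator that is due to the diagonal terms. -/
noncomputable def diagonalBias (K : E d → ℝ) (h : ℝ) (n : ℕ) : ℝ :=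
  2 * (K 0 / h ^ d / n) - smooth K K 0 / h ^ d / n

/-- The locally robust combination of two pairwise statistics has a linear expansion around the
average density. -/
theorem linearExpansion (H : Setting f₀ K s P h) {C : ℝ} {a a' : (n : ℕ) → Fin n → Fin n → ℝ}
    (ha : ∀ᶠ n in atTop, NearUniform C (a n)) (ha' : ∀ᶠ n in atTop, NearUniform C (a' n))
    (hag : ∀ D : ℝ, Tendsto (fun n : ℕ => √(n : ℝ) *
      ((1 / n - ∑ i, a n i i) * (D / h n ^ d))) atTop (𝓝 0))
    (hag' : ∀ D : ℝ, Tendsto (fun n : ℕ => √(n : ℝ) *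
      ((1 / n - ∑ i, a' n i i) * (D / h n ^ d))) atTop (𝓝 0)) :
    LinearExpansion (densityLaw f₀) (fun x => 2 * f₀ x)
      (fun n x => 2 * pairStat (a n) (diffKernel K (h n)) x
        - pairStat (a' n) (diffKernel (smooth K K) (h n)) x) 1
      (fun _ => averageDensity f₀) (fun n => diagonalBias K (h n) n) := by
  have hS := H.density.exponentS_pos H.kernel.order_pos
  have hSs : exponentS P s ≤ s := min_le_right _ _
  have hSP := exponentS_lt (s := s) H.kernel.order_pos
  have h1 := H.kernel.linearExpansion H.measurable H.nonneg H.density.bounded H.density.besov hS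
    hSs hSP H.bandwidth ha (hag _)
  have h2 := H.kernel.autoconv.linearExpansion H.measurable H.nonneg H.density.bounded
    H.density.besov hS hSs hSP H.bandwidth ha' (hag' _)
  have h3 := ((h1.const_mul 2).add (h2.const_mul (-1))).recenter (κ := fun _ => 0)
    (θ' := fun _ => averageDensity f₀) (b' := fun n => diagonalBias K (h n) n) ?_ ?_
  · refine h3.congr ?_ (by norm_num) rfl rfl
    ext n x
    ring
  · refine (H.kernel.tendsto_locallyRobust_bias H.measurable H.nonneg H.density.bounded
      H.density.besov hS hSs hSP H.bandwidth).congr fun n => ?_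
    ring
  · refine tendsto_const_nhds.congr fun n => ?_
    rw [diagonalBias]
    ring

theorem linearExpansion_thetaLR (H : Setting f₀ K s P h) :
    LinearExpansion (densityLaw f₀) (fun x => 2 * f₀ x) (fun n x => thetaLR K (h n) x) 1
      (fun _ => averageDensity f₀) (fun n => diagonalBias K (h n) n) := by
  have hu : ∀ᶠ n : ℕ in atTop, NearUniform 1 fun _ _ : Fin n => ((n : ℝ) ^ 2)⁻¹ :=
    (eventually_gt_atTop 0).mono fun n hn => nearUniform_const hn
  refine (H.linearExpansion hu hu (fun D => tendsto_uniform_diagonal _)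
    (fun D => tendsto_uniform_diagonal _)).congr ?_ rfl rfl rfl
  ext n x
  rw [thetaLR, thetaAD_eq_pairStat, thetaISD_eq_pairStat H.kernel (H.bandwidth.pos n)]

/-- A linear combination of the plug-in estimators at bandwidths `h` and `c h`, with coefficients
adding up to one. The bias sequence need not be identified, since the bootstrap has the same one. -/
theorem linearExpansion_thetaLRGJ (H : Setting f₀ K s P h) {c : ℝ} (hc : 0 < c)
    (hcd : c ^ d ≠ 1) :
    ∃ b : ℕ → ℝ, LinearExpansion (densityLaw f₀) (fun x => 2 * f₀ x)
      (fun n x => thetaLRGJ c K (h n) x) 1 (fun _ => averageDensity f₀) b := by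
  have H' : Setting f₀ K s P fun n => c * h n :=
    ⟨H.measurable, H.nonneg, H.density, H.kernel, H.bandwidth.const_mul hc⟩
  have hc1 : 1 - c ^ d ≠ 0 := sub_ne_zero.2 hcd.symm
  have hs : 1 / (1 - c ^ d) + -(c ^ d / (1 - c ^ d)) = 1 := by
    field_simp
    ring
  refine ⟨_, ((H.linearExpansion_thetaLR.const_mul (1 / (1 - c ^ d))).add
    (H'.linearExpansion_thetaLR.const_mul (-(c ^ d / (1 - c ^ d))))).congr ?_ ?_ ?_ rfl⟩
  · ext n x
    simp only [thetaLRGJ, thetaADGJ, thetaISDGJ, thetaLR]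
    ring
  · rw [mul_one, mul_one, hs]
  · ext n
    rw [← add_mul, hs, one_mul]

/-- The correction removes the diagonal bias under sampling but cancels from the bootstrap
difference. A bias common to both worlds exists because `hg` makes the diagonal bias `o(n^{-1/2})`.
-/
theorem linearExpansion_thetaLRBC (H : Setting f₀ K s P h)
    (hg : ∀ D : ℝ, Tendsto (fun n : ℕ => √(n : ℝ) * (D / h n ^ d / n)) atTop (𝓝 0)) :
    LinearExpansion (densityLaw f₀) (fun x => 2 * f₀ x) (fun n x => thetaLRBC K (h n) x) 1
      (fun _ => averageDensity f₀) (fun n => diagonalBias K (h n) n) := by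
  have h0 : Tendsto (fun n : ℕ => √(n : ℝ) * diagonalBias K (h n) n) atTop (𝓝 0) := by
    have := ((hg (K 0)).const_mul 2).sub (hg (smooth K K 0))
    rw [mul_zero, sub_zero] at this
    refine this.congr fun n => ?_
    rw [diagonalBias]
    ring
  refine (H.linearExpansion_thetaLR.recenter (κ := fun n => diagonalBias K (h n) n)
    (θ' := fun _ => averageDensity f₀) (b' := fun n => diagonalBias K (h n) n) ?_ ?_).congr ?_ rfl
    rfl rfl
  · have := h0.neg
    rw [neg_zero] at this
    refine this.congr fun n => ?_
    ring
  · simp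
  · ext n x
    rw [thetaLRBC, thetaADBC, thetaISDBC, thetaLR, diagonalBias,
      ← smooth_self_zero H.kernel.even, div_div, div_div, mul_comm (h n ^ d)]
    ring

/-- The diagonal mass of the leave-out weights need not be `1/n`, whereas the bootstrap bias comes
from the diagonal pairs of the empirical law. The two biases are reconciled by `hg`, which makes
both negligible. -/
theorem linearExpansion_thetaLRLO (H : Setting f₀ K s P h)
    (hg : ∀ D : ℝ, Tendsto (fun n : ℕ => √(n : ℝ) * (D / h n ^ d / n)) atTop (𝓝 0)) {B : ℕ → ℕ}
    (hB : ∀ n, 2 ≤ n → 2 ≤ B n) :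
    LinearExpansion (densityLaw f₀) (fun x => 2 * f₀ x) (fun n x => thetaLRLO (B n) K (h n) x) 1
      (fun _ => averageDensity f₀) (fun n => diagonalBias K (h n) n) := by
  have ha : ∀ᶠ n : ℕ in atTop, NearUniform 32 fun i j : Fin n =>
      (n : ℝ)⁻¹ * leaveOutWeight (B n) i j :=
    (eventually_ge_atTop 4).mono fun n hn => nearUniform_leaveOutWeight hn (hB n (by omega))
  have ha' : ∀ᶠ n : ℕ in atTop, NearUniform 32 fun i j : Fin n =>
      (n : ℝ)⁻¹ * ∑ k, leaveOutWeight (B n) k i * leaveOutWeight (B n) k j :=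
    (eventually_ge_atTop 4).mono fun n hn => nearUniform_leaveOutWeight_mul hn (hB n (by omega))
  refine (H.linearExpansion ha ha' (fun D => NearUniform.tendsto_diagonal ha (hg D))
    (fun D => NearUniform.tendsto_diagonal ha' (hg D))).congr ?_ rfl rfl rfl
  ext n x
  rw [thetaLRLO, thetaADLO_eq_pairStat, thetaISDLO_eq_pairStat H.kernel (H.bandwidth.pos n)]

end Setting

theorem varianceBound_eq {f₀ : E d → ℝ} [IsProbabilityMeasure (densityLaw f₀)]
    (hf₀ : Measurable f₀) (hb : ∃ M : ℝ, ∀ x, |f₀ x| ≤ M) : varianceBound f₀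
      = ∫ x, (2 * f₀ x - ∫ z, 2 * f₀ z ∂(densityLaw f₀)) ^ 2 ∂(densityLaw f₀) := by
  have hi : Integrable f₀ (densityLaw f₀) := integrable_of_bounded hf₀ hb
  have h0 : ∫ x, influence f₀ x ∂(densityLaw f₀) = 0 := by
    simp only [influence]
    rw [integral_const_mul, integral_sub hi (integrable_const _)]
    simp [averageDensity]
  have hm : AEMeasurable (influence f₀) (densityLaw f₀) := by
    unfold influence
    fun_prop
  rw [varianceBound, variance_eq_integral hm, h0, integral_const_mul]
  refine integral_congr_ae (ae_of_all _ fun x => ?_)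
  simp only [influence, averageDensity]
  ring

end LocallyRobust

end AvgDensity

theorem theorem6 {d : ℕ} (hd : 1 ≤ d)
    {Ω : Type*} [MeasurableSpace Ω] (μ : Measure Ω) [IsProbabilityMeasure μ]
    (f₀ : AvgDensity.E d → ℝ) (hf₀_meas : Measurable f₀) (hf₀_nonneg : ∀ x, 0 ≤ f₀ x)
    (X : ℕ → Ω → AvgDensity.E d) (hX_meas : ∀ i, Measurable (X i))
    (hX_indep : iIndepFun X μ) (hX_law : ∀ i, μ.map (X i) = AvgDensity.densityLaw f₀)
    (hσ₀ : 0 < AvgDensity.varianceBound f₀)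
    (s P : ℝ) (hD : AvgDensity.ConditionD f₀ s)
    (K : AvgDensity.E d → ℝ) (hK : AvgDensity.ConditionK K P)
    (h : ℕ → ℝ) (hh : ∀ n, 0 < h n)
    (c : ℝ) (hc_pos : 0 < c) (hc_ne : c ≠ 1)
    (B : ℕ → ℕ) (hB : ∀ n, 2 ≤ n → 2 ≤ B n ∧ B n ≤ n) :
    (AvgDensity.ConditionB d P s h →
      AvgDensity.BootstrapConsistent μ X (AvgDensity.averageDensity f₀)
          (fun n x => AvgDensity.thetaLR K (h n) x) ∧
        AvgDensity.BootstrapConsistent μ X (AvgDensity.averageDensity f₀)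
          (fun n x => AvgDensity.thetaLRGJ c K (h n) x)) ∧
    (AvgDensity.ConditionBPlus d P s h →
      AvgDensity.BootstrapConsistent μ X (AvgDensity.averageDensity f₀)
          (fun n x => AvgDensity.thetaLRBC K (h n) x) ∧
        AvgDensity.BootstrapConsistent μ X (AvgDensity.averageDensity f₀)
          (fun n x => AvgDensity.thetaLRLO (B n) K (h n) x)) := by
  have hprob : IsProbabilityMeasure (AvgDensity.densityLaw f₀) := by
    rw [← hX_law 0]
    exact Measure.isProbabilityMeasure_map (hX_meas 0).aemeasurable
  obtain ⟨M, hM⟩ := hD.bounded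
  rw [AvgDensity.varianceBound_eq hf₀_meas ⟨M, hM⟩] at hσ₀
  have hcons : ∀ {T : (n : ℕ) → (Fin n → AvgDensity.E d) → ℝ} {b : ℕ → ℝ},
      AvgDensity.LinearExpansion (AvgDensity.densityLaw f₀) (fun x => 2 * f₀ x) T 1
        (fun _ => AvgDensity.averageDensity f₀) b →
      AvgDensity.BootstrapConsistent μ X (AvgDensity.averageDensity f₀) T := fun hT =>
    hT.bootstrapConsistent hX_meas hX_indep hX_law (hf₀_meas.const_mul 2)
      ⟨2 * M, fun x => by rw [abs_mul, abs_two]; gcongr; exact hM x⟩ hσ₀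
  have hcd : c ^ d ≠ 1 := fun hc =>
    hc_ne ((pow_eq_one_iff_of_nonneg hc_pos.le (by omega)).1 hc)
  refine ⟨fun hBd => ?_, fun hBd => ?_⟩
  · have H : AvgDensity.Setting f₀ K s P h :=
      ⟨hf₀_meas, hf₀_nonneg, hD, hK.goodKernel, hBd.admissibleBandwidth hh⟩
    obtain ⟨b, hb⟩ := H.linearExpansion_thetaLRGJ hc_pos hcd
    exact ⟨hcons H.linearExpansion_thetaLR, hcons hb⟩
  · have H : AvgDensity.Setting f₀ K s P h :=
      ⟨hf₀_meas, hf₀_nonneg, hD, hK.goodKernel, hBd.admissibleBandwidth hh⟩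
    exact ⟨hcons (H.linearExpansion_thetaLRBC (hBd.tendsto_sqrt_mul_div hh)),
      hcons (H.linearExpansion_thetaLRLO (hBd.tendsto_sqrt_mul_div hh) fun n hn => (hB n hn).1)⟩
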